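/- **Setting.** Let $1\le N\le K$ and $T\ge 1$ be integers and let $\rho>0$ be a budget. There are $K$ LLMs (arms) $\mathcal K=\{1,\dots,K\}$, and one of three reward models is fixed: - AWC: $r(S;\mu)=1-\prod_{k\in S}(1-\mu_k)$, actions $\mathcal S=\{S\subseteq\mathcal K:|S|\le N\}$; - SUC: $r(S;\mu)=\sum_{k\in S}\mu_k$, actions $\mathcal S=\{S:|S|=N\}$; - AIC: $r(S;\mu)=\prod_{k\in S}\mu_k$, actions $\mathcal S=\{S:|S|=N\}$. In each round $t=1,\dots,T$ the environment draws, independently of the past and of the action selected in round $t$, and with the same law in every round, outcomes $X_{t,k}\in[0,1]$ with means $\mu_k$ and costs $y_{t,k}\in[0,1]$ with means $c_k$. When the action $S_t$ is selected in round $t$, the outcomes and costs of the LLMs in a random subset $\mathcal F_t\subseteq S_t$ are observed. This subset is determined by $t$, $S_t$ and the environment's randomness in round $t$. Whether $k\in S_t$ is observed is independent of $X_{t,k}$ and independent of $y_{t,k}$, but may depend on other LLMs' outcomes. Let $o_{t,S}$ be the probability that all LLMs in $S$ are observed if $S$ is selected in round $t$, and let $o^*=\min_{t\le T,\,S\in\mathcal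 S}o_{t,S}$, assumed positive. Assume that some $S\in\mathcal S$ has $\sum_{k\in S}c_k\le\rho$, let $S^*$ maximize $r(S;\mu)$ over all such $S$, and let $r^*=r(S^*;\mu)$. Let $L$ be a constant with $|r(S;\mu)-r(S;\nu)|\le L\sum_{k\in S}|\mu_k-\nu_k|$ for all $S\in\mathcal S$ and $\mu,\nu\in[0,1]^K$. Let $0\le\alpha\le1$. **Algorithm (C2MAB-V with $\delta=1/T$).** For LLM $k$ at the start of round $t$, let $n$ be the number of earlier rounds in which $k$ was observed, let $\hat\mu_{t,k},\hat c_{t,k}$ be the averages of the observed outcomes and costs, and let $\varrho=\sqrt{\ln\!\big(2\pi^2Kt^3/(3\delta)\big)/(2n)}$. Put $\bar\mu_{t,k}=\min\{\hat\mu_{t,k}+\varrho,1\}$ and $\underline c_{t,k}=\max\{\hat c_{t,k}-\varrho,0\}$, or $\bar\mu_{t,k}=1$, $\underline c_{t,k}=0$ if $n=0$. Let $\tilde r(z,\mu)$ be $1-\prod_k(1-\mu_kz_k)$ for AWC, $\sum_k\mu_kz_k$ for SUC, and $\prod_k\mu_k^{z_k}$ for AIC. The algorithm computes an $\alpha$-approximate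 solution $\tilde Z_t$ of the problem of maximizing $\tilde r(z,\bar\mu_t)$ over $z\in[0,1]^K$ with $\sum_kz_k\le N$ (AWC) or $\sum_kz_k=N$ (SUC, AIC) and $\sum_k\underline c_{t,k}z_k\le\rho$; that is, $\tilde Z_t$ is feasible and $\tilde r(\tilde Z_t,\bar\mu_t)\ge\alpha\,\tilde r(z,\bar\mu_t)$ for all feasible $z$. If the problem is infeasible, $\tilde Z_t$ is any point satisfying the constraints other than the budget constraint. Given the past, $S_t$ is then drawn by rounding $\tilde Z_t$ as follows. In both procedures the choices left open may be made in any way. - *AWC (swap rounding).* Write $\tilde Z_t=\sum_iv_i\mathbb I_{B_i}$ as a convex combination with $|B_i|\le N$ and merge the sets one after the other. To merge sets $B,B'$ of weights $p,p'$ (the weight of a merged set is the sum of the weights), where $|B|\ge|B'|$, add to $B'$ a set $G\subseteq B\setminus B'$ with $|G|=|B|-|B'|$. While $B\ne B'$, choose $i\in B\setminus B'$ and $j\in B'\setminus B$, and replace $i$ by $j$ in $B$ with probability $p'/(p+p')$, otherwise replace $j$ by $i$ in $B'$. Finally remove each element of $G$ independently with probability $p'/(p+p')$. - *SUC, AIC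 (dependent rounding).* While there are fractional coordinates, choose two of them, $z_k$ and $z_j$, and let $p=\min\{1-z_k,z_j\}$ and $q=\min\{z_k,1-z_j\}$. Move to $(z_k+p,z_j-p)$ with probability $q/(p+q)$ and to $(z_k-q,z_j+q)$ otherwise. Return the set of coordinates equal to $1$. **Theorem.** The $\alpha$-approximate regret $R(T)=\mathbb E\big[\sum_{t=1}^T\big(\alpha\, r(S^*;\mu)-r(S_t;\mu)\big)\big]$, the expectation being over the environment and the algorithm, satisfies $$R(T)\le\frac{2L}{o^*}\sqrt{2NKT\,\ln\!\Big(\frac{2\pi^2KT}{3}\Big)}+(K+1)\,r^*.$$ -/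

import Mathlib

open MeasureTheory ProbabilityTheory

noncomputable section

namespace C2MABV

/-! ## Reward models, actions and relaxations -/

/-- The three reward models: Any Win, Sum Up and All In Combination. -/
inductive RewardModel
  | AWC
  | SUC
  | AIC

/-- The reward `r(S; μ)` of the action `S` at the mean vector `μ`. -/
def reward {K : ℕ} (m : RewardModel) (S : Finset (Fin K)) (μ : Fin K → ℝ) : ℝ :=
  match m with
  | .AWC => 1 - ∏ k ∈ S, (1 - μ k)
  | .SUC => ∑ k ∈ S, μ k
  | .AIC => ∏ k ∈ S, μ k

/-- The combinatorial constraint on actions: at most `N` LLMs for AWC, exactly `N` LLMs for SUC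
and AIC. -/
def IsAction {K : ℕ} (m : RewardModel) (N : ℕ) (S : Finset (Fin K)) : Prop :=
  match m with
  | .AWC => S.card ≤ N
  | .SUC => S.card = N
  | .AIC => S.card = N

/-- The polytope spanned by the indicator vectors of the actions. -/
def polytope {K : ℕ} (m : RewardModel) (N : ℕ) : Set (Fin K → ℝ) :=
  {z | (∀ k, 0 ≤ z k ∧ z k ≤ 1) ∧
    match m with
    | .AWC => ∑ k, z k ≤ N
    | .SUC => ∑ k, z k = N
    | .AIC => ∑ k, z k = N}

/-- The relaxed reward `r̃(z, μ)` of a fractional action `z`. -/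
def relaxedReward {K : ℕ} (m : RewardModel) (z μ : Fin K → ℝ) : ℝ :=
  match m with
  | .AWC => 1 - ∏ k, (1 - μ k * z k)
  | .SUC => ∑ k, μ k * z k
  | .AIC => ∏ k, μ k ^ z k

/-- The feasible set of the relaxed problem for the cost vector `c` and the budget `ρ`. -/
def relaxedFeasible {K : ℕ} (m : RewardModel) (N : ℕ) (ρ : ℝ) (c : Fin K → ℝ) :
    Set (Fin K → ℝ) :=
  {z | z ∈ polytope m N ∧ ∑ k, c k * z k ≤ ρ}

/-- `z` is an admissible output of an `α`-approximation oracle for the relaxed problem with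
reward estimates `μ` and cost estimates `c`. When the relaxed problem has no feasible point,
the output is an arbitrary point of the polytope. -/
def IsApproxSolution {K : ℕ} (m : RewardModel) (N : ℕ) (ρ α : ℝ) (μ c z : Fin K → ℝ) : Prop :=
  z ∈ polytope m N ∧
    ((relaxedFeasible m N ρ c).Nonempty →
      z ∈ relaxedFeasible m N ρ c ∧
        ∀ z' ∈ relaxedFeasible m N ρ c, α * relaxedReward m z' μ ≤ relaxedReward m z μ)

/-- `L` is a Lipschitz constant of the reward of every action, on mean vectors in `[0,1]^K`. -/
def IsLipschitzConst (K : ℕ) (m : RewardModel) (N : ℕ) (L : ℝ) : Prop :=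
  ∀ S : Finset (Fin K), IsAction m N S → ∀ μ ν : Fin K → ℝ,
    (∀ k, 0 ≤ μ k ∧ μ k ≤ 1) → (∀ k, 0 ≤ ν k ∧ ν k ≤ 1) →
      |reward m S μ - reward m S ν| ≤ L * ∑ k ∈ S, |μ k - ν k|

/-! ## The two randomized rounding procedures -/

/-- A coin that shows `true` with probability `w`, for `w ∈ [0,1]`. -/
def coin (w : ℝ) : PMF Bool :=
  PMF.ofFintype
    (fun b => if b then ENNReal.ofReal (min w 1) else 1 - ENNReal.ofReal (min w 1))
    (by simp)

/-- The coordinate `k` of `z` is strictly between `0` and `1`. -/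
def IsFrac {K : ℕ} (z : Fin K → ℝ) (k : Fin K) : Prop := 0 < z k ∧ z k < 1

open Classical in
/-- Dependent rounding with at most `n` iterations of the loop. As long as there are two
fractional coordinates, the rule `pick` names two of them, and the pair is moved until one of the
two becomes integral. At the end, the coordinates equal to `1` are returned. Every iteration makes
a coordinate integral, so `n = K` iterations are enough. -/
def depRound {K : ℕ} (pick : (Fin K → ℝ) → Fin K × Fin K) :
    ℕ → (Fin K → ℝ) → PMF (Finset (Fin K))
  | 0, z => PMF.pure (Finset.univ.filter fun k => z k = 1)
  | n + 1, z =>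
    if ∃ k j, k ≠ j ∧ IsFrac z k ∧ IsFrac z j then
      let k := (pick z).1
      let j := (pick z).2
      let p := min (1 - z k) (z j)
      let q := min (z k) (1 - z j)
      (coin (q / (p + q))).bind fun b =>
        if b then depRound pick n (Function.update (Function.update z k (z k + p)) j (z j - p))
        else depRound pick n (Function.update (Function.update z k (z k - q)) j (z j + q))
    else PMF.pure (Finset.univ.filter fun k => z k = 1)

/-- The rule `pick` names two distinct fractional coordinates whenever there are two. -/
def IsPickRule {K : ℕ} (pick : (Fin K → ℝ) → Fin K × Fin K) : Prop :=
  ∀ z, (∃ k j, k ≠ j ∧ IsFrac z k ∧ IsFrac z j) →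
    (pick z).1 ≠ (pick z).2 ∧ IsFrac z (pick z).1 ∧ IsFrac z (pick z).2

/-- The choices left open in swap rounding: a convex decomposition of the fractional point into
indicator vectors of sets, the padding set of the smaller of two sets, and the pair of elements
that is exchanged. -/
structure SwapChoices (K : ℕ) where
  decomp : (Fin K → ℝ) → List (ℝ × Finset (Fin K))
  pad : Finset (Fin K) → Finset (Fin K) → Finset (Fin K)
  pair : Finset (Fin K) → Finset (Fin K) → Fin K × Fin K

/-- The choices are as swap rounding for sets of size at most `N` requires. -/
structure SwapChoices.Valid {K : ℕ} (c : SwapChoices K) (N : ℕ) : Prop where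
  weight_nonneg : ∀ z ∈ polytope RewardModel.AWC N, ∀ a ∈ c.decomp z, 0 ≤ a.1
  weight_sum : ∀ z ∈ polytope RewardModel.AWC N, ((c.decomp z).map fun a => a.1).sum = 1
  card_le : ∀ z ∈ polytope RewardModel.AWC N, ∀ a ∈ c.decomp z, a.2.card ≤ N
  combine : ∀ z ∈ polytope RewardModel.AWC N, ∀ k,
    ((c.decomp z).map fun a => if k ∈ a.2 then a.1 else 0).sum = z k
  pad_subset : ∀ B₁ B₂ : Finset (Fin K), B₁.card ≤ N → B₂.card ≤ B₁.card →
    c.pad B₁ B₂ ⊆ B₁ \ B₂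
  pad_card : ∀ B₁ B₂ : Finset (Fin K), B₁.card ≤ N → B₂.card ≤ B₁.card →
    (c.pad B₁ B₂).card + B₂.card = B₁.card
  pair_mem : ∀ B₁ B₂ : Finset (Fin K), B₁.card ≤ N → B₂.card = B₁.card → B₁ ≠ B₂ →
    (c.pair B₁ B₂).1 ∈ B₁ \ B₂ ∧ (c.pair B₁ B₂).2 ∈ B₂ \ B₁

/-- The exchange loop on two sets of equal size, with at most `n` iterations: with probability
`w` the first set gives up an element for one of the second set, otherwise the second set does so.
Every iteration lowers the number of elements in which the sets differ, so `n = K` is enough. -/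
def swapLoop {K : ℕ} (c : SwapChoices K) (w : ℝ) :
    ℕ → Finset (Fin K) → Finset (Fin K) → PMF (Finset (Fin K))
  | 0, B₁, _ => PMF.pure B₁
  | n + 1, B₁, B₂ =>
    if B₁ = B₂ then PMF.pure B₁
    else
      let i := (c.pair B₁ B₂).1
      let j := (c.pair B₁ B₂).2
      (coin w).bind fun b =>
        if b then swapLoop c w n (insert j (B₁.erase i)) B₂
        else swapLoop c w n B₁ (insert i (B₂.erase j))

/-- Remove each element of the list from `B`, independently, with probability `w`. -/
def removeEach {K : ℕ} (w : ℝ) : List (Fin K) → Finset (Fin K) → PMF (Finset (Fin K))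
  | [], B => PMF.pure B
  | i :: l, B => (coin w).bind fun b => removeEach w l (if b then B.erase i else B)

/-- Merge `B₁` with weight `p₁` and `B₂` with weight `p₂`, for `B₁` at least as large as `B₂`. -/
def mergeOrdered {K : ℕ} (c : SwapChoices K) (p₁ : ℝ) (B₁ : Finset (Fin K)) (p₂ : ℝ)
    (B₂ : Finset (Fin K)) : PMF (Finset (Fin K)) :=
  (swapLoop c (p₂ / (p₁ + p₂)) K B₁ (B₂ ∪ c.pad B₁ B₂)).bind fun B =>
    removeEach (p₂ / (p₁ + p₂)) (c.pad B₁ B₂).toList B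

/-- Merge two weighted sets. -/
def merge {K : ℕ} (c : SwapChoices K) (p₁ : ℝ) (B₁ : Finset (Fin K)) (p₂ : ℝ)
    (B₂ : Finset (Fin K)) : PMF (Finset (Fin K)) :=
  if B₁.card < B₂.card then mergeOrdered c p₂ B₂ p₁ B₁ else mergeOrdered c p₁ B₁ p₂ B₂

/-- Merge the current set `A` of accumulated weight `p` with the sets of the list, in order. -/
def mergeList {K : ℕ} (c : SwapChoices K) :
    ℝ → Finset (Fin K) → List (ℝ × Finset (Fin K)) → PMF (Finset (Fin K))
  | _, A, [] => PMF.pure A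
  | p, A, (v, B) :: l => (merge c p A v B).bind fun A' => mergeList c (p + v) A' l

/-- Swap rounding of the fractional point `z`. -/
def swapRound {K : ℕ} (c : SwapChoices K) (z : Fin K → ℝ) : PMF (Finset (Fin K)) :=
  match c.decomp z with
  | [] => PMF.pure ∅
  | (v, B) :: l => mergeList c v B l

/-- `σ` is the discretization rounding of the reward model: swap rounding for AWC, dependent
rounding for SUC and AIC, with any admissible choices. -/
def IsRounding {K : ℕ} (m : RewardModel) (N : ℕ) (σ : (Fin K → ℝ) → PMF (Finset (Fin K))) :
    Prop :=
  match m with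
  | .AWC => ∃ c : SwapChoices K, c.Valid N ∧ σ = swapRound c
  | .SUC => ∃ pick, IsPickRule pick ∧ σ = depRound pick K
  | .AIC => ∃ pick, IsPickRule pick ∧ σ = depRound pick K

/-! ## The environment -/

/-- One round of the environment. A point of `E`, drawn from `law`, carries all the randomness of
a round outside the algorithm: the outcome and the cost of every LLM, with values in `[0,1]`, and
the set `feedback t S` of LLMs that are queried, and hence observed, if the action `S` is selected
in round `t`. Whether an LLM is observed is decided independently of its own outcome and its own
cost; it may depend on the outcomes of other LLMs, as in a cascade that stops at the first
success. -/
structure Environment (K : ℕ) (E : Type*) [MeasurableSpace E] where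
  law : Measure E
  isProb : IsProbabilityMeasure law
  outcome : Fin K → E → ℝ
  cost : Fin K → E → ℝ
  feedback : ℕ → Finset (Fin K) → E → Finset (Fin K)
  measurable_outcome : ∀ k, Measurable (outcome k)
  measurable_cost : ∀ k, Measurable (cost k)
  measurable_feedback : ∀ t S, Measurable (feedback t S)
  outcome_mem : ∀ k x, 0 ≤ outcome k x ∧ outcome k x ≤ 1
  cost_mem : ∀ k x, 0 ≤ cost k x ∧ cost k x ≤ 1
  feedback_subset : ∀ t S x, feedback t S x ⊆ S
  indep_outcome : ∀ t S k, k ∈ S → IndepFun (outcome k) (fun x => k ∈ feedback t S x) law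
  indep_cost : ∀ t S k, k ∈ S → IndepFun (cost k) (fun x => k ∈ feedback t S x) law

section

variable {K : ℕ} {E : Type*} [MeasurableSpace E] (env : Environment K E)

/-- The mean outcome vector `μ`. -/
def Environment.mean (k : Fin K) : ℝ := ∫ x, env.outcome k x ∂env.law

/-- The mean cost vector `c`. -/
def Environment.meanCost (k : Fin K) : ℝ := ∫ x, env.cost k x ∂env.law

/-- The probability that all LLMs of the action `S` are observed in round `t`. -/
def Environment.obsProb (t : ℕ) (S : Finset (Fin K)) : ℝ :=
  env.law.real {x | env.feedback t S x = S}

/-- The set of the probabilities `o_{t,S}` over the rounds `1, …, T` and all actions `S`; its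
least element is `o*`. -/
def Environment.obsProbs (m : RewardModel) (N T : ℕ) : Set ℝ :=
  {x | ∃ t ∈ Finset.Icc 1 T, ∃ S : Finset (Fin K), IsAction m N S ∧ x = env.obsProb t S}

/-- `S` satisfies the combinatorial constraint and, in mean, the budget constraint. -/
def Environment.IsViable (m : RewardModel) (N : ℕ) (ρ : ℝ) (S : Finset (Fin K)) : Prop :=
  IsAction m N S ∧ ∑ k ∈ S, env.meanCost k ≤ ρ

/-- `S` is an optimal action `S*`: viable, and of maximal reward among the viable actions. -/
def Environment.IsOptimal (m : RewardModel) (N : ℕ) (ρ : ℝ) (S : Finset (Fin K)) : Prop :=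
  env.IsViable m N ρ S ∧
    ∀ S', env.IsViable m N ρ S' → reward m S' env.mean ≤ reward m S env.mean

/-! ## The algorithm

In what follows `e t` is the environment's randomness in round `t`, and `S t` is the action. -/

variable {Ω : Type*} (e : ℕ → Ω → E) (S : ℕ → Ω → Finset (Fin K))

/-- The set of LLMs observed in round `t`. -/
def observed (t : ℕ) (ω : Ω) : Finset (Fin K) := env.feedback t (S t ω) (e t ω)

/-- The rounds before round `t` in which LLM `k` was observed. -/
def obsRounds (t : ℕ) (k : Fin K) (ω : Ω) : Finset ℕ :=
  (Finset.Ico 1 t).filter fun τ => k ∈ observed env e S τ ω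

/-- The number of observations of LLM `k` before round `t`. -/
def obsCount (t : ℕ) (k : Fin K) (ω : Ω) : ℕ := (obsRounds env e S t k ω).card

/-- The empirical mean outcome of LLM `k` at the start of round `t`. -/
def empMean (t : ℕ) (k : Fin K) (ω : Ω) : ℝ :=
  (∑ τ ∈ obsRounds env e S t k ω, env.outcome k (e τ ω)) / obsCount env e S t k ω

/-- The empirical mean cost of LLM `k` at the start of round `t`. -/
def empCost (t : ℕ) (k : Fin K) (ω : Ω) : ℝ :=
  (∑ τ ∈ obsRounds env e S t k ω, env.cost k (e τ ω)) / obsCount env e S t k ω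

/-- The confidence radius in round `t` after `n ≥ 1` observations. -/
def radius (K : ℕ) (δ : ℝ) (t n : ℕ) : ℝ :=
  √(Real.log (2 * Real.pi ^ 2 * K * t ^ 3 / (3 * δ)) / (2 * n))

/-- The optimistic reward estimate. The radius of an LLM without observations is infinite, which
makes the estimate equal to `1`. -/
def ucb (δ : ℝ) (t : ℕ) (ω : Ω) (k : Fin K) : ℝ :=
  if obsCount env e S t k ω = 0 then 1
  else min (empMean env e S t k ω + radius K δ t (obsCount env e S t k ω)) 1

/-- The lower confidence bound of the cost, equal to `0` for an LLM without observations. -/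
def lcb (δ : ℝ) (t : ℕ) (ω : Ω) (k : Fin K) : ℝ :=
  if obsCount env e S t k ω = 0 then 0
  else max (empCost env e S t k ω - radius K δ t (obsCount env e S t k ω)) 0

/-- The information generated by the rounds before round `t`. -/
@[reducible] def past (t : ℕ) : MeasurableSpace Ω :=
  ⨆ τ ∈ Finset.Ico 1 t,
    (MeasurableSpace.comap (e τ) inferInstance ⊔ MeasurableSpace.comap (S τ) inferInstance)

variable [mΩ : MeasurableSpace Ω]

/-- A run over `T` rounds of the algorithm in the environment, with confidence parameter `δ`. In
each round `t`, an `α`-approximate solution `Z t` of the relaxed problem for the current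
confidence bounds is computed, the action `S t` is drawn from the rounding distribution
`σ t (Z t)` given the past, and then the environment draws `e t` from its law, independently of
the past and of the action. -/
structure IsRun (m : RewardModel) (N T : ℕ) (ρ α δ : ℝ) (P : Measure Ω)
    (Z : ℕ → Ω → Fin K → ℝ) (σ : ℕ → (Fin K → ℝ) → PMF (Finset (Fin K))) : Prop where
  measurable_env : ∀ t ∈ Finset.Icc 1 T, Measurable (e t)
  measurable_action : ∀ t ∈ Finset.Icc 1 T, Measurable (S t)
  rounding : ∀ t ∈ Finset.Icc 1 T, IsRounding m N (σ t)
  relaxed : ∀ t ∈ Finset.Icc 1 T, ∀ ω,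
    IsApproxSolution m N ρ α (ucb env e S δ t ω) (lcb env e S δ t ω) (Z t ω)
  action_law : ∀ t ∈ Finset.Icc 1 T, ∀ A : Finset (Fin K),
    P[Set.indicator {ω | S t ω = A} (fun _ => (1 : ℝ)) | past e S t]
      =ᵐ[P] fun ω => (σ t (Z t ω) A).toReal
  env_law : ∀ t ∈ Finset.Icc 1 T, P.map (e t) = env.law
  env_indep : ∀ t ∈ Finset.Icc 1 T,
    Indep (MeasurableSpace.comap (e t) inferInstance)
      (past e S t ⊔ MeasurableSpace.comap (S t) inferInstance) P

/-- The `α`-approximate regret over `T` rounds against the action `Sstar`. -/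
def regret (m : RewardModel) (T : ℕ) (α : ℝ) (P : Measure Ω) (Sstar : Finset (Fin K)) : ℝ :=
  ∫ ω, ∑ t ∈ Finset.Icc 1 T,
    (α * reward m Sstar env.mean - reward m (S t ω) env.mean) ∂P

end

end C2MABV

end

/-! The regret of a round is controlled by optimism. Outside a rare bad event, each `ucb` is at
least the true mean and each `lcb` at most the true mean cost. The optimal action is then feasible
for the relaxed problem, and `α` times its reward is at most the relaxed reward of the computed
point at the optimistic estimates. Rounding does not lower that value in mean
(`relaxedReward_le_pmfMean`). By the Lipschitz property, a good round costs in mean at most `L`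
times the sum of `ucb - mean` over the selected arms, and a bad round costs at most the optimal
reward. A selected arm is observed with conditional probability at least `o*`, so at the price of a
factor `1 / o*` only the rounds in which the arm is observed count (`mul_integral_action_le`).

The constant is the delicate point. Write `c` for `radiusCoeff K T`, whose logarithm contains `T ^
4`, and `c'` for `boundCoeff K T`, whose logarithm contains only `T`. Bounding `ucb - mean` by two
radii would give about `4 c √n` for an arm with `n` observations, whereas the target allows `2 c'
√n`, and `c' ≤ 2 c`. Therefore one radius is kept together with the actual deviation `M / n` of the
empirical mean, where `M` is the sum of the centred observations. The radii add up to about `2 c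
√n`, and `c' ^ 2 - c ^ 2 ≥ 27 / 10` leaves room for the deviations.

By summation by parts (`devSum_mul_harmonic`), the deviations add up to `M * (H - h)` up to a term
of mean zero, with `H` a harmonic number of the final count and `h` any constant. Since the mean of
`M ^ 2 / √n` is at most half the mean of `√n`, the inequality between the arithmetic and the
geometric mean leaves a multiple of `√n / c'` and a multiple of `c' √n (H - h) ^ 2`. With `h = log
n₀ + γ`, the second term is small for `n` near `n₀`. Elsewhere it is absorbed by the gap `(√n - √n₀)
^ 2 / √n₀` in `2 √n ≤ n / √n₀ + √n₀` (`optimism_tangent_bound`). The resulting bound is linear in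
`n`, so it can be averaged and summed over the arms, whose counts have total mean at most `N T`; the
choice `n₀ = N T / K` gives the main term.

An exponential supermartingale and a union bound over the possible counts make the expected number
of bad rounds at most `1` (`sum_measureReal_badEvent_le`). -/

noncomputable section

namespace C2MABV

/-! ## Means under a finitely supported law -/

/-- The mean of `f` under `p`. -/
def pmfMean {β : Type*} [Fintype β] (p : PMF β) (f : β → ℝ) : ℝ := ∑ a, (p a).toReal * f a

section PmfMean

variable {β : Type*} [Fintype β]

lemma sum_toReal_pmf (p : PMF β) : ∑ a, (p a).toReal = 1 := by
  have h := p.tsum_coe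
  rw [tsum_fintype] at h
  rw [← ENNReal.toReal_sum (fun a _ => p.apply_ne_top a), h, ENNReal.toReal_one]

lemma pmfMean_pure (a : β) (f : β → ℝ) : pmfMean (PMF.pure a) f = f a := by
  classical
  unfold pmfMean
  rw [Finset.sum_eq_single a]
  · simp
  · intro b _ hb
    simp [PMF.pure_apply, hb]
  · simp

lemma pmfMean_bind {γ : Type*} [Fintype γ] (p : PMF γ) (g : γ → PMF β) (f : β → ℝ) :
    pmfMean (p.bind g) f = pmfMean p fun c => pmfMean (g c) f := by
  unfold pmfMean
  have h : ∀ a, ((p.bind g) a).toReal = ∑ c, (p c).toReal * (g c a).toReal := by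
    intro a
    rw [PMF.bind_apply, tsum_fintype, ENNReal.toReal_sum]
    · simp
    · intro c _
      exact ENNReal.mul_ne_top (p.apply_ne_top c) ((g c).apply_ne_top a)
  simp_rw [h, Finset.sum_mul, Finset.mul_sum]
  rw [Finset.sum_comm]
  simp_rw [mul_assoc]

lemma pmfMean_mono_of_support {p : PMF β} {f g : β → ℝ} (h : ∀ a ∈ p.support, f a ≤ g a) :
    pmfMean p f ≤ pmfMean p g := by
  refine Finset.sum_le_sum fun a _ => ?_
  by_cases ha : a ∈ p.support
  · exact mul_le_mul_of_nonneg_left (h a ha) ENNReal.toReal_nonneg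
  · rw [PMF.mem_support_iff, not_not] at ha
    simp [ha]

lemma pmfMean_sum {ι : Type*} (p : PMF β) (s : Finset ι) (f : ι → β → ℝ) :
    pmfMean p (fun a => ∑ i ∈ s, f i a) = ∑ i ∈ s, pmfMean p (f i) := by
  unfold pmfMean
  simp_rw [Finset.mul_sum]
  exact Finset.sum_comm

lemma pmfMean_const_mul (p : PMF β) (x : ℝ) (f : β → ℝ) :
    pmfMean p (fun a => x * f a) = x * pmfMean p f := by
  unfold pmfMean
  rw [Finset.mul_sum]
  exact Finset.sum_congr rfl fun a _ => by ring

lemma pmfMean_const_sub (p : PMF β) (x : ℝ) (f : β → ℝ) :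
    pmfMean p (fun a => x - f a) = x - pmfMean p f := by
  unfold pmfMean
  simp_rw [mul_sub, Finset.sum_sub_distrib, ← Finset.sum_mul, sum_toReal_pmf, one_mul]

lemma pmfMean_coin_bind {w : ℝ} (h0 : 0 ≤ w) (h1 : w ≤ 1) (g : Bool → PMF β) (f : β → ℝ) :
    pmfMean ((coin w).bind g) f = w * pmfMean (g true) f + (1 - w) * pmfMean (g false) f := by
  rw [pmfMean_bind]
  unfold pmfMean
  rw [Fintype.sum_bool]
  simp [coin, h1, h0, ENNReal.toReal_sub_of_le, ENNReal.ofReal_le_one]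

end PmfMean

/-! ## Dependent rounding -/

section DependentRounding

variable {K : ℕ}

open Classical in
/-- The number of fractional coordinates. -/
def numFrac (z : Fin K → ℝ) : ℕ := (Finset.univ.filter (IsFrac z)).card

/-- The point obtained by moving the amount `p` from coordinate `j` to coordinate `k`. -/
def moveMass (z : Fin K → ℝ) (k j : Fin K) (p : ℝ) : Fin K → ℝ :=
  Function.update (Function.update z k (z k + p)) j (z j - p)

lemma moveMass_fst (z : Fin K → ℝ) {k j : Fin K} (h : k ≠ j) (p : ℝ) :
    moveMass z k j p k = z k + p := by
  simp [moveMass, h]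

lemma moveMass_snd (z : Fin K → ℝ) (k j : Fin K) (p : ℝ) : moveMass z k j p j = z j - p := by
  simp [moveMass]

lemma moveMass_of_ne (z : Fin K → ℝ) {k j i : Fin K} (hk : i ≠ k) (hj : i ≠ j) (p : ℝ) :
    moveMass z k j p i = z i := by
  simp [moveMass, hk, hj]

lemma moveMass_eq_add (z : Fin K → ℝ) {k j : Fin K} (h : k ≠ j) (p : ℝ) (i : Fin K) :
    moveMass z k j p i = z i + p * ((if i = k then 1 else 0) - (if i = j then 1 else 0)) := by
  by_cases hk : i = k
  · subst hk
    simp [moveMass_fst z h, h]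
  · by_cases hj : i = j
    · subst hj
      simp [moveMass_snd, hk, sub_eq_add_neg]
    · simp [moveMass_of_ne z hk hj, hk, hj]

lemma sum_moveMass (z : Fin K → ℝ) {k j : Fin K} (h : k ≠ j) (p : ℝ) :
    ∑ i, moveMass z k j p i = ∑ i, z i := by
  simp_rw [moveMass_eq_add z h, Finset.sum_add_distrib, ← Finset.mul_sum, Finset.sum_sub_distrib]
  simp

lemma moveMass_mem {z : Fin K → ℝ} (hz : ∀ i, 0 ≤ z i ∧ z i ≤ 1) {k j : Fin K} (h : k ≠ j)
    (i : Fin K) : 0 ≤ moveMass z k j (min (1 - z k) (z j)) i ∧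
      moveMass z k j (min (1 - z k) (z j)) i ≤ 1 := by
  have h1 := min_le_left (1 - z k) (z j)
  have h2 := min_le_right (1 - z k) (z j)
  have h3 : 0 ≤ min (1 - z k) (z j) := le_min (by linarith [(hz k).2]) (hz j).1
  by_cases hk : i = k
  · subst hk
    rw [moveMass_fst z h]
    constructor <;> linarith [(hz i).1]
  · by_cases hj : i = j
    · subst hj
      rw [moveMass_snd]
      constructor <;> linarith [(hz i).2]
    · rw [moveMass_of_ne z hk hj]
      exact hz i

/-- The amount moved is the largest possible, so coordinate `k` reaches `1` or coordinate `j`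
reaches `0`, and no other coordinate changes. This bounds the number of iterations of the rounding.
-/
lemma numFrac_moveMass_lt {z : Fin K → ℝ} {k j : Fin K} (h : k ≠ j) (hk : IsFrac z k)
    (hj : IsFrac z j) : numFrac (moveMass z k j (min (1 - z k) (z j))) < numFrac z := by
  classical
  refine Finset.card_lt_card ⟨fun i hi => ?_, fun hsub => ?_⟩
  · simp only [Finset.mem_filter, Finset.mem_univ, true_and] at hi ⊢
    by_cases hik : i = k
    · exact hik ▸ hk
    · by_cases hij : i = j
      · exact hij ▸ hj
      · simpa [IsFrac, moveMass_of_ne z hik hij] using hi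
  · have hk' : IsFrac (moveMass z k j (min (1 - z k) (z j))) k := by
      simpa using hsub (by simpa using hk)
    have hj' : IsFrac (moveMass z k j (min (1 - z k) (z j))) j := by
      simpa using hsub (by simpa using hj)
    unfold IsFrac at hk' hj'
    rw [moveMass_fst z h] at hk'
    rw [moveMass_snd] at hj'
    rcases min_choice (1 - z k) (z j) with hm | hm <;> rw [hm] at hk' hj'
    · linarith [hk'.2]
    · linarith [hj'.1]

/-- A lone fractional coordinate would be the difference of the integer `N` and a sum of integers,
hence an integer strictly between `0` and `1`. -/
lemma integral_of_no_frac_pair {z : Fin K → ℝ} (hz : ∀ i, 0 ≤ z i ∧ z i ≤ 1) {N : ℕ}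
    (hsum : ∑ i, z i = N) (h : ¬ ∃ k j, k ≠ j ∧ IsFrac z k ∧ IsFrac z j) (i : Fin K) :
    z i = 0 ∨ z i = 1 := by
  by_contra hi
  push Not at hi
  have hfi : IsFrac z i := ⟨lt_of_le_of_ne (hz i).1 (Ne.symm hi.1), lt_of_le_of_ne (hz i).2 hi.2⟩
  have hoth : ∀ j ∈ Finset.univ.erase i, z j = ((if z j = 1 then (1 : ℤ) else 0 : ℤ) : ℝ) := by
    intro j hj
    have hji := Finset.ne_of_mem_erase hj
    by_cases h1 : z j = 1
    · simp [h1]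
    · rcases eq_or_lt_of_le (hz j).1 with h0 | h0
      · simp [← h0]
      · exact absurd ⟨j, i, hji, ⟨h0, lt_of_le_of_ne (hz j).2 h1⟩, hfi⟩ h
  rw [← Finset.add_sum_erase _ _ (Finset.mem_univ i), Finset.sum_congr rfl hoth,
    ← Int.cast_sum] at hsum
  set s : ℤ := ∑ j ∈ Finset.univ.erase i, (if z j = 1 then (1 : ℤ) else 0)
  have hzi : z i = (((N : ℤ) - s : ℤ) : ℝ) := by push_cast; linarith
  have h1 := hfi.1
  have h2 := hfi.2
  rw [hzi] at h1 h2
  have h1' : (0 : ℤ) < N - s := by exact_mod_cast h1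
  have h2' : (N : ℤ) - s < 1 := by exact_mod_cast h2
  omega

lemma no_frac_pair_of_numFrac_eq_zero {z : Fin K → ℝ} (h : numFrac z = 0) :
    ¬ ∃ k j, k ≠ j ∧ IsFrac z k ∧ IsFrac z j := by
  classical
  rintro ⟨k, _, _, hk, _⟩
  rw [numFrac, Finset.card_eq_zero] at h
  have : k ∈ (∅ : Finset (Fin K)) := h ▸ (by simpa using hk)
  simp at this

lemma card_filter_eq_one {z : Fin K → ℝ} {N : ℕ} (hsum : ∑ i, z i = N)
    (h : ∀ i, z i = 0 ∨ z i = 1) [DecidablePred fun k => z k = 1] :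
    (Finset.univ.filter fun k => z k = 1).card = N := by
  have h1 : ∀ i, z i = if z i = 1 then 1 else 0 := by
    intro i
    rcases h i with h | h <;> simp [h]
  rw [Finset.sum_congr rfl fun i _ => h1 i, Finset.sum_boole] at hsum
  exact_mod_cast hsum

/-- One step of dependent rounding, as an equation with `moveMass`. -/
lemma depRound_succ_of_exists {pick : (Fin K → ℝ) → Fin K × Fin K} (hpick : IsPickRule pick)
    (n : ℕ) {z : Fin K → ℝ} (hz : ∀ i, 0 ≤ z i ∧ z i ≤ 1)
    (h : ∃ k j, k ≠ j ∧ IsFrac z k ∧ IsFrac z j) :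
    ∃ (k j : Fin K) (w : ℝ), 0 ≤ w ∧ w ≤ 1 ∧
      (∀ z' ∈ ({moveMass z k j (min (1 - z k) (z j)), moveMass z j k (min (1 - z j) (z k))} :
        Set (Fin K → ℝ)), (∀ i, 0 ≤ z' i ∧ z' i ≤ 1) ∧ ∑ i, z' i = ∑ i, z i ∧
          numFrac z' < numFrac z) ∧
      (∀ i, w * moveMass z k j (min (1 - z k) (z j)) i +
        (1 - w) * moveMass z j k (min (1 - z j) (z k)) i = z i) ∧
      depRound pick (n + 1) z = (coin w).bind fun b =>
        if b then depRound pick n (moveMass z k j (min (1 - z k) (z j)))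
        else depRound pick n (moveMass z j k (min (1 - z j) (z k))) := by
  obtain ⟨hkj, hk, hj⟩ := hpick z h
  -- The second branch is the first with the two coordinates exchanged. If the branches move `p` and
  -- `q`, the weight `w = q / (p + q)` gives `w * p = (1 - w) * q`, so the step has mean zero.
  refine ⟨(pick z).1, (pick z).2, min (z (pick z).1) (1 - z (pick z).2) /
    (min (1 - z (pick z).1) (z (pick z).2) + min (z (pick z).1) (1 - z (pick z).2)),
    ?_, ?_, ?_, ?_, ?_⟩
  · have h1 : 0 < min (1 - z (pick z).1) (z (pick z).2) := lt_min (by linarith [hk.2]) hj.1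
    have h2 : 0 < min (z (pick z).1) (1 - z (pick z).2) := lt_min hk.1 (by linarith [hj.2])
    positivity
  · have h1 : 0 < min (1 - z (pick z).1) (z (pick z).2) := lt_min (by linarith [hk.2]) hj.1
    have h2 : 0 < min (z (pick z).1) (1 - z (pick z).2) := lt_min hk.1 (by linarith [hj.2])
    rw [div_le_one (by positivity)]
    linarith
  · rintro z' (rfl | rfl)
    · exact ⟨moveMass_mem hz hkj, sum_moveMass z hkj _, numFrac_moveMass_lt hkj hk hj⟩
    · exact ⟨moveMass_mem hz hkj.symm, sum_moveMass z hkj.symm _,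
        numFrac_moveMass_lt hkj.symm hj hk⟩
  · intro i
    have h1 : 0 < min (1 - z (pick z).1) (z (pick z).2) := lt_min (by linarith [hk.2]) hj.1
    have h2 : 0 < min (z (pick z).1) (1 - z (pick z).2) := lt_min hk.1 (by linarith [hj.2])
    rw [moveMass_eq_add z hkj, moveMass_eq_add z hkj.symm,
      min_comm (1 - z (pick z).2) (z (pick z).1)]
    have h3 := (add_pos h1 h2).ne'
    field_simp
    ring
  · rw [depRound, if_pos h]
    refine congrArg (PMF.bind _) (funext fun b => ?_)
    cases b
    · simp only [Bool.false_eq_true, if_false]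
      rw [moveMass, Function.update_comm hkj, min_comm (1 - z (pick z).2)]
    · simp only [if_true]
      rfl

lemma depRound_eq_pure {pick : (Fin K → ℝ) → Fin K × Fin K} {n : ℕ} {z : Fin K → ℝ}
    (h : ¬ ∃ k j, k ≠ j ∧ IsFrac z k ∧ IsFrac z j) :
    depRound pick n z = PMF.pure (@Finset.filter _ (fun k => z k = 1)
      (fun _ => Classical.propDecidable _) Finset.univ) := by
  cases n with
  | zero => rfl
  | succ n => rw [depRound, if_neg h]

lemma card_of_mem_support_depRound {pick : (Fin K → ℝ) → Fin K × Fin K} (hpick : IsPickRule pick)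
    {N : ℕ} (n : ℕ) (z : Fin K → ℝ) (hz : ∀ i, 0 ≤ z i ∧ z i ≤ 1) (hsum : ∑ i, z i = N)
    (hn : numFrac z ≤ n) {A : Finset (Fin K)} (hA : A ∈ (depRound pick n z).support) :
    A.card = N := by
  classical
  induction n generalizing z with
  | zero =>
    have h := no_frac_pair_of_numFrac_eq_zero (Nat.le_zero.1 hn)
    rw [depRound_eq_pure h, PMF.support_pure, Set.mem_singleton_iff] at hA
    rw [hA]
    exact card_filter_eq_one hsum (integral_of_no_frac_pair hz hsum h)
  | succ n ih =>
    by_cases h : ∃ k j, k ≠ j ∧ IsFrac z k ∧ IsFrac z j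
    · obtain ⟨k, j, w, -, -, hz', -, heq⟩ := depRound_succ_of_exists hpick n hz h
      rw [heq, PMF.mem_support_bind_iff] at hA
      obtain ⟨b, -, hb⟩ := hA
      cases b
      · obtain ⟨h1, h2, h3⟩ := hz' _ (Or.inr rfl)
        exact ih _ h1 (h2.trans hsum) (by omega) (by simpa using hb)
      · obtain ⟨h1, h2, h3⟩ := hz' _ (Or.inl rfl)
        exact ih _ h1 (h2.trans hsum) (by omega) (by simpa using hb)
    · rw [depRound_eq_pure h, PMF.support_pure, Set.mem_singleton_iff] at hA
      rw [hA]
      exact card_filter_eq_one hsum (integral_of_no_frac_pair hz hsum h)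

/-- Each iteration preserves every coordinate in mean, and at an integral point the returned set has
`z` as its indicator. These marginals are all that SUC and AIC need from the rounding. -/
lemma pmfMean_depRound_mem {pick : (Fin K → ℝ) → Fin K × Fin K} (hpick : IsPickRule pick)
    {N : ℕ} (n : ℕ) (z : Fin K → ℝ) (hz : ∀ i, 0 ≤ z i ∧ z i ≤ 1) (hsum : ∑ i, z i = N)
    (hn : numFrac z ≤ n) (i : Fin K) :
    pmfMean (depRound pick n z) (fun A => if i ∈ A then 1 else 0) = z i := by
  classical
  have hpure : ∀ (n : ℕ) (z : Fin K → ℝ), (∀ i, 0 ≤ z i ∧ z i ≤ 1) → ∑ i, z i = N →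
      (¬ ∃ k j, k ≠ j ∧ IsFrac z k ∧ IsFrac z j) →
      pmfMean (depRound pick n z) (fun A => if i ∈ A then 1 else 0) = z i := by
    intro n z hz hsum h
    rw [depRound_eq_pure h, pmfMean_pure]
    rcases integral_of_no_frac_pair hz hsum h i with h | h <;> simp [h]
  induction n generalizing z with
  | zero => exact hpure 0 z hz hsum (no_frac_pair_of_numFrac_eq_zero (Nat.le_zero.1 hn))
  | succ n ih =>
    by_cases h : ∃ k j, k ≠ j ∧ IsFrac z k ∧ IsFrac z j
    · obtain ⟨k, j, w, h0, h1, hz', hmean, heq⟩ := depRound_succ_of_exists hpick n hz h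
      obtain ⟨a1, a2, a3⟩ := hz' _ (Or.inr rfl)
      obtain ⟨b1, b2, b3⟩ := hz' _ (Or.inl rfl)
      rw [heq, pmfMean_coin_bind h0 h1]
      simp only [if_true, Bool.false_eq_true, if_false]
      rw [ih _ a1 (a2.trans hsum) (by omega), ih _ b1 (b2.trans hsum) (by omega), hmean]
    · exact hpure _ z hz hsum h

lemma numFrac_le (z : Fin K → ℝ) : numFrac z ≤ K := by
  classical
  exact (Finset.card_le_univ _).trans (by simp)

end DependentRounding

/-! ## Swap rounding -/

section SwapRounding

variable {K : ℕ}

/-- The probability that all arms fail, as a function of fractional selections. -/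
def failProd (μ y : Fin K → ℝ) : ℝ := ∏ k, (1 - μ k * y k)

/-- The indicator of membership in `B`. -/
def ind (B : Finset (Fin K)) (k : Fin K) : ℝ := if k ∈ B then 1 else 0

lemma ind_of_mem {B : Finset (Fin K)} {k : Fin K} (h : k ∈ B) : ind B k = 1 := if_pos h

lemma ind_of_notMem {B : Finset (Fin K)} {k : Fin K} (h : k ∉ B) : ind B k = 0 := if_neg h

lemma ind_le_one (B : Finset (Fin K)) (k : Fin K) : ind B k ≤ 1 := by
  unfold ind; split_ifs <;> norm_num

lemma ind_nonneg (B : Finset (Fin K)) (k : Fin K) : 0 ≤ ind B k := by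
  unfold ind; split_ifs <;> norm_num

lemma failProd_ind (μ : Fin K → ℝ) (B : Finset (Fin K)) :
    failProd μ (ind B) = ∏ k ∈ B, (1 - μ k) := by
  unfold failProd ind
  simp only [mul_ite, mul_one, mul_zero]
  rw [← Finset.prod_filter_mul_prod_filter_not Finset.univ (· ∈ B)]
  rw [Finset.prod_congr rfl fun k hk => by rw [if_pos (Finset.mem_filter.1 hk).2],
    Finset.prod_congr (s₁ := Finset.univ.filter fun k => ¬ k ∈ B) rfl
      fun k hk => by rw [if_neg (Finset.mem_filter.1 hk).2]]
  simp

/-- The failure probability is affine in each single coordinate, so randomizing one coordinate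
commutes with taking means. This handles the independent removals without any loss. -/
lemma failProd_affine (μ : Fin K → ℝ) {y y₁ y₂ : Fin K → ℝ} {w : ℝ} (i : Fin K)
    (h₁ : ∀ k, k ≠ i → y₁ k = y k) (h₂ : ∀ k, k ≠ i → y₂ k = y k)
    (hi : w * y₁ i + (1 - w) * y₂ i = y i) :
    w * failProd μ y₁ + (1 - w) * failProd μ y₂ = failProd μ y := by
  have key : ∀ v : Fin K → ℝ, (∀ k, k ≠ i → v k = y k) →
      failProd μ v = (1 - μ i * v i) * ∏ k ∈ Finset.univ.erase i, (1 - μ k * y k) := by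
    intro v hv
    unfold failProd
    rw [← Finset.mul_prod_erase _ _ (Finset.mem_univ i)]
    refine congrArg _ (Finset.prod_congr rfl fun k hk => ?_)
    rw [hv k (Finset.ne_of_mem_erase hk)]
  rw [key y₁ h₁, key y₂ h₂, key y fun _ _ => rfl, ← hi]
  ring

/-- Moving mass between two coordinates by a mean-zero random amount lowers the mean of the
failure probability. -/
lemma failProd_exchange_le {μ y : Fin K → ℝ} (hμ : ∀ k, 0 ≤ μ k) (hy : ∀ k, 0 ≤ 1 - μ k * y k)
    {i j : Fin K} (hij : i ≠ j) {w p₁ p₂ : ℝ} (h0 : 0 ≤ w) (h1 : w ≤ 1)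
    (hw : p₁ * w = p₂ * (1 - w)) {y₁ y₂ : Fin K → ℝ}
    (hy₁ : ∀ k, k ≠ i → k ≠ j → y₁ k = y k) (hy₂ : ∀ k, k ≠ i → k ≠ j → y₂ k = y k)
    (h₁i : y₁ i = y i - p₁) (h₁j : y₁ j = y j + p₁)
    (h₂i : y₂ i = y i + p₂) (h₂j : y₂ j = y j - p₂) :
    w * failProd μ y₁ + (1 - w) * failProd μ y₂ ≤ failProd μ y := by
  have key : ∀ v : Fin K → ℝ, failProd μ v = (1 - μ i * v i) * ((1 - μ j * v j) *
      ∏ k ∈ (Finset.univ.erase i).erase j, (1 - μ k * v k)) := by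
    intro v
    unfold failProd
    rw [← Finset.mul_prod_erase _ _ (Finset.mem_univ i),
      ← Finset.mul_prod_erase _ _ (Finset.mem_erase.2 ⟨hij.symm, Finset.mem_univ j⟩)]
  have hr : ∀ v : Fin K → ℝ, (∀ k, k ≠ i → k ≠ j → v k = y k) →
      ∏ k ∈ (Finset.univ.erase i).erase j, (1 - μ k * v k) =
      ∏ k ∈ (Finset.univ.erase i).erase j, (1 - μ k * y k) := by
    intro v hv
    refine Finset.prod_congr rfl fun k hk => ?_
    rw [hv k (Finset.ne_of_mem_erase (Finset.mem_of_mem_erase hk)) (Finset.ne_of_mem_erase hk)]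
  rw [key y, key y₁, key y₂, hr y₁ hy₁, hr y₂ hy₂, h₁i, h₁j, h₂i, h₂j]
  have hR : 0 ≤ ∏ k ∈ (Finset.univ.erase i).erase j, (1 - μ k * y k) :=
    Finset.prod_nonneg fun k _ => hy k
  set R := ∏ k ∈ (Finset.univ.erase i).erase j, (1 - μ k * y k)
  -- Along the direction that trades `i` against `j`, the product is quadratic with leading
  -- coefficient `-R * (μ i * μ j)`, hence concave. The first-order term carries the factor `p₁ * w
  -- - p₂ * (1 - w)`, which is zero.
  have hid : (1 - μ i * y i) * ((1 - μ j * y j) * R) -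
      (w * ((1 - μ i * (y i - p₁)) * ((1 - μ j * (y j + p₁)) * R)) +
        (1 - w) * ((1 - μ i * (y i + p₂)) * ((1 - μ j * (y j - p₂)) * R))) =
      R * (μ i * μ j) * (w * p₁ ^ 2 + (1 - w) * p₂ ^ 2) +
      R * (p₁ * w - p₂ * (1 - w)) * (μ j * (1 - μ i * y i) - μ i * (1 - μ j * y j)) := by ring
  rw [hw, sub_self, mul_zero, zero_mul, add_zero] at hid
  have : 0 ≤ R * (μ i * μ j) * (w * p₁ ^ 2 + (1 - w) * p₂ ^ 2) :=
    mul_nonneg (mul_nonneg hR (mul_nonneg (hμ i) (hμ j)))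
      (add_nonneg (mul_nonneg h0 (sq_nonneg _)) (mul_nonneg (by linarith) (sq_nonneg _)))
  linarith

lemma card_exchange {A : Finset (Fin K)} {i j : Fin K} (hi : i ∈ A) (hj : j ∉ A) :
    (insert j (A.erase i)).card = A.card := by
  rw [Finset.card_insert_of_notMem (fun h => hj (Finset.mem_of_mem_erase h)),
    Finset.card_erase_of_mem hi]
  have := Finset.card_pos.2 ⟨i, hi⟩
  omega

lemma ind_exchange {A : Finset (Fin K)} {i j : Fin K} (hi : i ∈ A) (hj : j ∉ A) :
    (∀ k, k ≠ i → k ≠ j → ind (insert j (A.erase i)) k = ind A k) ∧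
      ind (insert j (A.erase i)) i = ind A i - 1 ∧
      ind (insert j (A.erase i)) j = ind A j + 1 := by
  have hij : i ≠ j := fun h => hj (h ▸ hi)
  refine ⟨fun k hki hkj => ?_, ?_, ?_⟩
  · simp [ind, hki, hkj]
  · simp [ind, hi, hij]
  · simp [ind, hj]

/-- The exchange loop keeps the size and the common elements. -/
lemma swapLoop_support {c : SwapChoices K} {N : ℕ} (hc : c.Valid N) (w : ℝ) (n : ℕ)
    (B₁ B₂ : Finset (Fin K)) (hN : B₁.card ≤ N) (hcard : B₂.card = B₁.card)
    {A : Finset (Fin K)} (hA : A ∈ (swapLoop c w n B₁ B₂).support) :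
    A.card = B₁.card ∧ B₁ ∩ B₂ ⊆ A := by
  induction n generalizing B₁ B₂ with
  | zero =>
    rw [swapLoop, PMF.support_pure, Set.mem_singleton_iff] at hA
    exact hA ▸ ⟨rfl, Finset.inter_subset_left⟩
  | succ n ih =>
    rw [swapLoop] at hA
    split_ifs at hA with h
    · rw [PMF.support_pure, Set.mem_singleton_iff] at hA
      exact hA ▸ ⟨rfl, Finset.inter_subset_left⟩
    · obtain ⟨hi, hj⟩ := hc.pair_mem B₁ B₂ hN hcard h
      rw [Finset.mem_sdiff] at hi hj
      rw [PMF.mem_support_bind_iff] at hA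
      obtain ⟨b, -, hb⟩ := hA
      cases b
      · simp only [Bool.false_eq_true, if_false] at hb
        have h2 := card_exchange hj.1 hi.2
        obtain ⟨h3, h4⟩ := ih _ _ hN (h2.trans hcard) hb
        refine ⟨h3, fun k hk => h4 ?_⟩
        rw [Finset.mem_inter] at hk ⊢
        refine ⟨hk.1, Finset.mem_insert_of_mem (Finset.mem_erase.2 ⟨?_, hk.2⟩)⟩
        rintro rfl
        exact hj.2 hk.1
      · simp only [if_true] at hb
        have h2 := card_exchange hi.1 hj.2
        obtain ⟨h3, h4⟩ := ih _ _ (h2.le.trans hN) (hcard.trans h2.symm) hb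
        refine ⟨h3.trans h2, fun k hk => h4 ?_⟩
        rw [Finset.mem_inter] at hk ⊢
        refine ⟨Finset.mem_insert_of_mem (Finset.mem_erase.2 ⟨?_, hk.1⟩), hk.2⟩
        rintro rfl
        exact hi.2 hk.2

/-- The vector `r` holds the contribution of everything outside the two sets being merged. Each
exchange is a mean-zero move to which `failProd_exchange_le` applies, and it shrinks `B₁ \ B₂`. Only
an upper bound on `r` is required, which keeps the factors nonnegative; `r` itself may be negative,
as happens when padding is subtracted. -/
lemma pmfMean_swapLoop_le {c : SwapChoices K} {N : ℕ} (hc : c.Valid N) {w p₁ p₂ : ℝ}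
    (h0 : 0 ≤ w) (h1 : w ≤ 1) (hw : p₁ * w = p₂ * (1 - w)) (hp₁ : 0 ≤ p₁) (hp₂ : 0 ≤ p₂)
    {μ r : Fin K → ℝ} (hμ : ∀ k, 0 ≤ μ k ∧ μ k ≤ 1) (hr : ∀ k, r k + (p₁ + p₂) ≤ 1) (n : ℕ)
    (B₁ B₂ : Finset (Fin K)) (hN : B₁.card ≤ N) (hcard : B₂.card = B₁.card)
    (hn : (B₁ \ B₂).card ≤ n) :
    pmfMean (swapLoop c w n B₁ B₂) (fun B => failProd μ fun k => r k + (p₁ + p₂) * ind B k) ≤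
      failProd μ fun k => r k + (p₁ * ind B₁ k + p₂ * ind B₂ k) := by
  have hdone : ∀ B : Finset (Fin K),
      (fun k => r k + (p₁ + p₂) * ind B k) = fun k => r k + (p₁ * ind B k + p₂ * ind B k) :=
    fun B => funext fun k => by ring
  induction n generalizing B₁ B₂ with
  | zero =>
    have hsub : B₁ ⊆ B₂ := by
      rw [← Finset.sdiff_eq_empty_iff_subset, ← Finset.card_eq_zero]
      omega
    have hB : B₁ = B₂ := Finset.eq_of_subset_of_card_le hsub hcard.le
    subst hB
    rw [swapLoop, pmfMean_pure, hdone]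
  | succ n ih =>
    rw [swapLoop]
    split_ifs with h
    · subst h
      rw [pmfMean_pure, hdone]
    · obtain ⟨hi, hj⟩ := hc.pair_mem B₁ B₂ hN hcard h
      rw [Finset.mem_sdiff] at hi hj
      generalize (c.pair B₁ B₂).1 = i at hi hj ⊢
      generalize (c.pair B₁ B₂).2 = j at hi hj ⊢
      have hij : i ≠ j := fun h => hj.2 (h ▸ hi.1)
      simp only
      rw [pmfMean_coin_bind h0 h1]
      simp only [if_true, Bool.false_eq_true, if_false]
      have hlt1 : (insert j (B₁.erase i) \ B₂).card ≤ n := by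
        refine Nat.le_of_lt_succ (lt_of_lt_of_le (Finset.card_lt_card ?_) hn)
        refine ⟨fun k hk => ?_, fun hsub => ?_⟩
        · simp only [Finset.mem_sdiff, Finset.mem_insert, Finset.mem_erase] at hk ⊢
          rcases hk with ⟨rfl | ⟨_, hk⟩, hk2⟩
          · exact absurd hj.1 hk2
          · exact ⟨hk, hk2⟩
        · have := hsub (Finset.mem_sdiff.2 hi)
          simp [hij] at this
      have hlt2 : (B₁ \ insert i (B₂.erase j)).card ≤ n := by
        refine Nat.le_of_lt_succ (lt_of_lt_of_le (Finset.card_lt_card ?_) hn)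
        refine ⟨fun k hk => ?_, fun hsub => ?_⟩
        · simp only [Finset.mem_sdiff, Finset.mem_insert, Finset.mem_erase, not_or, not_and,
            Finset.mem_sdiff] at hk ⊢
          refine ⟨hk.1, hk.2.2 ?_⟩
          rintro rfl
          exact hj.2 hk.1
        · have := hsub (Finset.mem_sdiff.2 hi)
          simp at this
      have hc1 := card_exchange hi.1 hj.2
      have hc2 := card_exchange hj.1 hi.2
      have e1 := ih _ B₂ (hc1.le.trans hN) (hcard.trans hc1.symm) hlt1
      have e2 := ih B₁ _ hN (hc2.trans hcard) hlt2
      obtain ⟨a1, a2, a3⟩ := ind_exchange hi.1 hj.2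
      obtain ⟨b1, b2, b3⟩ := ind_exchange hj.1 hi.2
      refine (add_le_add (mul_le_mul_of_nonneg_left e1 h0)
        (mul_le_mul_of_nonneg_left e2 (by linarith))).trans ?_
      refine failProd_exchange_le (fun k => (hμ k).1) (fun k => ?_) hij h0 h1 hw
        (fun k hki hkj => ?_) (fun k hki hkj => ?_) ?_ ?_ ?_ ?_
      · have h5 : r k + (p₁ * ind B₁ k + p₂ * ind B₂ k) ≤ 1 := by
          have := mul_le_mul_of_nonneg_left (ind_le_one B₁ k) hp₁
          have := mul_le_mul_of_nonneg_left (ind_le_one B₂ k) hp₂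
          linarith [hr k]
        nlinarith [mul_le_mul_of_nonneg_left h5 (hμ k).1, (hμ k).2]
      · simp only [a1 k hki hkj]
      · simp only [b1 k hkj hki]
      · simp only [a2]; ring
      · simp only [a3]; ring
      · simp only [b3]; ring
      · simp only [b2]; ring

lemma removeEach_support (w : ℝ) (l : List (Fin K)) (B : Finset (Fin K)) {A : Finset (Fin K)}
    (hA : A ∈ (removeEach w l B).support) : A ⊆ B := by
  induction l generalizing B with
  | nil =>
    rw [removeEach, PMF.support_pure, Set.mem_singleton_iff] at hA
    exact hA ▸ subset_rfl
  | cons i l ih =>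
    rw [removeEach, PMF.mem_support_bind_iff] at hA
    obtain ⟨b, -, hb⟩ := hA
    refine (ih _ hb).trans ?_
    split_ifs
    · exact Finset.erase_subset _ _
    · exact subset_rfl

/-- Each removal randomizes one coordinate of its own, so `failProd_affine` gives equality. An
element of weight `s` loses `w * s = p` in mean. -/
lemma pmfMean_removeEach {w p s : ℝ} (h0 : 0 ≤ w) (h1 : w ≤ 1) (hw : w * s = p)
    (μ r : Fin K → ℝ) (l : List (Fin K)) (hl : l.Nodup) (B : Finset (Fin K))
    (hB : ∀ i ∈ l, i ∈ B) :
    pmfMean (removeEach w l B) (fun A => failProd μ fun k => r k + s * ind A k) =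
      failProd μ fun k => r k + s * ind B k - p * (if k ∈ l then 1 else 0) := by
  induction l generalizing B with
  | nil => rw [removeEach, pmfMean_pure]; simp
  | cons i l ih =>
    rw [List.nodup_cons] at hl
    have hil : ∀ k ∈ l, k ≠ i := fun k hk h => hl.1 (h ▸ hk)
    rw [removeEach, pmfMean_coin_bind h0 h1]
    simp only [if_true, Bool.false_eq_true, if_false]
    rw [ih hl.2 _ fun k hk => Finset.mem_erase.2 ⟨hil k hk, hB k (List.mem_cons_of_mem _ hk)⟩,
      ih hl.2 _ fun k hk => hB k (List.mem_cons_of_mem _ hk)]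
    refine failProd_affine μ i (fun k hk => ?_) (fun k hk => ?_) ?_
    · simp [ind, hk]
    · simp [hk]
    · have hi : i ∈ B := hB i List.mem_cons_self
      simp only [ind, Finset.notMem_erase, if_false, hl.1, hi, if_true, List.mem_cons, true_or]
      linear_combination -hw

lemma mergeOrdered_support {c : SwapChoices K} {N : ℕ} (hc : c.Valid N) {p₁ p₂ : ℝ}
    {B₁ B₂ : Finset (Fin K)} (hN : B₁.card ≤ N) (hle : B₂.card ≤ B₁.card)
    {A : Finset (Fin K)} (hA : A ∈ (mergeOrdered c p₁ B₁ p₂ B₂).support) : A.card ≤ N := by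
  rw [mergeOrdered, PMF.mem_support_bind_iff] at hA
  obtain ⟨B, hB, hA⟩ := hA
  have hdisj : Disjoint B₂ (c.pad B₁ B₂) :=
    Finset.disjoint_of_subset_right (hc.pad_subset B₁ B₂ hN hle) Finset.disjoint_sdiff
  have hcard : (B₂ ∪ c.pad B₁ B₂).card = B₁.card := by
    rw [Finset.card_union_of_disjoint hdisj, add_comm, hc.pad_card B₁ B₂ hN hle]
  have h1 := (swapLoop_support hc _ _ _ _ hN hcard hB).1
  exact (Finset.card_le_card (removeEach_support _ _ _ hA)).trans (h1.le.trans hN)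

/-- The padding lies in both sets at the start of the exchange loop, so it survives the loop. The
removals then take off mass `p₂` in mean from each padded element, exactly what the padding had
added to the smaller set. Accordingly the loop is analysed with `r` lowered by `p₂` on the padding.
-/
lemma pmfMean_mergeOrdered_le {c : SwapChoices K} {N : ℕ} (hc : c.Valid N) {p₁ p₂ : ℝ}
    (hp₁ : 0 ≤ p₁) (hp₂ : 0 ≤ p₂) {μ r : Fin K → ℝ} (hμ : ∀ k, 0 ≤ μ k ∧ μ k ≤ 1)
    (hr : ∀ k, r k + (p₁ + p₂) ≤ 1) {B₁ B₂ : Finset (Fin K)} (hN : B₁.card ≤ N)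
    (hle : B₂.card ≤ B₁.card) :
    pmfMean (mergeOrdered c p₁ B₁ p₂ B₂)
        (fun B => failProd μ fun k => r k + (p₁ + p₂) * ind B k) ≤
      failProd μ fun k => r k + (p₁ * ind B₁ k + p₂ * ind B₂ k) := by
  have hsub := hc.pad_subset B₁ B₂ hN hle
  have hdisj : Disjoint B₂ (c.pad B₁ B₂) :=
    Finset.disjoint_of_subset_right hsub Finset.disjoint_sdiff
  have hcard : (B₂ ∪ c.pad B₁ B₂).card = B₁.card := by
    rw [Finset.card_union_of_disjoint hdisj, add_comm, hc.pad_card B₁ B₂ hN hle]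
  have h0 : 0 ≤ p₂ / (p₁ + p₂) := by positivity
  have h1 : p₂ / (p₁ + p₂) ≤ 1 := div_le_one_of_le₀ (by linarith) (by linarith)
  have hws : p₂ / (p₁ + p₂) * (p₁ + p₂) = p₂ := by
    -- If both weights vanish, the quotient is `0` by convention and the identity still holds.
    rcases eq_or_ne (p₁ + p₂) 0 with h | h
    · rw [h, mul_zero]; linarith
    · exact div_mul_cancel₀ _ h
  have hw : p₁ * (p₂ / (p₁ + p₂)) = p₂ * (1 - p₂ / (p₁ + p₂)) := by
    linear_combination hws
  rw [mergeOrdered, pmfMean_bind]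
  have hstep : pmfMean (swapLoop c (p₂ / (p₁ + p₂)) K B₁ (B₂ ∪ c.pad B₁ B₂))
      (fun B => pmfMean (removeEach (p₂ / (p₁ + p₂)) (c.pad B₁ B₂).toList B)
        (fun B => failProd μ fun k => r k + (p₁ + p₂) * ind B k)) ≤
      pmfMean (swapLoop c (p₂ / (p₁ + p₂)) K B₁ (B₂ ∪ c.pad B₁ B₂))
      (fun B => failProd μ fun k => (r k - p₂ * ind (c.pad B₁ B₂) k) + (p₁ + p₂) * ind B k) := by
    refine pmfMean_mono_of_support fun B hB => ?_
    have hpad : ∀ i ∈ (c.pad B₁ B₂).toList, i ∈ B := by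
      intro i hi
      rw [Finset.mem_toList] at hi
      refine (swapLoop_support hc _ _ _ _ hN hcard hB).2 (Finset.mem_inter.2 ⟨?_, ?_⟩)
      · exact (Finset.mem_sdiff.1 (hsub hi)).1
      · exact Finset.mem_union_right _ hi
    rw [pmfMean_removeEach h0 h1 hws μ r _ (Finset.nodup_toList _) B hpad]
    refine le_of_eq (congrArg _ (funext fun k => ?_))
    simp only [Finset.mem_toList, ind]
    ring
  refine hstep.trans ((pmfMean_swapLoop_le hc h0 h1 hw hp₁ hp₂ hμ (fun k => ?_) K _ _ hN hcard
    ((Finset.card_le_univ _).trans (by simp))).trans (le_of_eq (congrArg _ (funext fun k => ?_))))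
  · have := mul_nonneg hp₂ (ind_nonneg (c.pad B₁ B₂) k)
    linarith [hr k]
  · have hu : ind (B₂ ∪ c.pad B₁ B₂) k = ind B₂ k + ind (c.pad B₁ B₂) k := by
      by_cases h2 : k ∈ B₂
      · simp [ind, h2, Finset.disjoint_left.1 hdisj h2]
      · simp [ind, h2]
    rw [hu]
    ring

lemma merge_support {c : SwapChoices K} {N : ℕ} (hc : c.Valid N) {p₁ p₂ : ℝ}
    {B₁ B₂ : Finset (Fin K)} (h₁ : B₁.card ≤ N) (h₂ : B₂.card ≤ N)
    {A : Finset (Fin K)} (hA : A ∈ (merge c p₁ B₁ p₂ B₂).support) : A.card ≤ N := by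
  rw [merge] at hA
  split_ifs at hA with h
  · exact mergeOrdered_support hc h₂ h.le hA
  · exact mergeOrdered_support hc h₁ (not_lt.1 h) hA

lemma pmfMean_merge_le {c : SwapChoices K} {N : ℕ} (hc : c.Valid N) {p₁ p₂ : ℝ}
    (hp₁ : 0 ≤ p₁) (hp₂ : 0 ≤ p₂) {μ r : Fin K → ℝ} (hμ : ∀ k, 0 ≤ μ k ∧ μ k ≤ 1)
    (hr : ∀ k, r k + (p₁ + p₂) ≤ 1) {B₁ B₂ : Finset (Fin K)} (h₁ : B₁.card ≤ N)
    (h₂ : B₂.card ≤ N) :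
    pmfMean (merge c p₁ B₁ p₂ B₂) (fun B => failProd μ fun k => r k + (p₁ + p₂) * ind B k) ≤
      failProd μ fun k => r k + (p₁ * ind B₁ k + p₂ * ind B₂ k) := by
  rw [merge]
  split_ifs with h
  · have := pmfMean_mergeOrdered_le hc hp₂ hp₁ hμ (r := r) (by simpa [add_comm p₂ p₁] using hr)
      h₂ h.le
    simpa only [add_comm p₂ p₁, add_comm (p₂ * ind B₂ _)] using this
  · exact pmfMean_mergeOrdered_le hc hp₁ hp₂ hμ hr h₁ (not_lt.1 h)

lemma mergeList_support {c : SwapChoices K} {N : ℕ} (hc : c.Valid N) (p : ℝ)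
    (B : Finset (Fin K)) (l : List (ℝ × Finset (Fin K))) (hB : B.card ≤ N)
    (hl : ∀ a ∈ l, a.2.card ≤ N) {A : Finset (Fin K)} (hA : A ∈ (mergeList c p B l).support) :
    A.card ≤ N := by
  induction l generalizing p B with
  | nil =>
    rw [mergeList, PMF.support_pure, Set.mem_singleton_iff] at hA
    exact hA ▸ hB
  | cons a l ih =>
    obtain ⟨v, C⟩ := a
    rw [mergeList, PMF.mem_support_bind_iff] at hA
    obtain ⟨B', hB', hA⟩ := hA
    exact ih _ _ (merge_support hc hB (hl _ List.mem_cons_self) hB')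
      (fun a ha => hl a (List.mem_cons_of_mem _ ha)) hA

/-- The part of a fractional point that is contributed by a list of weighted sets. -/
def listPoint (l : List (ℝ × Finset (Fin K))) (k : Fin K) : ℝ :=
  (l.map fun a => if k ∈ a.2 then a.1 else 0).sum

lemma listPoint_cons (a : ℝ × Finset (Fin K)) (l : List (ℝ × Finset (Fin K))) (k : Fin K) :
    listPoint (a :: l) k = a.1 * ind a.2 k + listPoint l k := by
  simp [listPoint, ind]

lemma listPoint_le (l : List (ℝ × Finset (Fin K))) (hl : ∀ a ∈ l, 0 ≤ a.1) (k : Fin K) :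
    listPoint l k ≤ (l.map fun a => a.1).sum := by
  induction l with
  | nil => simp [listPoint]
  | cons a l ih =>
    rw [listPoint_cons, List.map_cons, List.sum_cons]
    have h1 := ih fun a ha => hl a (List.mem_cons_of_mem _ ha)
    have h2 := mul_le_mul_of_nonneg_left (ind_le_one a.2 k) (hl a List.mem_cons_self)
    linarith

/-- The point formed by the current merged set and the sets still waiting is a martingale whose
failure probability decreases in mean. The waiting sets play the role of `r`, and the bound on `r`
holds because the weights sum to `1`. -/
lemma pmfMean_mergeList_le {c : SwapChoices K} {N : ℕ} (hc : c.Valid N) {μ : Fin K → ℝ}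
    (hμ : ∀ k, 0 ≤ μ k ∧ μ k ≤ 1) (p : ℝ) (hp : 0 ≤ p) (B : Finset (Fin K))
    (l : List (ℝ × Finset (Fin K))) (hB : B.card ≤ N) (hl : ∀ a ∈ l, a.2.card ≤ N)
    (hw : ∀ a ∈ l, 0 ≤ a.1) (hsum : p + (l.map fun a => a.1).sum = 1) :
    pmfMean (mergeList c p B l) (fun A => failProd μ (ind A)) ≤
      failProd μ fun k => p * ind B k + listPoint l k := by
  induction l generalizing p B with
  | nil =>
    have hp1 : p = 1 := by simpa using hsum
    rw [mergeList, pmfMean_pure, hp1]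
    simp [listPoint]
  | cons a l ih =>
    obtain ⟨v, C⟩ := a
    have hv : 0 ≤ v := hw _ List.mem_cons_self
    have hC : C.card ≤ N := hl _ List.mem_cons_self
    have hl' : ∀ a ∈ l, a.2.card ≤ N := fun a ha => hl a (List.mem_cons_of_mem _ ha)
    have hw' : ∀ a ∈ l, 0 ≤ a.1 := fun a ha => hw a (List.mem_cons_of_mem _ ha)
    rw [List.map_cons, List.sum_cons, ← add_assoc] at hsum
    rw [mergeList, pmfMean_bind]
    have hstep : pmfMean (merge c p B v C)
        (fun B' => pmfMean (mergeList c (p + v) B' l) fun A => failProd μ (ind A)) ≤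
        pmfMean (merge c p B v C)
          (fun B' => failProd μ fun k => listPoint l k + (p + v) * ind B' k) := by
      refine pmfMean_mono_of_support fun B' hB' => ?_
      refine (ih (p + v) (by linarith) B' (merge_support hc hB hC hB') hl' hw' hsum).trans
        (le_of_eq (congrArg _ (funext fun k => by ring)))
    refine hstep.trans ((pmfMean_merge_le hc hp hv hμ (fun k => ?_) hB hC).trans
      (le_of_eq (congrArg _ (funext fun k => ?_))))
    · have := listPoint_le l hw' k
      linarith
    · rw [listPoint_cons]
      ring

lemma card_of_mem_support_swapRound {c : SwapChoices K} {N : ℕ} (hc : c.Valid N)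
    {z : Fin K → ℝ} (hz : z ∈ polytope RewardModel.AWC N) {A : Finset (Fin K)}
    (hA : A ∈ (swapRound c z).support) : A.card ≤ N := by
  have hcard := hc.card_le z hz
  rw [swapRound] at hA
  generalize c.decomp z = d at hA hcard
  rcases d with _ | ⟨⟨v, B⟩, l⟩
  · simp only [PMF.support_pure, Set.mem_singleton_iff] at hA
    simp [hA]
  · exact mergeList_support hc v B l (hcard _ List.mem_cons_self)
      (fun a ha => hcard a (List.mem_cons_of_mem _ ha)) hA

lemma pmfMean_swapRound_le {c : SwapChoices K} {N : ℕ} (hc : c.Valid N) {z μ : Fin K → ℝ}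
    (hz : z ∈ polytope RewardModel.AWC N) (hμ : ∀ k, 0 ≤ μ k ∧ μ k ≤ 1) :
    pmfMean (swapRound c z) (fun A => ∏ k ∈ A, (1 - μ k)) ≤ ∏ k, (1 - μ k * z k) := by
  have hcard := hc.card_le z hz
  have hsum := hc.weight_sum z hz
  have hnn := hc.weight_nonneg z hz
  have hcomb := hc.combine z hz
  change _ ≤ failProd μ z
  simp_rw [← failProd_ind]
  rw [swapRound]
  generalize c.decomp z = d at hcard hsum hnn hcomb
  rcases d with _ | ⟨⟨v, B⟩, l⟩
  · simp at hsum
  · refine (pmfMean_mergeList_le hc hμ v (hnn _ List.mem_cons_self) B l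
      (hcard _ List.mem_cons_self) (fun a ha => hcard a (List.mem_cons_of_mem _ ha))
      (fun a ha => hnn a (List.mem_cons_of_mem _ ha)) (by simpa using hsum)).trans
      (le_of_eq (congrArg _ (funext fun k => ?_)))
    rw [← hcomb k]
    exact (listPoint_cons (v, B) l k).symm

end SwapRounding

/-! ## Rounding preserves the relaxed reward in mean -/

section Rounding

variable {K : ℕ}

lemma isAction_of_mem_support {m : RewardModel} {N : ℕ} {σ : (Fin K → ℝ) → PMF (Finset (Fin K))}
    (hσ : IsRounding m N σ) {z : Fin K → ℝ} (hz : z ∈ polytope m N) {A : Finset (Fin K)}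
    (hA : A ∈ (σ z).support) : IsAction m N A := by
  cases m with
  | AWC =>
    obtain ⟨c, hc, rfl⟩ := hσ
    exact card_of_mem_support_swapRound hc hz hA
  | SUC =>
    obtain ⟨pick, hpick, rfl⟩ := hσ
    exact card_of_mem_support_depRound hpick K z hz.1 hz.2 (numFrac_le z) hA
  | AIC =>
    obtain ⟨pick, hpick, rfl⟩ := hσ
    exact card_of_mem_support_depRound hpick K z hz.1 hz.2 (numFrac_le z) hA

lemma sum_eq_sum_ite (A : Finset (Fin K)) (f : Fin K → ℝ) :
    ∑ k ∈ A, f k = ∑ k, f k * (if k ∈ A then 1 else 0) := by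
  simp

/-- For AWC this is concavity along exchanges; for SUC, linearity together with the preserved
marginals. For AIC the relaxed reward is a weighted geometric mean of the rewards of the sets, at
most their arithmetic mean. -/
lemma relaxedReward_le_pmfMean {m : RewardModel} {N : ℕ}
    {σ : (Fin K → ℝ) → PMF (Finset (Fin K))} (hσ : IsRounding m N σ) {z μ : Fin K → ℝ}
    (hz : z ∈ polytope m N) (hμ : ∀ k, 0 ≤ μ k ∧ μ k ≤ 1) :
    relaxedReward m z μ ≤ pmfMean (σ z) fun A => reward m A μ := by
  cases m with
  | AWC =>
    obtain ⟨c, hc, rfl⟩ := hσ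
    have := pmfMean_swapRound_le hc hz hμ
    simp only [relaxedReward, reward]
    rw [pmfMean_const_sub]
    linarith
  | SUC =>
    obtain ⟨pick, hpick, rfl⟩ := hσ
    simp only [relaxedReward, reward]
    rw [show (fun A : Finset (Fin K) => ∑ k ∈ A, μ k) =
      fun A => ∑ k, μ k * (if k ∈ A then 1 else 0) from funext fun A => sum_eq_sum_ite A μ,
      pmfMean_sum]
    refine Finset.sum_le_sum fun k _ => ?_
    rw [pmfMean_const_mul, pmfMean_depRound_mem hpick K z hz.1 hz.2 (numFrac_le z)]
  | AIC =>
    obtain ⟨pick, hpick, rfl⟩ := hσ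
    simp only [relaxedReward, reward]
    -- Writing the exponent `z k` as a marginal turns the product over arms into a product over
    -- sets, weighted by their probabilities.
    have hmarg : ∀ k, z k = ∑ A : Finset (Fin K),
        (if k ∈ A then (depRound pick K z A).toReal else 0) := by
      intro k
      rw [← pmfMean_depRound_mem hpick K z hz.1 hz.2 (numFrac_le z) k, pmfMean]
      simp
    have hpow : ∀ k, μ k ^ z k = ∏ A : Finset (Fin K),
        (if k ∈ A then μ k else 1) ^ (depRound pick K z A).toReal := by
      intro k
      have h1 : ∀ A : Finset (Fin K), (if k ∈ A then μ k else 1) ^ (depRound pick K z A).toReal =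
          μ k ^ (if k ∈ A then (depRound pick K z A).toReal else 0) := by
        intro A
        split_ifs <;> simp
      simp_rw [h1]
      rw [hmarg k]
      exact Real.rpow_sum_of_nonneg (hμ k).1 fun A _ => by
        split_ifs
        · exact ENNReal.toReal_nonneg
        · exact le_rfl
    have hprod : ∀ A : Finset (Fin K), ∏ k ∈ A, μ k = ∏ k, (if k ∈ A then μ k else 1) := by
      intro A
      simp
    calc ∏ k, μ k ^ z k
        = ∏ A : Finset (Fin K), (∏ k ∈ A, μ k) ^ (depRound pick K z A).toReal := by
          simp_rw [hpow]
          rw [Finset.prod_comm]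
          refine Finset.prod_congr rfl fun A _ => ?_
          rw [hprod A]
          exact Real.finsetProd_rpow _ _ (fun k _ => by split_ifs; exacts [(hμ k).1, zero_le_one]) _
      _ ≤ ∑ A : Finset (Fin K), (depRound pick K z A).toReal * ∏ k ∈ A, μ k :=
          Real.geom_mean_le_arith_mean_weighted _ _ _ (fun _ _ => ENNReal.toReal_nonneg)
            (sum_toReal_pmf _) fun A _ => Finset.prod_nonneg fun k _ => (hμ k).1

end Rounding

/-! ## Scalar inequalities -/

section Scalar

/-- With `u = log x` one has `(x - 1) ^ 2 = 4 x sinh (u / 2) ^ 2`, and `|sinh v| ≥ |v|`. At `x = √n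
/ √n₀` this compares the squared logarithm with the gap between the square root and its tangent. -/
lemma mul_log_sq_le {x : ℝ} (hx : 0 < x) : x * Real.log x ^ 2 ≤ (x - 1) ^ 2 := by
  set u := Real.log x with hu
  have hxe : x = Real.exp (u / 2) * Real.exp (u / 2) := by
    rw [← Real.exp_add, add_halves, hu, Real.exp_log hx]
  have hinv : Real.exp (u / 2) * Real.exp (-(u / 2)) = 1 := by
    rw [← Real.exp_add]; simp
  have hs : (u / 2) ^ 2 ≤ Real.sinh (u / 2) ^ 2 := by
    rcases le_total 0 (u / 2) with h | h
    · exact pow_le_pow_left₀ h (Real.self_le_sinh_iff.2 h) 2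
    · have := Real.sinh_le_self_iff.2 h
      nlinarith
  have h1 : (x - 1) ^ 2 = 4 * (x * Real.sinh (u / 2) ^ 2) := by
    rw [Real.sinh_eq, hxe]
    set a := Real.exp (u / 2)
    set b := Real.exp (-(u / 2))
    linear_combination (2 * a ^ 2 - a * b - 1) * hinv
  rw [h1]
  nlinarith [mul_le_mul_of_nonneg_left hs hx.le]

/-- The sum of the reciprocals of the positive integers below `n`. -/
def harmonicBelow (n : ℕ) : ℝ := ∑ i ∈ Finset.range n, 1 / (i : ℝ)

lemma harmonicBelow_succ (n : ℕ) : harmonicBelow (n + 1) = (harmonic n : ℝ) := by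
  unfold harmonicBelow harmonic
  rw [Finset.sum_range_succ']
  push_cast
  simp

lemma abs_harmonicBelow_sub_log_le {n : ℕ} (hn : 1 ≤ n) :
    |harmonicBelow n - (Real.log n + Real.eulerMascheroniConstant)| ≤ 1 / n := by
  obtain ⟨m, rfl⟩ := Nat.exists_eq_add_of_le' hn
  have h1 := Real.eulerMascheroniSeq_lt_eulerMascheroniConstant m
  have h2 := Real.eulerMascheroniConstant_lt_eulerMascheroniSeq' (m + 1)
  rw [Real.eulerMascheroniSeq] at h1
  rw [Real.eulerMascheroniSeq', if_neg (Nat.succ_ne_zero m), harmonic_succ] at h2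
  rw [harmonicBelow_succ]
  push_cast at h1 h2 ⊢
  rw [inv_eq_one_div] at h2
  have h3 : (0 : ℝ) < 1 / ((m : ℝ) + 1) := by positivity
  rw [abs_le]
  constructor <;> linarith

lemma sum_one_div_sqrt_succ_le (n : ℕ) :
    ∑ i ∈ Finset.range n, 1 / √((i : ℝ) + 1) ≤ 2 * √(n : ℝ) := by
  induction n with
  | zero => simp
  | succ n ih =>
    rw [Finset.sum_range_succ]
    have h0 : (0 : ℝ) ≤ n := n.cast_nonneg
    have hb := Real.sq_sqrt (by positivity : (0 : ℝ) ≤ (n : ℝ) + 1)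
    have ha := Real.sq_sqrt h0
    have hbp : 0 < √((n : ℝ) + 1) := Real.sqrt_pos.2 (by positivity)
    have : 1 / √((n : ℝ) + 1) ≤ 2 * √((n : ℝ) + 1) - 2 * √(n : ℝ) := by
      rw [div_le_iff₀ hbp]
      nlinarith [sq_nonneg (√((n : ℝ) + 1) - √(n : ℝ))]
    push_cast
    linarith

/-- The leading `1` is the price of the first, uninformed observation. The lower-order terms `-1 - 1
/ √(n + 1)` are kept because they pay for it later. -/
lemma sum_one_div_sqrt_le {c : ℝ} (hc : 0 ≤ c) (n : ℕ) :
    ∑ i ∈ Finset.range (n + 1), (if i = 0 then 1 else c / √(i : ℝ)) ≤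
      1 + c * (2 * √((n + 1 : ℕ) : ℝ) - 1 - 1 / √((n + 1 : ℕ) : ℝ)) := by
  induction n with
  | zero => norm_num
  | succ n ih =>
    rw [Finset.sum_range_succ, if_neg (Nat.succ_ne_zero n)]
    refine (add_le_add_left ih _).trans ?_
    set a := √((n + 1 : ℕ) : ℝ)
    have hbp : 0 < √((n + 1 + 1 : ℕ) : ℝ) := Real.sqrt_pos.2 (by positivity)
    have hap : 0 < a := Real.sqrt_pos.2 (by positivity)
    have hb := Real.sq_sqrt (by positivity : (0 : ℝ) ≤ ((n + 1 + 1 : ℕ) : ℝ))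
    have ha : a ^ 2 = ((n + 1 : ℕ) : ℝ) := Real.sq_sqrt (by positivity)
    set b := √((n + 1 + 1 : ℕ) : ℝ)
    rw [Nat.cast_succ (n + 1), ← ha] at hb
    have : 1 / b ≤ 2 * b - 2 * a := by
      rw [div_le_iff₀ hbp]
      nlinarith [sq_nonneg (b - a)]
    have h2 := mul_le_mul_of_nonneg_left this hc
    have h3 : c / a = c * (1 / a) := by ring
    rw [h3]
    nlinarith

/-- The bound on the accumulated optimism of an arm with `n` observations, linearized at `n₀`. -/
lemma optimism_tangent_bound {c c' n₀ : ℝ} (hc : 0 < c) (hc' : 0 < c')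
    (hgap : c ^ 2 + 27 / 10 ≤ c' ^ 2) (hcc : c' ≤ 2 * c) (hn₀ : 0 < n₀) (n : ℕ)
    (hfirst : 1 ≤ n → 1 ≤ c + 2 / 3 * c / √(n : ℝ)) :
    ∑ i ∈ Finset.range n, (if i = 0 then 1 else c / √(i : ℝ)) + 3 / (2 * c') * √(n : ℝ) +
        c' / 12 * (√(n : ℝ) *
          (harmonicBelow n - (Real.log n₀ + Real.eulerMascheroniConstant)) ^ 2) ≤
      c' * (n / √n₀ + √n₀) - 3 / 5 / c' * √n₀ := by
  have hs₀ : 0 < √n₀ := Real.sqrt_pos.2 hn₀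
  have hs₀sq := Real.sq_sqrt hn₀.le
  have hc's : 3 / 5 / c' ≤ c' / 3 := by
    rw [div_le_iff₀ hc']
    nlinarith
  rcases Nat.eq_zero_or_pos n with rfl | hn
  · simp only [Finset.range_zero, Finset.sum_empty, Nat.cast_zero, Real.sqrt_zero]
    have := mul_le_mul_of_nonneg_right hc's hs₀.le
    have h2 : 0 ≤ c' * √n₀ := by positivity
    have h3 : c' * (0 / √n₀ + √n₀) = c' * √n₀ := by ring
    rw [h3]
    linarith
  · have hn' : (1 : ℝ) ≤ n := by exact_mod_cast hn
    set s := √(n : ℝ) with hs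
    have hs1 : 1 ≤ s := by rw [hs]; exact Real.one_le_sqrt.2 hn'
    have hsp : 0 < s := by linarith
    have hssq : s ^ 2 = n := Real.sq_sqrt (by positivity)
    set s₀ := √n₀ with hs₀def
    -- The factor `4` comes from `log n - log n₀ = 2 log (s / s₀)`.
    have hlog : s * (Real.log n - Real.log n₀) ^ 2 ≤ 4 * (s - s₀) ^ 2 / s₀ := by
      have h1 := mul_log_sq_le (div_pos hsp hs₀)
      have h2 : Real.log n - Real.log n₀ = 2 * Real.log (s / s₀) := by
        rw [Real.log_div hsp.ne' hs₀.ne', ← hssq, ← hs₀sq, Real.log_pow, Real.log_pow]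
        push_cast; ring
      rw [h2]
      have h3 : s * (2 * Real.log (s / s₀)) ^ 2 = 4 * s₀ * (s / s₀ * Real.log (s / s₀) ^ 2) := by
        field_simp; ring
      have h4 : 4 * (s - s₀) ^ 2 / s₀ = 4 * s₀ * (s / s₀ - 1) ^ 2 := by
        field_simp
      rw [h3, h4]
      exact mul_le_mul_of_nonneg_left h1 (by positivity)
    have herr := abs_harmonicBelow_sub_log_le hn
    have hharm : s * (harmonicBelow n - (Real.log n₀ + Real.eulerMascheroniConstant)) ^ 2 ≤
        8 * (s - s₀) ^ 2 / s₀ + 2 / s ^ 3 := by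
      set ε := harmonicBelow n - (Real.log n + Real.eulerMascheroniConstant)
      have h1 : harmonicBelow n - (Real.log n₀ + Real.eulerMascheroniConstant) =
          (Real.log n - Real.log n₀) + ε := by ring
      rw [h1]
      have h2 : ε ^ 2 ≤ 1 / s ^ 4 := by
        have := sq_le_sq' (by linarith [neg_abs_le ε]) ((le_abs_self ε).trans herr)
        refine this.trans (le_of_eq ?_)
        rw [← hssq]; field_simp
      have h3 : s * ε ^ 2 ≤ 1 / s ^ 3 := by
        refine (mul_le_mul_of_nonneg_left h2 hsp.le).trans (le_of_eq ?_)
        field_simp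
      have h4 : s * ((Real.log n - Real.log n₀) + ε) ^ 2 ≤
          2 * (s * (Real.log n - Real.log n₀) ^ 2) + 2 * (s * ε ^ 2) := by
        nlinarith [mul_nonneg hsp.le (sq_nonneg ((Real.log n - Real.log n₀) - ε))]
      have h5 : 8 * (s - s₀) ^ 2 / s₀ = 2 * (4 * (s - s₀) ^ 2 / s₀) := by ring
      have h6 : 2 / s ^ 3 = 2 * (1 / s ^ 3) := by ring
      rw [h5, h6]
      linarith
    have hsum : ∑ i ∈ Finset.range n, (if i = 0 then 1 else c / √(i : ℝ)) ≤
        1 + c * (2 * s - 1 - 1 / s) := by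
      obtain ⟨k, rfl⟩ := Nat.exists_eq_add_of_le' hn
      exact sum_one_div_sqrt_le hc.le k
    -- The gain `27 / 10` is spent as `3 / 2` on the variance term and `6 / 5` on the slack in `hd`.
    have ha : 2 * c + 27 / 10 / c' ≤ 2 * c' := by
      have : 27 / 10 / c' ≤ 2 * (c' - c) := by
        rw [div_le_iff₀ hc']
        nlinarith [sq_nonneg (c' - c)]
      linarith
    have ha' := mul_le_mul_of_nonneg_right ha hsp.le
    -- The error of the harmonic number is paid by one third of the term `c / s` from `hsum`; the
    -- other two thirds serve `hfirst`.
    have hb : c' / 12 * (2 / s ^ 3) ≤ 1 / 3 * (c / s) := by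
      have h1 : s ≤ s ^ 3 := by nlinarith [mul_nonneg hsp.le (by nlinarith : 0 ≤ s ^ 2 - 1)]
      have h2 : 2 / s ^ 3 ≤ 2 / s := div_le_div_of_nonneg_left (by norm_num) hsp h1
      have h3 : c' / 12 * (2 / s) ≤ (2 * c) / 12 * (2 / s) := by gcongr
      calc c' / 12 * (2 / s ^ 3) ≤ c' / 12 * (2 / s) :=
            mul_le_mul_of_nonneg_left h2 (by positivity)
        _ ≤ _ := h3
        _ = 1 / 3 * (c / s) := by ring
    -- This follows from `s₀ = (s - s₀) ^ 2 / s₀ + 2 s - s ^ 2 / s₀`. One third of the tangent gap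
    -- is used here; the other two thirds absorb the logarithm, as `8 / 12 = 2 / 3`.
    have hd : 3 / 5 / c' * s₀ ≤ c' / 3 * ((s - s₀) ^ 2 / s₀) + 6 / 5 / c' * s := by
      have h1 : 3 / 5 / c' * ((s - s₀) ^ 2 / s₀) ≤ c' / 3 * ((s - s₀) ^ 2 / s₀) :=
        mul_le_mul_of_nonneg_right hc's (by positivity)
      have h2 : 3 / 5 / c' * ((s - s₀) ^ 2 / s₀) + 6 / 5 / c' * s =
          3 / 5 / c' * s₀ + 3 / 5 / c' * (s ^ 2 / s₀) := by
        field_simp; ring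
      have h3 : 0 ≤ 3 / 5 / c' * (s ^ 2 / s₀) := by positivity
      linarith
    have hcq : c' * (n / s₀ + s₀) = c' * ((s - s₀) ^ 2 / s₀) + 2 * c' * s := by
      rw [← hssq]; field_simp; ring
    have hfirst' := hfirst hn
    have hharm' := mul_le_mul_of_nonneg_left hharm (by positivity : 0 ≤ c' / 12)
    have e1 : c' / 12 * (8 * (s - s₀) ^ 2 / s₀ + 2 / s ^ 3) =
        2 / 3 * (c' * ((s - s₀) ^ 2 / s₀)) + c' / 12 * (2 / s ^ 3) := by ring
    have e2 : c * (2 * s - 1 - 1 / s) = 2 * c * s - c - c / s := by ring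
    have e3 : 2 / 3 * c / s = 2 / 3 * (c / s) := by ring
    have e4 : (2 * c + 27 / 10 / c') * s = 2 * c * s + 27 / 10 * (s / c') := by ring
    have e5 : 3 / (2 * c') * s = 3 / 2 * (s / c') := by field_simp
    have e6 : 6 / 5 / c' * s = 6 / 5 * (s / c') := by ring
    have e7 : c' / 3 * ((s - s₀) ^ 2 / s₀) = 1 / 3 * (c' * ((s - s₀) ^ 2 / s₀)) := by ring
    rw [e1] at hharm'
    rw [e2] at hsum
    rw [e3] at hfirst'
    rw [e4] at ha'
    rw [e6, e7] at hd
    rw [hcq, e5]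
    linarith

/-- The coefficient of `1 / √n` in the largest confidence radius over `T` rounds. -/
def radiusCoeff (K T : ℕ) : ℝ := √(Real.log (2 * Real.pi ^ 2 * K * T ^ 4 / 3) / 2)

/-- The coefficient in the regret bound. -/
def boundCoeff (K T : ℕ) : ℝ := √(2 * Real.log (2 * Real.pi ^ 2 * K * T / 3))

/-! ### Numerical estimates for the two coefficients and the confidence radius -/

lemma two_pi_sq_div_three_bounds :
    (6.57 : ℝ) ≤ 2 * Real.pi ^ 2 / 3 ∧ 2 * Real.pi ^ 2 / 3 ≤ 6.6 := by
  have h1 := Real.pi_gt_d2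
  have h2 := Real.pi_lt_d4
  constructor <;> nlinarith

lemma log_two_pi_sq_div_three_ge : (1.8 : ℝ) ≤ Real.log (2 * Real.pi ^ 2 / 3) := by
  have h := two_pi_sq_div_three_bounds.1
  rw [Real.le_log_iff_exp_le (by linarith)]
  refine le_trans ?_ h
  have he := Real.exp_one_lt_d9
  -- Taking fifth powers reduces the claim to a rational bound on `e`, since `5 * 1.8 = 9`.
  have h9 : Real.exp 1.8 ^ 5 = Real.exp 1 ^ 9 := by
    rw [← Real.exp_nat_mul, ← Real.exp_nat_mul]
    norm_num
  refine le_of_pow_le_pow_left₀ (n := 5) (by norm_num) (by norm_num) ?_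
  rw [h9]
  calc Real.exp 1 ^ 9 ≤ 2.7182818286 ^ 9 := pow_le_pow_left₀ (Real.exp_pos 1).le he.le 9
    _ ≤ 6.57 ^ 5 := by norm_num

variable {K T : ℕ}

lemma log_mul_pow_eq (hK : 1 ≤ K) (hT : 1 ≤ T) (i : ℕ) :
    Real.log (2 * Real.pi ^ 2 * K * T ^ i / 3) =
      Real.log (2 * Real.pi ^ 2 / 3) + Real.log K + i * Real.log T := by
  have hK' : (0 : ℝ) < K := by exact_mod_cast hK
  have hT' : (0 : ℝ) < T := by exact_mod_cast hT
  rw [← Real.log_pow, ← Real.log_mul (by positivity) hK'.ne',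
    ← Real.log_mul (by positivity) (by positivity)]
  congr 1
  ring

lemma radiusCoeff_sq (hK : 1 ≤ K) (hT : 1 ≤ T) : radiusCoeff K T ^ 2 =
    (Real.log (2 * Real.pi ^ 2 / 3) + Real.log K + 4 * Real.log T) / 2 := by
  have h1 : 0 ≤ Real.log K := Real.log_natCast_nonneg K
  have h2 : 0 ≤ Real.log T := Real.log_natCast_nonneg T
  have h3 := log_two_pi_sq_div_three_ge
  have := log_mul_pow_eq hK hT 4
  push_cast at this
  rw [radiusCoeff, this, Real.sq_sqrt (by linarith)]

lemma boundCoeff_sq (hK : 1 ≤ K) (hT : 1 ≤ T) : boundCoeff K T ^ 2 =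
    2 * (Real.log (2 * Real.pi ^ 2 / 3) + Real.log K + Real.log T) := by
  have h1 : 0 ≤ Real.log K := Real.log_natCast_nonneg K
  have h2 : 0 ≤ Real.log T := Real.log_natCast_nonneg T
  have h3 := log_two_pi_sq_div_three_ge
  have := log_mul_pow_eq hK hT 1
  rw [pow_one, Nat.cast_one, one_mul] at this
  rw [boundCoeff, this, Real.sq_sqrt (by linarith)]

lemma radiusCoeff_sq_ge (hK : 1 ≤ K) (hT : 1 ≤ T) : 0.9 ≤ radiusCoeff K T ^ 2 := by
  rw [radiusCoeff_sq hK hT]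
  linarith [Real.log_natCast_nonneg K, Real.log_natCast_nonneg T, log_two_pi_sq_div_three_ge]

lemma radiusCoeff_nonneg : 0 ≤ radiusCoeff K T := Real.sqrt_nonneg _

lemma boundCoeff_nonneg : 0 ≤ boundCoeff K T := Real.sqrt_nonneg _

lemma radiusCoeff_ge (hK : 1 ≤ K) (hT : 1 ≤ T) : 0.9 ≤ radiusCoeff K T := by
  have := radiusCoeff_sq_ge hK hT
  nlinarith [radiusCoeff_nonneg (K := K) (T := T)]

/-- The terms in `log T` cancel, and the difference of the squares is `3 / 2 * (log (2 π ^ 2 / 3) +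
log K)`, at least `3 / 2 * 1.8`. -/
lemma boundCoeff_gap (hK : 1 ≤ K) (hT : 1 ≤ T) :
    radiusCoeff K T ^ 2 + 27 / 10 ≤ boundCoeff K T ^ 2 := by
  rw [radiusCoeff_sq hK hT, boundCoeff_sq hK hT]
  linarith [Real.log_natCast_nonneg K, log_two_pi_sq_div_three_ge]

lemma boundCoeff_pos (hK : 1 ≤ K) (hT : 1 ≤ T) : 0 < boundCoeff K T := by
  have := boundCoeff_gap hK hT
  have := radiusCoeff_sq_ge hK hT
  exact (sq_pos_iff.1 (by linarith : 0 < boundCoeff K T ^ 2)).lt_of_le' boundCoeff_nonneg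

lemma boundCoeff_le (hK : 1 ≤ K) (hT : 1 ≤ T) : boundCoeff K T ≤ 2 * radiusCoeff K T := by
  refine le_of_sq_le_sq ?_ (by linarith [radiusCoeff_nonneg (K := K) (T := T)])
  rw [mul_pow, radiusCoeff_sq hK hT, boundCoeff_sq hK hT]
  linarith [Real.log_natCast_nonneg T]

/-- This absorbs the cost `1` of the first observation. For `T ≥ 2` the coefficient alone exceeds
`1`; for `T = 1` only `n = 1` occurs and the second term helps. -/
lemma one_le_radiusCoeff (hK : 1 ≤ K) (hT : 1 ≤ T) {n : ℕ} (hn : 1 ≤ n) (hnT : n ≤ T) :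
    1 ≤ radiusCoeff K T + 2 / 3 * radiusCoeff K T / √(n : ℝ) := by
  have h0 := radiusCoeff_ge hK hT
  rcases Nat.lt_or_ge T 2 with h | h
  · have : n = 1 := by omega
    subst this
    rw [Nat.cast_one, Real.sqrt_one, div_one]
    linarith
  · have h1 : 1 ≤ radiusCoeff K T := by
      have h2 : (1 : ℝ) ≤ radiusCoeff K T ^ 2 := by
        rw [radiusCoeff_sq hK hT]
        have h3 : Real.log 2 ≤ Real.log T := Real.log_le_log (by norm_num) (by exact_mod_cast h)
        linarith [Real.log_natCast_nonneg K, log_two_pi_sq_div_three_ge, Real.log_two_gt_d9]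
      nlinarith
    have : 0 ≤ 2 / 3 * radiusCoeff K T / √(n : ℝ) := by positivity
    linarith

/-- The slack in the regret bound covers the exceptional rounds. -/
lemma slack_ge (hK : 1 ≤ K) (hT : 1 ≤ T) {N : ℕ} (hN : 1 ≤ N) :
    1 / (4 * (T : ℝ)) ≤ 3 / 5 / boundCoeff K T * √(N * K * T : ℝ) := by
  have hK' : (1 : ℝ) ≤ K := by exact_mod_cast hK
  have hT' : (1 : ℝ) ≤ T := by exact_mod_cast hT
  have hN' : (1 : ℝ) ≤ N := by exact_mod_cast hN
  have hb := boundCoeff_pos hK hT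
  have hKT : (1 : ℝ) ≤ K * T := by nlinarith
  have hsq : boundCoeff K T ^ 2 ≤ 5 * (K * T) := by
    rw [boundCoeff_sq hK hT, ← Real.log_mul (by positivity) (by positivity),
      ← Real.log_mul (by positivity) (by positivity)]
    -- The estimate used is `log x ≤ x / e`; the cruder `log x ≤ x - 1` would give too large a
    -- constant.
    have hpos : 0 < 2 * Real.pi ^ 2 / 3 * K * T / Real.exp 1 := by positivity
    have h1 := Real.log_le_sub_one_of_pos hpos
    rw [Real.log_div (by positivity) (Real.exp_pos 1).ne', Real.log_exp] at h1
    have h2 : 2 * Real.pi ^ 2 / 3 * K * T / Real.exp 1 ≤ 5 / 2 * (K * T) := by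
      rw [div_le_iff₀ (Real.exp_pos 1)]
      have h3 := two_pi_sq_div_three_bounds.2
      have h4 := Real.exp_one_gt_d9
      have h5 : 2 * Real.pi ^ 2 / 3 * (K * T) ≤ 6.6 * (K * T) :=
        mul_le_mul_of_nonneg_right h3 (by positivity)
      nlinarith
    linarith
  have hle : boundCoeff K T ≤ 12 / 5 * √(N * K * T : ℝ) := by
    refine le_of_sq_le_sq ?_ (by positivity)
    rw [mul_pow, Real.sq_sqrt (by positivity)]
    nlinarith
  have h1 : 1 / (4 * (T : ℝ)) ≤ 1 / 4 := by
    apply div_le_div_of_nonneg_left <;> linarith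
  refine h1.trans ?_
  rw [div_mul_eq_mul_div, le_div_iff₀ hb]
  linarith

lemma radius_arg_eq (t : ℕ) : 2 * Real.pi ^ 2 * K * (t : ℝ) ^ 3 / (3 * (1 / (T : ℝ))) =
    2 * Real.pi ^ 2 * K * (t : ℝ) ^ 3 * T / 3 := by
  rw [← div_div, one_div, div_inv_eq_mul]
  ring

lemma radius_le (hK : 1 ≤ K) {t : ℕ} (ht : 1 ≤ t) (htT : t ≤ T) (n : ℕ) :
    radius K (1 / (T : ℝ)) t n ≤ radiusCoeff K T / √(n : ℝ) := by
  have hK' : (1 : ℝ) ≤ K := by exact_mod_cast hK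
  have ht' : (1 : ℝ) ≤ t := by exact_mod_cast ht
  have htT' : (t : ℝ) ≤ T := by exact_mod_cast htT
  have hT' : (0 : ℝ) < T := by linarith
  rw [radius, radiusCoeff, ← Real.sqrt_div' _ (Nat.cast_nonneg n), radius_arg_eq]
  refine Real.sqrt_le_sqrt ?_
  rw [div_div]
  refine div_le_div_of_nonneg_right (Real.log_le_log (by positivity) ?_) (by positivity)
  have : (t : ℝ) ^ 3 * T ≤ T ^ 4 := by
    have := pow_le_pow_left₀ (by linarith) htT' 3
    nlinarith
  have h2 : 2 * Real.pi ^ 2 * K * (t : ℝ) ^ 3 * T = 2 * Real.pi ^ 2 * K * ((t : ℝ) ^ 3 * T) := by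
    ring
  rw [h2]
  gcongr

/-- The tail bound at the confidence radius. -/
lemma exp_neg_radius (hK : 1 ≤ K) (hT : 1 ≤ T) {t n : ℕ} (ht : 1 ≤ t) (hn : 1 ≤ n) :
    Real.exp (-(2 * n * radius K (1 / (T : ℝ)) t n ^ 2)) =
      3 / (2 * Real.pi ^ 2 * K * T) / (t : ℝ) ^ 3 := by
  have hK' : (1 : ℝ) ≤ K := by exact_mod_cast hK
  have ht' : (1 : ℝ) ≤ t := by exact_mod_cast ht
  have hT' : (1 : ℝ) ≤ T := by exact_mod_cast hT
  have hn' : (1 : ℝ) ≤ n := by exact_mod_cast hn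
  have harg : 1 ≤ 2 * Real.pi ^ 2 * K * (t : ℝ) ^ 3 * T / 3 := by
    have h1 := two_pi_sq_div_three_bounds.1
    have h2 : (1 : ℝ) ≤ K * (t : ℝ) ^ 3 * T :=
      one_le_mul_of_one_le_of_one_le
        (one_le_mul_of_one_le_of_one_le hK' (one_le_pow₀ ht')) hT'
    have h3 : 2 * Real.pi ^ 2 * K * (t : ℝ) ^ 3 * T / 3 =
      2 * Real.pi ^ 2 / 3 * (K * (t : ℝ) ^ 3 * T) := by ring
    rw [h3]
    nlinarith
  rw [radius, radius_arg_eq, Real.sq_sqrt (div_nonneg (Real.log_nonneg harg) (by positivity))]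
  have : 2 * (n : ℝ) * (Real.log (2 * Real.pi ^ 2 * K * (t : ℝ) ^ 3 * T / 3) / (2 * n)) =
      Real.log (2 * Real.pi ^ 2 * K * (t : ℝ) ^ 3 * T / 3) := by
    field_simp
  rw [this, Real.exp_neg, Real.exp_log (by linarith)]
  field_simp

/-- Each term is at most `1 / t - 1 / (t + 1)`, because `(t - 1) * (t + 1) ≤ t ^ 2`, and the sum
telescopes. The numerator is the number of positive counts possible before round `t`. -/
lemma sum_one_div_sq_le (T : ℕ) :
    ∑ t ∈ Finset.Icc 1 T, ((t : ℝ) - 1) / (t : ℝ) ^ 3 ≤ 1 := by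
  suffices h : ∑ t ∈ Finset.Icc 1 T, ((t : ℝ) - 1) / (t : ℝ) ^ 3 ≤ 1 - 1 / ((T : ℝ) + 1) by
    refine h.trans ?_
    have : (0 : ℝ) ≤ 1 / ((T : ℝ) + 1) := by positivity
    linarith
  induction T with
  | zero => simp
  | succ n ih =>
    rw [Finset.sum_Icc_succ_top (by omega)]
    have h1 : (((n + 1 : ℕ) : ℝ) - 1) / ((n + 1 : ℕ) : ℝ) ^ 3 ≤
        1 / ((n : ℝ) + 1) - 1 / (((n + 1 : ℕ) : ℝ) + 1) := by
      push_cast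
      have hn : (0 : ℝ) ≤ n := n.cast_nonneg
      rw [div_sub_div _ _ (by positivity) (by positivity), div_le_div_iff₀ (by positivity)
        (by positivity)]
      nlinarith [mul_nonneg hn hn, mul_nonneg hn (mul_nonneg hn hn)]
    linarith

end Scalar

/-! ## One round of a run -/

section Round

variable {K : ℕ} {E : Type*} [MeasurableSpace E] (env : Environment K E)

instance : IsProbabilityMeasure env.law := env.isProb

/-- The indicator that `k` is observed if `A` is selected in round `t`. -/
def fbInd (t : ℕ) (k : Fin K) (A : Finset (Fin K)) (x : E) : ℝ :=
  ind (env.feedback t A x) k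

lemma measurable_ind (k : Fin K) : Measurable fun A : Finset (Fin K) => ind A k :=
  measurable_of_countable _

lemma measurable_fbInd (t : ℕ) (k : Fin K) (A : Finset (Fin K)) :
    Measurable (fbInd env t k A) :=
  (measurable_ind k).comp (env.measurable_feedback t A)

lemma fbInd_nonneg (t : ℕ) (k : Fin K) (A : Finset (Fin K)) (x : E) : 0 ≤ fbInd env t k A x :=
  ind_nonneg _ _

lemma fbInd_le_one (t : ℕ) (k : Fin K) (A : Finset (Fin K)) (x : E) : fbInd env t k A x ≤ 1 :=
  ind_le_one _ _

/-- A quantity with values in `[0,1]` that is independent of whether `k` is observed. -/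
structure IsSample (k : Fin K) (f : E → ℝ) : Prop where
  measurable : Measurable f
  mem : ∀ x, 0 ≤ f x ∧ f x ≤ 1
  indep : ∀ t S, k ∈ S → IndepFun f (fun x => k ∈ env.feedback t S x) env.law

lemma isSample_outcome (k : Fin K) : IsSample env k (env.outcome k) :=
  ⟨env.measurable_outcome k, env.outcome_mem k, fun t S h => env.indep_outcome t S k h⟩

lemma isSample_cost (k : Fin K) : IsSample env k (env.cost k) :=
  ⟨env.measurable_cost k, env.cost_mem k, fun t S h => env.indep_cost t S k h⟩

variable {env}

lemma IsSample.integral_mem {k : Fin K} {f : E → ℝ} (hf : IsSample env k f) :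
    0 ≤ ∫ x, f x ∂env.law ∧ ∫ x, f x ∂env.law ≤ 1 := by
  refine ⟨integral_nonneg fun x => (hf.mem x).1, ?_⟩
  have h : Integrable f env.law := Integrable.of_bound hf.measurable.aestronglyMeasurable 1
    (.of_forall fun x => by rw [Real.norm_of_nonneg (hf.mem x).1]; exact (hf.mem x).2)
  simpa using integral_mono h (integrable_const 1) fun x => (hf.mem x).2

lemma IsSample.abs_centred_le {k : Fin K} {f : E → ℝ} (hf : IsSample env k f) (x : E) :
    |f x - ∫ y, f y ∂env.law| ≤ 1 := by
  have h1 := hf.mem x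
  have h2 := hf.integral_mem
  rw [abs_le]
  constructor <;> linarith

/-- Being observed is independent of the value when `k ∈ A`. Otherwise `k` is never observed and
both sides vanish. -/
lemma IsSample.integral_mul_fbInd {k : Fin K} {f : E → ℝ} (hf : IsSample env k f) {φ : ℝ → ℝ}
    (hφ : Measurable φ) (t : ℕ) (A : Finset (Fin K)) :
    ∫ x, φ (f x) * fbInd env t k A x ∂env.law =
      (∫ x, φ (f x) ∂env.law) * ∫ x, fbInd env t k A x ∂env.law := by
  classical
  by_cases hk : k ∈ A
  · have h := (hf.indep t A hk).comp hφ
      (measurable_from_top : Measurable fun p : Prop => if p then (1 : ℝ) else 0)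
    have h2 := h.integral_mul_eq_mul_integral (hφ.comp hf.measurable).aestronglyMeasurable
      ?_
    · have e : ((fun p : Prop => if p then (1 : ℝ) else 0) ∘ fun x => k ∈ env.feedback t A x) =
        fbInd env t k A := by
        funext x
        simp [fbInd, ind]
      rw [e] at h2
      exact h2
    · have e : ((fun p : Prop => if p then (1 : ℝ) else 0) ∘ fun x => k ∈ env.feedback t A x) =
        fbInd env t k A := by
        funext x
        simp [fbInd, ind]
      rw [e]
      exact (measurable_fbInd env t k A).aestronglyMeasurable
  · have h0 : ∀ x, fbInd env t k A x = 0 := fun x =>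
      ind_of_notMem fun h => hk (env.feedback_subset t A x h)
    simp [h0]

/-- Popoviciu's inequality for a variable in `[0,1]`. -/
lemma IsSample.integral_sq_le {k : Fin K} {f : E → ℝ} (hf : IsSample env k f) :
    ∫ x, (f x - ∫ y, f y ∂env.law) ^ 2 ∂env.law ≤ 1 / 4 := by
  have h := variance_le_sq_of_bounded (μ := env.law) (a := 0) (b := 1) (X := f)
    (.of_forall fun x => hf.mem x) hf.measurable.aemeasurable
  rw [variance_eq_integral hf.measurable.aemeasurable] at h
  norm_num at h ⊢
  exact h

/-- Hoeffding's lemma for a variable in `[0,1]`. -/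
lemma IsSample.integral_exp_le {k : Fin K} {f : E → ℝ} (hf : IsSample env k f) (l : ℝ) :
    ∫ x, Real.exp (l * (f x - ∫ y, f y ∂env.law) - l ^ 2 / 8) ∂env.law ≤ 1 := by
  have h := (hasSubgaussianMGF_of_mem_Icc (μ := env.law) (a := 0) (b := 1) (X := f)
    hf.measurable.aemeasurable (.of_forall fun x => hf.mem x)).mgf_le l
  simp_rw [sub_eq_add_neg _ (l ^ 2 / 8), Real.exp_add]
  rw [integral_mul_const]
  have h2 : ∫ x, Real.exp (l * (f x - ∫ y, f y ∂env.law)) ∂env.law ≤ Real.exp (l ^ 2 / 8) := by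
    refine h.trans (le_of_eq ?_)
    congr 1
    simp
    ring
  calc _ ≤ Real.exp (l ^ 2 / 8) * Real.exp (-(l ^ 2 / 8)) :=
        mul_le_mul_of_nonneg_right h2 (Real.exp_pos _).le
    _ = 1 := by rw [← Real.exp_add]; simp

end Round

/-! ## Measurability with respect to the past -/

section Past

variable {K : ℕ} {E : Type*} [MeasurableSpace E] {env : Environment K E} {Ω : Type*}
  {e : ℕ → Ω → E} {S : ℕ → Ω → Finset (Fin K)}

lemma measurable_env_past {τ t : ℕ} (h : τ ∈ Finset.Ico 1 t) : Measurable[past e S t] (e τ) := by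
  refine (comap_measurable (e τ)).mono ?_ le_rfl
  exact le_trans le_sup_left (le_iSup₂ (f := fun τ (_ : τ ∈ Finset.Ico 1 t) =>
    MeasurableSpace.comap (e τ) inferInstance ⊔ MeasurableSpace.comap (S τ) inferInstance) τ h)

lemma measurable_action_past {τ t : ℕ} (h : τ ∈ Finset.Ico 1 t) :
    Measurable[past e S t] (S τ) := by
  refine (comap_measurable (S τ)).mono ?_ le_rfl
  exact le_trans le_sup_right (le_iSup₂ (f := fun τ (_ : τ ∈ Finset.Ico 1 t) =>
    MeasurableSpace.comap (e τ) inferInstance ⊔ MeasurableSpace.comap (S τ) inferInstance) τ h)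

lemma measurable_apply_action {β : Type*} [MeasurableSpace β] {m : MeasurableSpace Ω}
    {X : Ω → E} {A : Ω → Finset (Fin K)} (hX : Measurable[m] X) (hA : Measurable[m] A)
    {g : Finset (Fin K) → E → β} (hg : ∀ B, Measurable (g B)) :
    Measurable[m] fun ω => g (A ω) (X ω) := by
  have h : Measurable fun q : Finset (Fin K) × E => g q.1 q.2 :=
    measurable_from_prod_countable_right hg
  exact h.comp (hA.prodMk hX)

variable (env e S)

/-- The indicator that `k` is observed in round `t`. -/
def obsInd (t : ℕ) (k : Fin K) (ω : Ω) : ℝ := fbInd env t k (S t ω) (e t ω)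

/-- The sum of the centred observed values of `f` before round `t`. -/
def devSum (f : E → ℝ) (t : ℕ) (k : Fin K) (ω : Ω) : ℝ :=
  ∑ τ ∈ obsRounds env e S t k ω, (f (e τ ω) - ∫ x, f x ∂env.law)

lemma obsInd_eq (t : ℕ) (k : Fin K) (ω : Ω) :
    obsInd env e S t k ω = if k ∈ observed env e S t ω then 1 else 0 := rfl

lemma obsInd_nonneg (t : ℕ) (k : Fin K) (ω : Ω) : 0 ≤ obsInd env e S t k ω := ind_nonneg _ _

lemma obsInd_le_one (t : ℕ) (k : Fin K) (ω : Ω) : obsInd env e S t k ω ≤ 1 := ind_le_one _ _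

lemma devSum_eq_sum (f : E → ℝ) (t : ℕ) (k : Fin K) (ω : Ω) : devSum env e S f t k ω =
    ∑ τ ∈ Finset.Ico 1 t, obsInd env e S τ k ω * (f (e τ ω) - ∫ x, f x ∂env.law) := by
  rw [devSum, obsRounds, Finset.sum_filter]
  refine Finset.sum_congr rfl fun τ _ => ?_
  rw [obsInd_eq]
  split_ifs <;> simp

lemma obsCount_eq_sum (t : ℕ) (k : Fin K) (ω : Ω) : (obsCount env e S t k ω : ℝ) =
    ∑ τ ∈ Finset.Ico 1 t, obsInd env e S τ k ω := by
  rw [obsCount, obsRounds, Finset.card_filter]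
  push_cast
  rfl

lemma obsCount_one (k : Fin K) (ω : Ω) : obsCount env e S 1 k ω = 0 := by
  simp [obsCount, obsRounds]

lemma devSum_one (f : E → ℝ) (k : Fin K) (ω : Ω) : devSum env e S f 1 k ω = 0 := by
  simp [devSum_eq_sum]

lemma obsCount_succ {t : ℕ} (ht : 1 ≤ t) (k : Fin K) (ω : Ω) : obsCount env e S (t + 1) k ω =
    obsCount env e S t k ω + if k ∈ observed env e S t ω then 1 else 0 := by
  unfold obsCount obsRounds
  rw [Finset.card_filter, Finset.card_filter, Finset.sum_Ico_succ_top ht]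

lemma devSum_succ (f : E → ℝ) {t : ℕ} (ht : 1 ≤ t) (k : Fin K) (ω : Ω) :
    devSum env e S f (t + 1) k ω = devSum env e S f t k ω +
      obsInd env e S t k ω * (f (e t ω) - ∫ x, f x ∂env.law) := by
  rw [devSum_eq_sum, devSum_eq_sum, Finset.sum_Ico_succ_top ht]

lemma obsCount_le (t : ℕ) (k : Fin K) (ω : Ω) : obsCount env e S t k ω ≤ t - 1 := by
  refine (Finset.card_filter_le _ _).trans ?_
  simp

lemma devSum_eq_zero_of_obsCount {f : E → ℝ} {t : ℕ} {k : Fin K} {ω : Ω}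
    (h : obsCount env e S t k ω = 0) : devSum env e S f t k ω = 0 := by
  rw [obsCount, Finset.card_eq_zero] at h
  simp [devSum, h]

variable {env}

lemma abs_devSum_le {k : Fin K} {f : E → ℝ} (hf : IsSample env k f) (t : ℕ) (ω : Ω) :
    |devSum env e S f t k ω| ≤ obsCount env e S t k ω := by
  rw [devSum]
  refine (Finset.abs_sum_le_sum_abs _ _).trans ?_
  rw [obsCount, ← nsmul_one, ← Finset.sum_const]
  exact Finset.sum_le_sum fun τ _ => hf.abs_centred_le (e τ ω)

variable {e S}

lemma measurable_obsInd {τ t : ℕ} (h : τ ∈ Finset.Ico 1 t) (k : Fin K) :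
    Measurable[past e S t] (obsInd env e S τ k) :=
  measurable_apply_action (measurable_env_past h) (measurable_action_past h)
    (measurable_fbInd env τ k)

lemma measurable_devSum {f : E → ℝ} (hf : Measurable f) (t : ℕ) (k : Fin K) :
    Measurable[past e S t] (devSum env e S f t k) := by
  have h : devSum env e S f t k = fun ω => ∑ τ ∈ Finset.Ico 1 t,
      obsInd env e S τ k ω * (f (e τ ω) - ∫ x, f x ∂env.law) :=
    funext fun ω => devSum_eq_sum env e S f t k ω
  rw [h]
  exact Finset.measurable_fun_sum _ fun τ hτ =>
    (measurable_obsInd hτ k).mul ((hf.comp (measurable_env_past hτ)).sub_const _)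

lemma measurable_obsCount (t : ℕ) (k : Fin K) :
    Measurable[past e S t] (obsCount env e S t k) := by
  -- As a real number the count is a sum of measurable indicators; the floor brings it back to `ℕ`.
  have h : Measurable[past e S t] fun ω => ⌊(obsCount env e S t k ω : ℝ)⌋₊ := by
    refine Nat.measurable_floor.comp ?_
    simp_rw [obsCount_eq_sum]
    exact Finset.measurable_fun_sum _ fun τ hτ => measurable_obsInd hτ k
  simpa using h

end Past

/-! ## Means over one round of a run -/

section Run

variable {K : ℕ} {E : Type*} [MeasurableSpace E] {env : Environment K E} {Ω : Type*}
  {e : ℕ → Ω → E} {S : ℕ → Ω → Finset (Fin K)} [mΩ : MeasurableSpace Ω]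
  {m : RewardModel} {N T : ℕ} {ρ α δ : ℝ} {P : Measure Ω}
  {Z : ℕ → Ω → Fin K → ℝ} {σ : ℕ → (Fin K → ℝ) → PMF (Finset (Fin K))}

lemma integrable_of_abs_le [IsFiniteMeasure P] {f : Ω → ℝ} (hf : Measurable f) {C : ℝ} (h : ∀ ω, |f ω| ≤ C) :
    Integrable f P :=
  Integrable.of_bound hf.aestronglyMeasurable C (.of_forall h)

namespace IsRun

variable (hrun : IsRun env e S m N T ρ α δ P Z σ)
include hrun

lemma past_le {t : ℕ} (ht : t ≤ T + 1) : past e S t ≤ mΩ := by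
  refine iSup₂_le fun τ hτ => ?_
  have h : τ ∈ Finset.Icc 1 T := by
    rw [Finset.mem_Ico] at hτ
    rw [Finset.mem_Icc]
    omega
  exact sup_le (hrun.measurable_env τ h).comap_le (hrun.measurable_action τ h).comap_le

lemma measurable_of_past {β : Type*} [MeasurableSpace β] {t : ℕ} (ht : t ≤ T + 1) {f : Ω → β}
    (hf : Measurable[past e S t] f) : Measurable f :=
  hf.mono (hrun.past_le ht) le_rfl

lemma measurable_obsInd' {t : ℕ} (ht : t ∈ Finset.Icc 1 T) (k : Fin K) :
    Measurable (obsInd env e S t k) :=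
  measurable_apply_action (hrun.measurable_env t ht) (hrun.measurable_action t ht)
    (measurable_fbInd env t k)

variable [IsProbabilityMeasure P]

/-- The environment's randomness of round `t` can be integrated out. -/
lemma integral_mul_apply {t : ℕ} (ht : t ∈ Finset.Icc 1 T) {F : Ω → ℝ}
    (hF : Measurable[past e S t] F) {C : ℝ} (hC : ∀ ω, |F ω| ≤ C)
    {g : Finset (Fin K) → E → ℝ} (hg : ∀ A, Measurable (g A)) {C' : ℝ}
    (hC' : ∀ A x, |g A x| ≤ C') :
    ∫ ω, F ω * g (S t ω) (e t ω) ∂P = ∫ ω, F ω * ∫ x, g (S t ω) x ∂env.law ∂P := by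
  have ht1 : t ≤ T + 1 := by rw [Finset.mem_Icc] at ht; omega
  have hFm := hrun.measurable_of_past ht1 hF
  have hSm := hrun.measurable_action t ht
  have hem := hrun.measurable_env t ht
  have hind : ∀ A : Finset (Fin K), Measurable fun ω => if S t ω = A then (1 : ℝ) else 0 :=
    fun A => Measurable.ite (hSm (measurableSet_singleton A)) measurable_const measurable_const
  have hFA : ∀ A ω, |F ω * (if S t ω = A then (1 : ℝ) else 0)| ≤ C := by
    intro A ω
    split_ifs
    · simpa using hC ω
    · simpa using (abs_nonneg _).trans (hC ω)
  have hFAi : ∀ A, Integrable (fun ω => F ω * (if S t ω = A then (1 : ℝ) else 0)) P :=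
    fun A => integrable_of_abs_le (hFm.mul (hind A)) (hFA A)
  -- Splitting over the finitely many actions freezes `S t`. What remains is a factor determined by
  -- the past and the action, times a function of `e t`, and the two are independent.
  have hsplit : ∀ h : Finset (Fin K) → Ω → ℝ, ∀ ω, F ω * h (S t ω) ω =
      ∑ A, (F ω * (if S t ω = A then (1 : ℝ) else 0)) * h A ω := by
    intro h ω
    rw [Finset.sum_eq_single (S t ω)]
    · simp
    · intro A _ hA
      simp [hA.symm]
    · simp
  rw [integral_congr_ae (.of_forall (hsplit fun A ω => g A (e t ω))),
    integral_congr_ae (.of_forall (hsplit fun A _ => ∫ x, g A x ∂env.law)),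
    integral_finsetSum, integral_finsetSum]
  · refine Finset.sum_congr rfl fun A _ => ?_
    rw [integral_mul_const]
    have hFA' : Measurable[past e S t ⊔ MeasurableSpace.comap (S t) inferInstance]
        fun ω => F ω * (if S t ω = A then (1 : ℝ) else 0) := by
      refine (hF.mono le_sup_left le_rfl).mul ?_
      refine Measurable.ite ?_ measurable_const measurable_const
      exact (le_sup_right : MeasurableSpace.comap (S t) inferInstance ≤
        past e S t ⊔ MeasurableSpace.comap (S t) inferInstance) _
        ⟨{A}, measurableSet_singleton A, rfl⟩
    have hindep : IndepFun (fun ω => F ω * (if S t ω = A then (1 : ℝ) else 0))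
        (fun ω => g A (e t ω)) P := by
      rw [IndepFun_iff_Indep]
      refine indep_of_indep_of_le_left (indep_of_indep_of_le_right
        (hrun.env_indep t ht).symm ?_) hFA'.comap_le
      exact ((hg A).comp (comap_measurable (e t))).comap_le
    have h1 := hindep.integral_mul_eq_mul_integral (hFm.mul (hind A)).aestronglyMeasurable
      ((hg A).comp hem).aestronglyMeasurable
    have h2 : ∫ ω, g A (e t ω) ∂P = ∫ x, g A x ∂env.law := by
      rw [← hrun.env_law t ht, integral_map hem.aemeasurable (hg A).aestronglyMeasurable]
    rw [← h2]
    exact h1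
  · exact fun A _ => (hFAi A).mul_const _
  · intro A _
    refine integrable_of_abs_le (C := C * C') ((hFm.mul (hind A)).mul ((hg A).comp hem))
      fun ω => ?_
    rw [abs_mul]
    exact mul_le_mul (hFA A ω) (hC' A _) (abs_nonneg _) ((abs_nonneg _).trans (hC ω))

lemma integral_mul_sample {t : ℕ} (ht : t ∈ Finset.Icc 1 T) {k : Fin K} {f : E → ℝ}
    (hf : IsSample env k f) {F : Ω → ℝ} (hF : Measurable[past e S t] F) {C : ℝ}
    (hC : ∀ ω, |F ω| ≤ C) {φ : ℝ → ℝ} (hφ : Measurable φ) {C' : ℝ}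
    (hC' : ∀ x, |φ (f x)| ≤ C') :
    ∫ ω, F ω * (φ (f (e t ω)) * obsInd env e S t k ω) ∂P =
      (∫ x, φ (f x) ∂env.law) * ∫ ω, F ω * obsInd env e S t k ω ∂P := by
  have hb : ∀ A x, |fbInd env t k A x| ≤ 1 := fun A x => by
    rw [abs_of_nonneg (fbInd_nonneg env t k A x)]; exact fbInd_le_one env t k A x
  have h1 := hrun.integral_mul_apply ht hF hC (measurable_fbInd env t k) hb
  have h2 := hrun.integral_mul_apply ht hF hC (g := fun A x => φ (f x) * fbInd env t k A x)
    (fun A => (hφ.comp hf.measurable).mul (measurable_fbInd env t k A)) (C' := C')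
    (fun A x => by
      rw [abs_mul]
      exact (mul_le_of_le_one_right (abs_nonneg _) (hb A x)).trans (hC' x))
  simp only [obsInd]
  rw [h1, h2, ← integral_const_mul]
  refine integral_congr_ae (.of_forall fun ω => ?_)
  simp only [hf.integral_mul_fbInd hφ]
  ring

/-- Centred observed values have conditional mean zero. -/
lemma integral_mul_centred {t : ℕ} (ht : t ∈ Finset.Icc 1 T) {k : Fin K} {f : E → ℝ}
    (hf : IsSample env k f) {F : Ω → ℝ} (hF : Measurable[past e S t] F) {C : ℝ}
    (hC : ∀ ω, |F ω| ≤ C) :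
    ∫ ω, F ω * ((f (e t ω) - ∫ x, f x ∂env.law) * obsInd env e S t k ω) ∂P = 0 := by
  rw [hrun.integral_mul_sample ht hf hF hC (φ := fun y => y - ∫ x, f x ∂env.law)
    (measurable_id.sub_const _) (hf.abs_centred_le)]
  rw [integral_sub, integral_const]
  · simp
  · exact Integrable.of_bound hf.measurable.aestronglyMeasurable 1
      (.of_forall fun x => by rw [Real.norm_of_nonneg (hf.mem x).1]; exact (hf.mem x).2)
  · exact integrable_const _

/-- Centred observed values have conditional variance at most `1/4`. -/
lemma integral_mul_centred_sq_le {t : ℕ} (ht : t ∈ Finset.Icc 1 T) {k : Fin K} {f : E → ℝ}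
    (hf : IsSample env k f) {F : Ω → ℝ} (hF : Measurable[past e S t] F) {C : ℝ}
    (hC : ∀ ω, |F ω| ≤ C) (h0 : ∀ ω, 0 ≤ F ω) :
    ∫ ω, F ω * ((f (e t ω) - ∫ x, f x ∂env.law) ^ 2 * obsInd env e S t k ω) ∂P ≤
      1 / 4 * ∫ ω, F ω * obsInd env e S t k ω ∂P := by
  rw [hrun.integral_mul_sample ht hf hF hC (φ := fun y => (y - ∫ x, f x ∂env.law) ^ 2)
    ((measurable_id.sub_const _).pow_const 2) (C' := 1) fun x => by
      rw [abs_pow]; exact pow_le_one₀ (abs_nonneg _) (hf.abs_centred_le x)]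
  exact mul_le_mul_of_nonneg_right hf.integral_sq_le
    (integral_nonneg fun ω => mul_nonneg (h0 ω) (obsInd_nonneg env e S t k ω))

/-- The exponential supermartingale step. -/
lemma integral_mul_exp_le {t : ℕ} (ht : t ∈ Finset.Icc 1 T) {k : Fin K} {f : E → ℝ}
    (hf : IsSample env k f) (l : ℝ) {F : Ω → ℝ} (hF : Measurable[past e S t] F) {C : ℝ}
    (hC : ∀ ω, |F ω| ≤ C) (h0 : ∀ ω, 0 ≤ F ω) :
    ∫ ω, F ω * Real.exp (obsInd env e S t k ω *
      (l * (f (e t ω) - ∫ x, f x ∂env.law) - l ^ 2 / 8)) ∂P ≤ ∫ ω, F ω ∂P := by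
  have ht1 : t ≤ T + 1 := by rw [Finset.mem_Icc] at ht; omega
  have hFm := hrun.measurable_of_past ht1 hF
  set φ : ℝ → ℝ := fun y => Real.exp (l * (y - ∫ x, f x ∂env.law) - l ^ 2 / 8) - 1 with hφ
  have hφm : Measurable φ := by
    refine Measurable.sub_const (Real.measurable_exp.comp ?_) 1
    exact ((measurable_id.sub_const _).const_mul l).sub_const _
  have hexp : ∀ x, Real.exp (l * (f x - ∫ y, f y ∂env.law) - l ^ 2 / 8) ≤ Real.exp |l| := by
    intro x
    refine Real.exp_le_exp.2 ?_
    have h1 : l * (f x - ∫ y, f y ∂env.law) ≤ |l| := by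
      refine (le_abs_self _).trans ?_
      rw [abs_mul]
      exact mul_le_of_le_one_right (abs_nonneg _) (hf.abs_centred_le x)
    nlinarith [sq_nonneg l]
  have hφb : ∀ x, |φ (f x)| ≤ Real.exp |l| + 1 := by
    intro x
    have h1 := hexp x
    have h2 := Real.exp_pos (l * (f x - ∫ y, f y ∂env.law) - l ^ 2 / 8)
    simp only [hφ]
    rw [abs_le]
    constructor <;> linarith
  -- For `b ∈ {0, 1}` one has `exp (b x) = 1 + b (exp x - 1)`. This makes the expression linear in
  -- the indicator, so `integral_mul_sample` applies.
  have hstep : ∀ ω, F ω * Real.exp (obsInd env e S t k ω *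
      (l * (f (e t ω) - ∫ x, f x ∂env.law) - l ^ 2 / 8)) =
      F ω + F ω * (φ (f (e t ω)) * obsInd env e S t k ω) := by
    intro ω
    rw [obsInd_eq]
    simp only [hφ]
    split_ifs
    · rw [one_mul]; ring
    · simp
  have hint : Integrable (fun ω => F ω * (φ (f (e t ω)) * obsInd env e S t k ω)) P := by
    refine integrable_of_abs_le (C := C * (Real.exp |l| + 1)) (hFm.mul
      ((hφm.comp (hf.measurable.comp (hrun.measurable_env t ht))).mul
        (hrun.measurable_obsInd' ht k))) fun ω => ?_
    rw [abs_mul, abs_mul, abs_of_nonneg (obsInd_nonneg env e S t k ω)]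
    refine mul_le_mul (hC ω) ?_ (mul_nonneg (abs_nonneg _) (obsInd_nonneg env e S t k ω))
      ((abs_nonneg _).trans (hC ω))
    exact (mul_le_of_le_one_right (abs_nonneg _) (obsInd_le_one env e S t k ω)).trans (hφb _)
  rw [integral_congr_ae (.of_forall hstep), integral_add (integrable_of_abs_le hFm hC) hint,
    hrun.integral_mul_sample ht hf hF hC hφm hφb]
  have hneg : ∫ x, φ (f x) ∂env.law ≤ 0 := by
    simp only [hφ]
    rw [integral_sub _ (integrable_const _)]
    · have := hf.integral_exp_le l
      simpa using this
    · refine Integrable.of_bound (C := Real.exp |l|) ?_ (.of_forall fun x => ?_)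
      · refine (Real.measurable_exp.comp ?_).aestronglyMeasurable
        exact ((hf.measurable.sub_const _).const_mul l).sub_const _
      · rw [Real.norm_of_nonneg (Real.exp_pos _).le]
        exact hexp x
  have hpos : 0 ≤ ∫ ω, F ω * obsInd env e S t k ω ∂P :=
    integral_nonneg fun ω => mul_nonneg (h0 ω) (obsInd_nonneg env e S t k ω)
  nlinarith

end IsRun

end Run

/-! ## One arm over a run -/

section Arm

variable {K : ℕ} {E : Type*} [MeasurableSpace E] {env : Environment K E} {Ω : Type*}
  {e : ℕ → Ω → E} {S : ℕ → Ω → Finset (Fin K)}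

lemma obsCount_succ_of_obs {t : ℕ} (ht : 1 ≤ t) {k : Fin K} {ω : Ω}
    (h : k ∈ observed env e S t ω) :
    obsCount env e S (t + 1) k ω = obsCount env e S t k ω + 1 := by
  rw [obsCount_succ env e S ht, if_pos h]

lemma obsCount_succ_of_not_obs {t : ℕ} (ht : 1 ≤ t) {k : Fin K} {ω : Ω}
    (h : k ∉ observed env e S t ω) :
    obsCount env e S (t + 1) k ω = obsCount env e S t k ω := by
  rw [obsCount_succ env e S ht, if_neg h, add_zero]

lemma obsInd_of_obs {t : ℕ} {k : Fin K} {ω : Ω} (h : k ∈ observed env e S t ω) :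
    obsInd env e S t k ω = 1 := by
  rw [obsInd_eq, if_pos h]

lemma obsInd_of_not_obs {t : ℕ} {k : Fin K} {ω : Ω} (h : k ∉ observed env e S t ω) :
    obsInd env e S t k ω = 0 := by
  rw [obsInd_eq, if_neg h]

/-- A sum over the numbers of earlier observations at the rounds in which `k` is observed. -/
lemma sum_obsInd_mul (φ : ℕ → ℝ) (T : ℕ) (k : Fin K) (ω : Ω) :
    ∑ t ∈ Finset.Icc 1 T, obsInd env e S t k ω * φ (obsCount env e S t k ω) =
      ∑ i ∈ Finset.range (obsCount env e S (T + 1) k ω), φ i := by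
  induction T with
  | zero => simp [obsCount_one]
  | succ T ih =>
    rw [Finset.sum_Icc_succ_top (by omega), ih]
    by_cases h : k ∈ observed env e S (T + 1) ω
    · rw [obsCount_succ_of_obs (by omega) h, Finset.sum_range_succ, obsInd_of_obs h, one_mul]
    · rw [obsCount_succ_of_not_obs (by omega) h, obsInd_of_not_obs h, zero_mul, add_zero]

/-- Summation by parts for the accumulated mean deviations. -/
lemma devSum_mul_harmonic (f : E → ℝ) (h : ℝ) (T : ℕ) (k : Fin K) (ω : Ω) :
    devSum env e S f (T + 1) k ω * (harmonicBelow (obsCount env e S (T + 1) k ω) - h) =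
      ∑ t ∈ Finset.Icc 1 T,
        obsInd env e S t k ω * (devSum env e S f t k ω / obsCount env e S t k ω) +
      ∑ t ∈ Finset.Icc 1 T, (harmonicBelow (obsCount env e S t k ω + 1) - h) *
        ((f (e t ω) - ∫ x, f x ∂env.law) * obsInd env e S t k ω) := by
  induction T with
  | zero => simp [devSum_one]
  | succ T ih =>
    rw [Finset.sum_Icc_succ_top (by omega), Finset.sum_Icc_succ_top (by omega),
      devSum_succ env e S f (by omega)]
    by_cases ho : k ∈ observed env e S (T + 1) ω
    · rw [obsCount_succ_of_obs (by omega) ho, obsInd_of_obs ho]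
      -- At count `0` the increment is `1 / 0 = 0`, in agreement with the quotient `devSum /
      -- obsCount`.
      have hG : harmonicBelow (obsCount env e S (T + 1) k ω + 1) =
          harmonicBelow (obsCount env e S (T + 1) k ω) +
            1 / (obsCount env e S (T + 1) k ω : ℝ) := Finset.sum_range_succ _ _
      linear_combination ih + devSum env e S f (T + 1) k ω * hG
    · rw [obsCount_succ_of_not_obs (by omega) ho, obsInd_of_not_obs ho]
      linear_combination ih

/-- Before a fixed round only finitely many counts occur, and the count bounds the deviation sum.
Boundedness gives every integrability statement below, whatever `φ` is. -/
lemma exists_bound_devSum_pow_mul {k : Fin K} {f : E → ℝ} (hf : IsSample env k f) (j t : ℕ)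
    (φ : ℕ → ℝ) : ∃ C, ∀ ω,
      |devSum env e S f t k ω ^ j * φ (obsCount env e S t k ω)| ≤ C := by
  refine ⟨∑ n ∈ Finset.range (t + 1), (n : ℝ) ^ j * |φ n|, fun ω => ?_⟩
  have hmem : obsCount env e S t k ω ∈ Finset.range (t + 1) := by
    have := obsCount_le env e S t k ω
    rw [Finset.mem_range]
    omega
  rw [abs_mul, abs_pow]
  refine le_trans ?_ (Finset.single_le_sum (f := fun n : ℕ => (n : ℝ) ^ j * |φ n|)
    (fun n _ => by positivity) hmem)
  exact mul_le_mul_of_nonneg_right (pow_le_pow_left₀ (abs_nonneg _) (abs_devSum_le e S hf t ω) j)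
    (abs_nonneg _)

lemma exists_bound_obsCount (k : Fin K) (t : ℕ) (φ : ℕ → ℝ) :
    ∃ C, ∀ ω, |φ (obsCount env e S t k ω)| ≤ C := by
  refine ⟨∑ n ∈ Finset.range (t + 1), |φ n|, fun ω => ?_⟩
  have hmem : obsCount env e S t k ω ∈ Finset.range (t + 1) := by
    have := obsCount_le env e S t k ω
    rw [Finset.mem_range]
    omega
  exact Finset.single_le_sum (f := fun n : ℕ => |φ n|) (fun n _ => abs_nonneg _) hmem

lemma measurable_devSum_pow_mul {f : E → ℝ} (hf : Measurable f) (j t : ℕ) (k : Fin K)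
    (φ : ℕ → ℝ) : Measurable[past e S t] fun ω =>
      devSum env e S f t k ω ^ j * φ (obsCount env e S t k ω) :=
  ((measurable_devSum hf t k).pow_const j).mul
    ((measurable_of_countable φ).comp (measurable_obsCount t k))

lemma measurable_comp_obsCount (t : ℕ) (k : Fin K) (φ : ℕ → ℝ) :
    Measurable[past e S t] fun ω => φ (obsCount env e S t k ω) :=
  (measurable_of_countable φ).comp (measurable_obsCount t k)

variable [mΩ : MeasurableSpace Ω]
  {m : RewardModel} {N T : ℕ} {ρ α δ : ℝ} {P : Measure Ω}
  {Z : ℕ → Ω → Fin K → ℝ} {σ : ℕ → (Fin K → ℝ) → PMF (Finset (Fin K))}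

namespace IsRun

variable (hrun : IsRun env e S m N T ρ α δ P Z σ)
include hrun

lemma integrable_mul_obsInd {F : Ω → ℝ} (hF : Integrable F P) {t : ℕ}
    (ht : t ∈ Finset.Icc 1 T) (k : Fin K) :
    Integrable (fun ω => F ω * obsInd env e S t k ω) P := by
  refine hF.mul_bdd (c := 1) (hrun.measurable_obsInd' ht k).aestronglyMeasurable
    (.of_forall fun ω => ?_)
  rw [Real.norm_of_nonneg (obsInd_nonneg env e S t k ω)]
  exact obsInd_le_one env e S t k ω

lemma integrable_mul_centred_pow {k : Fin K} {f : E → ℝ} (hf : IsSample env k f) (j : ℕ)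
    {F : Ω → ℝ} (hF : Integrable F P) {t : ℕ} (ht : t ∈ Finset.Icc 1 T) :
    Integrable (fun ω => F ω * ((f (e t ω) - ∫ x, f x ∂env.law) ^ j *
      obsInd env e S t k ω)) P := by
  have hm : Measurable fun ω => (f (e t ω) - ∫ x, f x ∂env.law) ^ j * obsInd env e S t k ω :=
    (((hf.measurable.comp (hrun.measurable_env t ht)).sub_const _).pow_const j).mul
      (hrun.measurable_obsInd' ht k)
  refine hF.mul_bdd (c := 1) hm.aestronglyMeasurable (.of_forall fun ω => ?_)
  rw [Real.norm_eq_abs, abs_mul, abs_pow, abs_of_nonneg (obsInd_nonneg env e S t k ω)]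
  exact mul_le_one₀ (pow_le_one₀ (abs_nonneg _) (hf.abs_centred_le _))
    (obsInd_nonneg env e S t k ω) (obsInd_le_one env e S t k ω)

variable [IsProbabilityMeasure P]

lemma integrable_devSum_pow_mul {k : Fin K} {f : E → ℝ} (hf : IsSample env k f) (j : ℕ) {t : ℕ}
    (ht : t ≤ T + 1) (φ : ℕ → ℝ) :
    Integrable (fun ω => devSum env e S f t k ω ^ j * φ (obsCount env e S t k ω)) P := by
  obtain ⟨C, hC⟩ := exists_bound_devSum_pow_mul (e := e) (S := S) hf j t φ
  exact integrable_of_abs_le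
    (hrun.measurable_of_past ht (measurable_devSum_pow_mul hf.measurable j t k φ)) hC

lemma integrable_comp_obsCount (k : Fin K) {t : ℕ} (ht : t ≤ T + 1) (φ : ℕ → ℝ) :
    Integrable (fun ω => φ (obsCount env e S t k ω)) P := by
  obtain ⟨C, hC⟩ := exists_bound_obsCount (env := env) (e := e) (S := S) k t φ
  exact integrable_of_abs_le
    (hrun.measurable_of_past ht (measurable_comp_obsCount t k φ)) hC

lemma integrable_obsInd_mul_dev {k : Fin K} {f : E → ℝ} (hf : IsSample env k f) {t : ℕ}
    (ht : t ∈ Finset.Icc 1 T) : Integrable (fun ω =>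
      obsInd env e S t k ω * (devSum env e S f t k ω / obsCount env e S t k ω)) P := by
  have ht1 : t ≤ T + 1 := by rw [Finset.mem_Icc] at ht; omega
  have h := hrun.integrable_mul_obsInd
    (hrun.integrable_devSum_pow_mul hf 1 ht1 fun n => 1 / (n : ℝ)) ht k
  refine h.congr (.of_forall fun ω => ?_)
  simp only [pow_one]
  ring

/-- The mean of the accumulated deviations depends on the harmonic numbers only up to a constant,
because the deviations have mean zero. -/
lemma integral_sum_dev {k : Fin K} {f : E → ℝ} (hf : IsSample env k f) (h : ℝ) :
    ∫ ω, ∑ t ∈ Finset.Icc 1 T,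
        obsInd env e S t k ω * (devSum env e S f t k ω / obsCount env e S t k ω) ∂P =
      ∫ ω, devSum env e S f (T + 1) k ω *
        (harmonicBelow (obsCount env e S (T + 1) k ω) - h) ∂P := by
  have hbound : ∀ t ∈ Finset.Icc 1 T, t ≤ T + 1 := fun t ht => by
    rw [Finset.mem_Icc] at ht; omega
  have hint : ∀ t ∈ Finset.Icc 1 T, Integrable (fun ω =>
      (harmonicBelow (obsCount env e S t k ω + 1) - h) *
        ((f (e t ω) - ∫ x, f x ∂env.law) * obsInd env e S t k ω)) P := by
    intro t ht
    simpa using hrun.integrable_mul_centred_pow hf 1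
      (hrun.integrable_comp_obsCount k (hbound t ht) fun n => harmonicBelow (n + 1) - h) ht
  simp_rw [devSum_mul_harmonic]
  rw [integral_add (integrable_finsetSum _ fun t ht => hrun.integrable_obsInd_mul_dev hf ht)
    (integrable_finsetSum _ hint), integral_finsetSum _ hint, left_eq_add]
  -- The harmonic number at the count plus one is determined by the past, so each term is a
  -- martingale increment.
  refine Finset.sum_eq_zero fun t ht => ?_
  obtain ⟨C, hC⟩ := exists_bound_obsCount (env := env) (e := e) (S := S) k t
    fun n => harmonicBelow (n + 1) - h
  exact hrun.integral_mul_centred ht hf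
    (measurable_comp_obsCount t k fun n => harmonicBelow (n + 1) - h) hC

/-- The mean of the squared deviation, normalized by the square root of the number of
observations. -/
lemma integral_devSum_sq_le {k : Fin K} {f : E → ℝ} (hf : IsSample env k f) {t : ℕ}
    (ht : t ≤ T) :
    ∫ ω, devSum env e S f (t + 1) k ω ^ 2 * (1 / √(obsCount env e S (t + 1) k ω : ℝ)) ∂P ≤
      1 / 4 * ∫ ω, ∑ i ∈ Finset.range (obsCount env e S (t + 1) k ω),
        1 / √((i : ℝ) + 1) ∂P := by
  induction t with
  | zero => simp [devSum_one, obsCount_one]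
  | succ t ih =>
    have htm : t + 1 ∈ Finset.Icc 1 T := Finset.mem_Icc.2 ⟨by omega, ht⟩
    have ht1 : t + 1 ≤ T + 1 := by omega
    have ih' := ih (by omega)
    set a := ∫ x, f x ∂env.law with ha
    -- Expand the square of the new deviation sum. The larger count only lowers the weight of the
    -- old square, also at count `0`, where the old deviation sum is zero.
    have hpt : ∀ ω, devSum env e S f (t + 1 + 1) k ω ^ 2 *
        (1 / √(obsCount env e S (t + 1 + 1) k ω : ℝ)) ≤
        devSum env e S f (t + 1) k ω ^ 2 * (1 / √(obsCount env e S (t + 1) k ω : ℝ)) +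
        (2 * ((devSum env e S f (t + 1) k ω ^ 1 *
          (1 / √((obsCount env e S (t + 1) k ω : ℝ) + 1))) *
          ((f (e (t + 1) ω) - a) ^ 1 * obsInd env e S (t + 1) k ω)) +
        (1 / √((obsCount env e S (t + 1) k ω : ℝ) + 1)) *
          ((f (e (t + 1) ω) - a) ^ 2 * obsInd env e S (t + 1) k ω)) := by
      intro ω
      rw [devSum_succ env e S f (by omega : 1 ≤ t + 1)]
      by_cases ho : k ∈ observed env e S (t + 1) ω
      · rw [obsCount_succ_of_obs (by omega) ho, obsInd_of_obs ho]
        push_cast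
        have hmono : devSum env e S f (t + 1) k ω ^ 2 *
            (1 / √((obsCount env e S (t + 1) k ω : ℝ) + 1)) ≤
            devSum env e S f (t + 1) k ω ^ 2 * (1 / √(obsCount env e S (t + 1) k ω : ℝ)) := by
          rcases Nat.eq_zero_or_pos (obsCount env e S (t + 1) k ω) with h0 | h0
          · rw [devSum_eq_zero_of_obsCount env e S h0]
            simp
          · refine mul_le_mul_of_nonneg_left ?_ (sq_nonneg _)
            have h0' : (0 : ℝ) < obsCount env e S (t + 1) k ω := by exact_mod_cast h0
            exact one_div_le_one_div_of_le (Real.sqrt_pos.2 h0')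
              (Real.sqrt_le_sqrt (by linarith))
        rw [← ha]
        linarith
      · rw [obsCount_succ_of_not_obs (by omega) ho, obsInd_of_not_obs ho]
        simp
    have hi1 := hrun.integrable_devSum_pow_mul hf 2 ht1 fun n => 1 / √(n : ℝ)
    have hi2 := (hrun.integrable_mul_centred_pow hf 1
      (hrun.integrable_devSum_pow_mul hf 1 ht1 fun n => 1 / √((n : ℝ) + 1)) htm).const_mul 2
    have hi3 := hrun.integrable_mul_centred_pow hf 2
      (hrun.integrable_comp_obsCount k ht1 fun n => 1 / √((n : ℝ) + 1)) htm
    have hi4 := hrun.integrable_devSum_pow_mul hf 2 (by omega : t + 1 + 1 ≤ T + 1)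
      fun n => 1 / √(n : ℝ)
    have hzero : ∫ ω, 2 * ((devSum env e S f (t + 1) k ω ^ 1 *
          (1 / √((obsCount env e S (t + 1) k ω : ℝ) + 1))) *
          ((f (e (t + 1) ω) - a) ^ 1 * obsInd env e S (t + 1) k ω)) ∂P = 0 := by
      obtain ⟨C, hC⟩ := exists_bound_devSum_pow_mul (e := e) (S := S) hf 1 (t + 1)
        fun n => 1 / √((n : ℝ) + 1)
      have := hrun.integral_mul_centred htm hf
        (measurable_devSum_pow_mul hf.measurable 1 (t + 1) k fun n => 1 / √((n : ℝ) + 1)) hC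
      rw [integral_const_mul]
      simp only [pow_one] at this ⊢
      rw [this, mul_zero]
    have hvar : ∫ ω, (1 / √((obsCount env e S (t + 1) k ω : ℝ) + 1)) *
          ((f (e (t + 1) ω) - a) ^ 2 * obsInd env e S (t + 1) k ω) ∂P ≤
        1 / 4 * ∫ ω, (1 / √((obsCount env e S (t + 1) k ω : ℝ) + 1)) *
          obsInd env e S (t + 1) k ω ∂P := by
      obtain ⟨C, hC⟩ := exists_bound_obsCount (env := env) (e := e) (S := S) k (t + 1)
        fun n => 1 / √((n : ℝ) + 1)
      exact hrun.integral_mul_centred_sq_le htm hf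
        (measurable_comp_obsCount (t + 1) k fun n => 1 / √((n : ℝ) + 1)) hC
        fun ω => by positivity
    have hsum : ∫ ω, ∑ i ∈ Finset.range (obsCount env e S (t + 1 + 1) k ω),
          1 / √((i : ℝ) + 1) ∂P =
        ∫ ω, ∑ i ∈ Finset.range (obsCount env e S (t + 1) k ω), 1 / √((i : ℝ) + 1) ∂P +
        ∫ ω, (1 / √((obsCount env e S (t + 1) k ω : ℝ) + 1)) *
          obsInd env e S (t + 1) k ω ∂P := by
      rw [← integral_add
        (hrun.integrable_comp_obsCount k ht1 fun n => ∑ i ∈ Finset.range n, 1 / √((i : ℝ) + 1))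
        (hrun.integrable_mul_obsInd
          (hrun.integrable_comp_obsCount k ht1 fun n => 1 / √((n : ℝ) + 1)) htm k)]
      refine integral_congr_ae (.of_forall fun ω => ?_)
      by_cases ho : k ∈ observed env e S (t + 1) ω
      · simp only [obsCount_succ_of_obs (by omega : 1 ≤ t + 1) ho, obsInd_of_obs ho,
          Finset.sum_range_succ, mul_one]
      · simp only [obsCount_succ_of_not_obs (by omega : 1 ≤ t + 1) ho, obsInd_of_not_obs ho,
          mul_zero, add_zero]
    refine (integral_mono hi4 (hi1.add (hi2.add hi3)) hpt).trans ?_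
    rw [integral_add' hi1 (hi2.add hi3), integral_add' hi2 hi3, hzero, hsum, zero_add, mul_add]
    exact add_le_add ih' hvar

/-- The mean of the accumulated deviations of an arm. -/
lemma integral_sum_dev_le {k : Fin K} {f : E → ℝ} (hf : IsSample env k f) (h : ℝ) {c' : ℝ}
    (hc' : 0 < c') :
    ∫ ω, ∑ t ∈ Finset.Icc 1 T,
        obsInd env e S t k ω * (devSum env e S f t k ω / obsCount env e S t k ω) ∂P ≤
      ∫ ω, (3 / (2 * c') * √(obsCount env e S (T + 1) k ω : ℝ) +
        c' / 12 * (√(obsCount env e S (T + 1) k ω : ℝ) *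
          (harmonicBelow (obsCount env e S (T + 1) k ω) - h) ^ 2)) ∂P := by
  rw [hrun.integral_sum_dev hf h]
  have hi0 := hrun.integrable_devSum_pow_mul hf 1 le_rfl fun n => harmonicBelow n - h
  have hi1 := (hrun.integrable_devSum_pow_mul hf 2 le_rfl fun n => 1 / √(n : ℝ)).const_mul (3 / c')
  have hi2 := (hrun.integrable_comp_obsCount k le_rfl
    fun n => √(n : ℝ) * (harmonicBelow n - h) ^ 2).const_mul (c' / 12)
  have hi3 := (hrun.integrable_comp_obsCount k le_rfl fun n => √(n : ℝ)).const_mul (3 / (2 * c'))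
  simp only [pow_one] at hi0
  refine (integral_mono hi0 (hi1.add hi2) fun ω => ?_).trans ?_
  · simp only [Pi.add_apply]
    rcases Nat.eq_zero_or_pos (obsCount env e S (T + 1) k ω) with h0 | h0
    · rw [devSum_eq_zero_of_obsCount env e S h0, h0]
      simp
    · have h0' : (0 : ℝ) < obsCount env e S (T + 1) k ω := by exact_mod_cast h0
      set s := √(obsCount env e S (T + 1) k ω : ℝ)
      have hs : 0 < s := Real.sqrt_pos.2 h0'
      set M := devSum env e S f (T + 1) k ω
      set H := harmonicBelow (obsCount env e S (T + 1) k ω) - h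
      -- The weights `3 / c'` and `c' / 12` have product `1 / 4`, so `M * H` completes the square.
      have hid : 3 / c' * (M ^ 2 * (1 / s)) + c' / 12 * (s * H ^ 2) - M * H =
          3 / (c' * s) * (M - c' * s / 6 * H) ^ 2 := by
        field_simp
        ring
      have : 0 ≤ 3 / (c' * s) * (M - c' * s / 6 * H) ^ 2 := by positivity
      linarith
  · simp only [Pi.add_apply]
    rw [integral_add hi1 hi2, integral_add hi3 hi2]
    refine add_le_add_left ?_ _
    rw [integral_const_mul, integral_const_mul]
    have h1 := hrun.integral_devSum_sq_le hf le_rfl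
    have h2 : ∫ ω, ∑ i ∈ Finset.range (obsCount env e S (T + 1) k ω), 1 / √((i : ℝ) + 1) ∂P ≤
        ∫ ω, 2 * √(obsCount env e S (T + 1) k ω : ℝ) ∂P :=
      integral_mono (hrun.integrable_comp_obsCount k le_rfl
        fun n => ∑ i ∈ Finset.range n, 1 / √((i : ℝ) + 1))
        ((hrun.integrable_comp_obsCount k le_rfl fun n => √(n : ℝ)).const_mul 2)
        fun ω => sum_one_div_sqrt_succ_le _
    rw [integral_const_mul] at h2
    have h3 : 3 / (2 * c') * ∫ ω, √(obsCount env e S (T + 1) k ω : ℝ) ∂P =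
        3 / c' * (1 / 4 * (2 * ∫ ω, √(obsCount env e S (T + 1) k ω : ℝ) ∂P)) := by
      field_simp
      ring
    rw [h3]
    refine mul_le_mul_of_nonneg_left ?_ (by positivity)
    linarith

/-- The mean of the accumulated optimism of an arm, at the rounds in which it is observed. -/
lemma integral_sum_optimism_le (hK : 1 ≤ K) (hT : 1 ≤ T) {k : Fin K} {f : E → ℝ}
    (hf : IsSample env k f) {n₀ : ℝ} (hn₀ : 0 < n₀) :
    ∫ ω, ∑ t ∈ Finset.Icc 1 T, obsInd env e S t k ω *
        ((if obsCount env e S t k ω = 0 then 1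
          else radiusCoeff K T / √(obsCount env e S t k ω : ℝ)) +
        devSum env e S f t k ω / obsCount env e S t k ω) ∂P ≤
      boundCoeff K T * ((∫ ω, (obsCount env e S (T + 1) k ω : ℝ) ∂P) / √n₀ + √n₀) -
        3 / 5 / boundCoeff K T * √n₀ := by
  set c := radiusCoeff K T
  set c' := boundCoeff K T
  -- This is approximately the harmonic number at count `n₀`, the point of tangency.
  set h := Real.log n₀ + Real.eulerMascheroniConstant
  have hc' : 0 < c' := boundCoeff_pos hK hT
  have hc : 0 < c := by linarith [radiusCoeff_ge hK hT]
  set U : ℕ → ℝ := fun n => ∑ i ∈ Finset.range n, (if i = 0 then 1 else c / √(i : ℝ))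
  have hU : ∀ ω, ∑ t ∈ Finset.Icc 1 T, obsInd env e S t k ω *
        ((if obsCount env e S t k ω = 0 then 1
          else c / √(obsCount env e S t k ω : ℝ)) +
        devSum env e S f t k ω / obsCount env e S t k ω) =
      U (obsCount env e S (T + 1) k ω) + ∑ t ∈ Finset.Icc 1 T,
        obsInd env e S t k ω * (devSum env e S f t k ω / obsCount env e S t k ω) := by
    intro ω
    simp only [U]
    rw [← sum_obsInd_mul (fun i => if i = 0 then 1 else c / √(i : ℝ)), ← Finset.sum_add_distrib]
    exact Finset.sum_congr rfl fun t _ => mul_add _ _ _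
  have hiU := hrun.integrable_comp_obsCount (env := env) k le_rfl U
  have hi1 := hrun.integrable_comp_obsCount k le_rfl fun n => 3 / (2 * c') * √(n : ℝ) +
        c' / 12 * (√(n : ℝ) * (harmonicBelow n - h) ^ 2)
  have hiN := hrun.integrable_comp_obsCount k le_rfl fun n => (n : ℝ)
  rw [integral_congr_ae (.of_forall hU),
    integral_add hiU (integrable_finsetSum _ fun t ht => hrun.integrable_obsInd_mul_dev hf ht)]
  calc _ ≤ _ := add_le_add_right (hrun.integral_sum_dev_le hf h hc') _
    _ = ∫ ω, (U (obsCount env e S (T + 1) k ω) +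
        (3 / (2 * c') * √(obsCount env e S (T + 1) k ω : ℝ) +
        c' / 12 * (√(obsCount env e S (T + 1) k ω : ℝ) *
          (harmonicBelow (obsCount env e S (T + 1) k ω) - h) ^ 2))) ∂P :=
        (integral_add hiU hi1).symm
    _ ≤ ∫ ω, (c' * ((obsCount env e S (T + 1) k ω : ℝ) / √n₀ + √n₀) - 3 / 5 / c' * √n₀) ∂P := by
        refine integral_mono (hiU.add hi1) ((((hiN.div_const _).add (integrable_const _)).const_mul
          c').sub (integrable_const _)) fun ω => ?_
        have := optimism_tangent_bound hc hc' (boundCoeff_gap hK hT) (boundCoeff_le hK hT) hn₀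
          (obsCount env e S (T + 1) k ω) fun h1 =>
            one_le_radiusCoeff hK hT h1 (by simpa using obsCount_le env e S (T + 1) k ω)
        simp only [U]
        linarith
    _ = _ := by
        have hlin : ∀ x : ℝ, c' * (x / √n₀ + √n₀) - 3 / 5 / c' * √n₀ =
            c' / √n₀ * x + (c' * √n₀ - 3 / 5 / c' * √n₀) := fun x => by ring
        simp_rw [hlin]
        rw [integral_add (hiN.const_mul _) (integrable_const _), integral_const_mul]
        simp

end IsRun

end Arm

/-! ## Tail bounds for the deviations -/

section Tail

variable {K : ℕ} {E : Type*} [MeasurableSpace E] (env : Environment K E) {Ω : Type*}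
  (e : ℕ → Ω → E) (S : ℕ → Ω → Finset (Fin K))

/-- The empirical mean of `f` deviates by at least the confidence radius, in the direction given
by the sign of `s`. -/
def tailEvent (δ s : ℝ) (f : E → ℝ) (t : ℕ) (k : Fin K) : Set Ω :=
  {ω | obsCount env e S t k ω ≠ 0 ∧
    obsCount env e S t k ω * radius K δ t (obsCount env e S t k ω) ≤
      s * devSum env e S f t k ω}

variable {env e S}

lemma measurableSet_tailEvent (δ s : ℝ) {f : E → ℝ} (hf : Measurable f) (t : ℕ) (k : Fin K) :
    MeasurableSet[past e S t] (tailEvent env e S δ s f t k) := by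
  have h1 : MeasurableSet[past e S t] {ω | obsCount env e S t k ω ≠ 0} :=
    measurable_obsCount t k (MeasurableSet.of_discrete (s := {n | n ≠ 0}))
  have h2 := measurable_comp_obsCount (env := env) (e := e) (S := S) t k
    fun n => (n : ℝ) * radius K δ t n
  exact h1.inter (measurableSet_le h2 ((measurable_devSum hf t k).const_mul s))

variable [mΩ : MeasurableSpace Ω]
  {m : RewardModel} {N T : ℕ} {ρ α δ : ℝ} {P : Measure Ω} [IsProbabilityMeasure P]
  {Z : ℕ → Ω → Fin K → ℝ} {σ : ℕ → (Fin K → ℝ) → PMF (Finset (Fin K))}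

namespace IsRun

variable (hrun : IsRun env e S m N T ρ α δ P Z σ)
include hrun

lemma integrable_exp_devSum {k : Fin K} {f : E → ℝ} (hf : IsSample env k f) (l : ℝ) {t : ℕ}
    (ht : t ≤ T + 1) :
    Measurable[past e S t] (fun ω => Real.exp (l * devSum env e S f t k ω -
        l ^ 2 / 8 * obsCount env e S t k ω)) ∧
      (∀ ω, |Real.exp (l * devSum env e S f t k ω - l ^ 2 / 8 * obsCount env e S t k ω)| ≤
        Real.exp (|l| * t)) ∧
      Integrable (fun ω => Real.exp (l * devSum env e S f t k ω -
        l ^ 2 / 8 * obsCount env e S t k ω)) P := by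
  have hm : Measurable[past e S t] (fun ω => Real.exp (l * devSum env e S f t k ω -
      l ^ 2 / 8 * obsCount env e S t k ω)) :=
    Real.measurable_exp.comp (((measurable_devSum hf.measurable t k).const_mul l).sub
      (measurable_comp_obsCount t k fun n => l ^ 2 / 8 * n))
  have hb : ∀ ω, |Real.exp (l * devSum env e S f t k ω -
      l ^ 2 / 8 * obsCount env e S t k ω)| ≤ Real.exp (|l| * t) := by
    intro ω
    rw [abs_of_pos (Real.exp_pos _)]
    refine Real.exp_le_exp.2 ?_
    have h1 : l * devSum env e S f t k ω ≤ |l| * t := by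
      refine (le_abs_self _).trans ?_
      rw [abs_mul]
      refine mul_le_mul_of_nonneg_left ((abs_devSum_le e S hf t ω).trans ?_) (abs_nonneg _)
      have := obsCount_le env e S t k ω
      exact_mod_cast this.trans (Nat.sub_le t 1)
    have h2 : 0 ≤ l ^ 2 / 8 * (obsCount env e S t k ω : ℝ) := by positivity
    linarith
  exact ⟨hm, hb, integrable_of_abs_le (hrun.measurable_of_past ht hm) hb⟩

/-- The exponential supermartingale of an arm. -/
lemma integral_exp_devSum_le {k : Fin K} {f : E → ℝ} (hf : IsSample env k f) (l : ℝ) {t : ℕ}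
    (ht : t ≤ T) :
    ∫ ω, Real.exp (l * devSum env e S f (t + 1) k ω -
      l ^ 2 / 8 * obsCount env e S (t + 1) k ω) ∂P ≤ 1 := by
  induction t with
  | zero => simp [devSum_one, obsCount_one]
  | succ t ih =>
    have htm : t + 1 ∈ Finset.Icc 1 T := Finset.mem_Icc.2 ⟨by omega, ht⟩
    obtain ⟨hm, hb, -⟩ := hrun.integrable_exp_devSum hf l (by omega : t + 1 ≤ T + 1)
    refine le_trans (le_of_eq ?_) ((hrun.integral_mul_exp_le htm hf l hm hb
      fun ω => (Real.exp_pos _).le).trans (ih (by omega)))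
    refine integral_congr_ae (.of_forall fun ω => ?_)
    simp only
    rw [← Real.exp_add, devSum_succ env e S f (by omega : 1 ≤ t + 1)]
    congr 1
    by_cases ho : k ∈ observed env e S (t + 1) ω
    · rw [obsCount_succ_of_obs (by omega) ho, obsInd_of_obs ho]
      push_cast
      ring
    · rw [obsCount_succ_of_not_obs (by omega) ho, obsInd_of_not_obs ho]
      ring

/-- Chernoff's method at a fixed count. With exponent parameter `4 * r * s`, the exponent of the
supermartingale is at least `4 n r ^ 2 - 2 n r ^ 2` on the event. -/
lemma measureReal_devSum_ge_le {k : Fin K} {f : E → ℝ} (hf : IsSample env k f) {t : ℕ}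
    (ht : t ∈ Finset.Icc 1 T) (n : ℕ) {s r : ℝ} (hs : s ^ 2 = 1) (hr : 0 ≤ r) :
    P.real {ω | obsCount env e S t k ω = n ∧ n * r ≤ s * devSum env e S f t k ω} ≤
      Real.exp (-(2 * n * r ^ 2)) := by
  rw [Finset.mem_Icc] at ht
  obtain ⟨t, rfl⟩ := Nat.exists_eq_add_of_le' ht.1
  obtain ⟨-, -, hi⟩ := hrun.integrable_exp_devSum hf (4 * r * s) (by omega : t + 1 ≤ T + 1)
  have h1 := hrun.integral_exp_devSum_le hf (4 * r * s) (by omega : t ≤ T)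
  have h2 := mul_meas_ge_le_integral_of_nonneg
    (.of_forall fun ω => (Real.exp_pos _).le) hi (Real.exp (2 * n * r ^ 2))
  have h3 : {ω | obsCount env e S (t + 1) k ω = n ∧
      n * r ≤ s * devSum env e S f (t + 1) k ω} ⊆ {ω | Real.exp (2 * n * r ^ 2) ≤
      Real.exp (4 * r * s * devSum env e S f (t + 1) k ω -
        (4 * r * s) ^ 2 / 8 * obsCount env e S (t + 1) k ω)} := by
    rintro ω ⟨hn, hω⟩
    refine Real.exp_le_exp.2 ?_
    rw [hn]
    have e1 : (4 * r * s) ^ 2 / 8 = 2 * r ^ 2 := by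
      rw [mul_pow, hs]; ring
    rw [e1]
    nlinarith [mul_le_mul_of_nonneg_left hω hr]
  have h4 := measureReal_mono (μ := P) h3
  rw [Real.exp_neg, ← one_div, le_div_iff₀ (Real.exp_pos _), mul_comm]
  exact (mul_le_mul_of_nonneg_left h4 (Real.exp_pos _).le).trans (h2.trans h1)

/-- The count is random, so the union is taken over its `t - 1` possible positive values. The radius
is such that each value contributes the same amount. -/
lemma measureReal_tailEvent_le (hK : 1 ≤ K) (hT : 1 ≤ T) {k : Fin K} {f : E → ℝ}
    (hf : IsSample env k f) {t : ℕ} (ht : t ∈ Finset.Icc 1 T) {s : ℝ} (hs : s ^ 2 = 1) :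
    P.real (tailEvent env e S (1 / (T : ℝ)) s f t k) ≤
      3 / (2 * Real.pi ^ 2 * K * T) * (((t : ℝ) - 1) / (t : ℝ) ^ 3) := by
  have ht1 : 1 ≤ t := (Finset.mem_Icc.1 ht).1
  have hsub : tailEvent env e S (1 / (T : ℝ)) s f t k ⊆ ⋃ n ∈ Finset.Ico 1 t,
      {ω | obsCount env e S t k ω = n ∧
        n * radius K (1 / (T : ℝ)) t n ≤ s * devSum env e S f t k ω} := by
    rintro ω ⟨h0, hω⟩
    simp only [Set.mem_iUnion]
    refine ⟨obsCount env e S t k ω, ?_, rfl, hω⟩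
    have := obsCount_le env e S t k ω
    rw [Finset.mem_Ico]
    omega
  refine (measureReal_mono hsub (measure_ne_top _ _)).trans ((measureReal_biUnion_finset_le _ _).trans ?_)
  have hle : ∀ n ∈ Finset.Ico 1 t, P.real {ω | obsCount env e S t k ω = n ∧
      n * radius K (1 / (T : ℝ)) t n ≤ s * devSum env e S f t k ω} ≤
      3 / (2 * Real.pi ^ 2 * K * T) / (t : ℝ) ^ 3 := by
    intro n hn
    refine (hrun.measureReal_devSum_ge_le hf ht n hs (Real.sqrt_nonneg _)).trans (le_of_eq ?_)
    exact exp_neg_radius hK hT ht1 (Finset.mem_Ico.1 hn).1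
  refine (Finset.sum_le_sum hle).trans (le_of_eq ?_)
  rw [Finset.sum_const, Nat.card_Ico, nsmul_eq_mul, Nat.cast_sub ht1, Nat.cast_one]
  ring

/-- The mean number of rounds in which an arm deviates is small. -/
lemma sum_measureReal_tailEvent_le (hK : 1 ≤ K) (hT : 1 ≤ T) {k : Fin K} {f : E → ℝ}
    (hf : IsSample env k f) {s : ℝ} (hs : s ^ 2 = 1) :
    ∑ t ∈ Finset.Icc 1 T, P.real (tailEvent env e S (1 / (T : ℝ)) s f t k) ≤
      1 / (4 * (K * T)) := by
  refine (Finset.sum_le_sum fun t ht => hrun.measureReal_tailEvent_le hK hT hf ht hs).trans ?_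
  rw [← Finset.mul_sum]
  have hK' : (0 : ℝ) < K := by exact_mod_cast hK
  have hT' : (0 : ℝ) < T := by exact_mod_cast hT
  calc _ ≤ 3 / (2 * Real.pi ^ 2 * K * T) * 1 :=
        mul_le_mul_of_nonneg_left (sum_one_div_sq_le T) (by positivity)
    -- Only `2 π ^ 2 / 3 ≥ 4` is needed.
    _ ≤ 1 / (4 * (K * T)) := by
        rw [mul_one, div_le_div_iff₀ (by positivity) (by positivity)]
        have h1 := two_pi_sq_div_three_bounds.1
        have h2 : 0 < (K : ℝ) * T := by positivity
        nlinarith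

end IsRun

end Tail

/-! ## Rewards -/

section Reward

variable {K N : ℕ} {m : RewardModel}

lemma IsAction.card_le {A : Finset (Fin K)} (h : IsAction m N A) : A.card ≤ N := by
  cases m with
  | AWC => exact h
  | SUC => exact le_of_eq h
  | AIC => exact le_of_eq h

lemma exists_isAction (m : RewardModel) (hNK : N ≤ K) :
    ∃ A : Finset (Fin K), IsAction m N A ∧ A.card = N := by
  obtain ⟨A, -, hA⟩ := Finset.exists_subset_card_eq
    (s := (Finset.univ : Finset (Fin K))) (n := N) (by simpa using hNK)
  refine ⟨A, ?_, hA⟩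
  cases m with
  | AWC => exact hA.le
  | SUC => exact hA
  | AIC => exact hA

lemma reward_nonneg (A : Finset (Fin K)) {μ : Fin K → ℝ} (hμ : ∀ k, 0 ≤ μ k ∧ μ k ≤ 1) :
    0 ≤ reward m A μ := by
  cases m with
  | AWC =>
    have : ∏ k ∈ A, (1 - μ k) ≤ 1 := Finset.prod_le_one
      (fun k _ => by linarith [(hμ k).2]) fun k _ => by linarith [(hμ k).1]
    simp only [reward]
    linarith
  | SUC => exact Finset.sum_nonneg fun k _ => (hμ k).1
  | AIC => exact Finset.prod_nonneg fun k _ => (hμ k).1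

lemma reward_le (A : Finset (Fin K)) {μ : Fin K → ℝ} (hμ : ∀ k, 0 ≤ μ k ∧ μ k ≤ 1) :
    reward m A μ ≤ K + 1 := by
  have hK : (0 : ℝ) ≤ K := K.cast_nonneg
  cases m with
  | AWC =>
    have : 0 ≤ ∏ k ∈ A, (1 - μ k) := Finset.prod_nonneg fun k _ => by linarith [(hμ k).2]
    simp only [reward]
    linarith
  | SUC =>
    have h1 : ∑ k ∈ A, μ k ≤ ∑ _k ∈ A, (1 : ℝ) := Finset.sum_le_sum fun k _ => (hμ k).2
    have h2 : (A.card : ℝ) ≤ K := by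
      exact_mod_cast (Finset.card_le_univ A).trans (by simp)
    simp only [Finset.sum_const, nsmul_eq_mul, mul_one] at h1
    simp only [reward]
    linarith
  | AIC =>
    have : ∏ k ∈ A, μ k ≤ 1 := Finset.prod_le_one (fun k _ => (hμ k).1) fun k _ => (hμ k).2
    simp only [reward]
    linarith

lemma reward_mono (A : Finset (Fin K)) {μ ν : Fin K → ℝ} (hμ : ∀ k, 0 ≤ μ k)
    (hν : ∀ k, ν k ≤ 1) (h : ∀ k, μ k ≤ ν k) : reward m A μ ≤ reward m A ν := by
  cases m with
  | AWC =>
    have : ∏ k ∈ A, (1 - ν k) ≤ ∏ k ∈ A, (1 - μ k) := Finset.prod_le_prod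
      (fun k _ => by linarith [hν k]) fun k _ => by linarith [h k]
    simp only [reward]
    linarith
  | SUC => exact Finset.sum_le_sum fun k _ => h k
  | AIC => exact Finset.prod_le_prod (fun k _ => hμ k) fun k _ => h k

lemma relaxedReward_ind (A : Finset (Fin K)) (μ : Fin K → ℝ) :
    relaxedReward m (ind A) μ = reward m A μ := by
  cases m with
  | AWC => exact congrArg (fun x => 1 - x) (failProd_ind μ A)
  | SUC => exact (sum_eq_sum_ite A μ).symm
  | AIC =>
    simp only [relaxedReward, reward, ind]
    have : ∀ k, μ k ^ (if k ∈ A then (1 : ℝ) else 0) = if k ∈ A then μ k else 1 := by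
      intro k
      split_ifs <;> simp
    simp [this]

lemma sum_ind (A : Finset (Fin K)) : ∑ k, ind A k = A.card := by
  simp [ind]

lemma ind_mem_polytope {A : Finset (Fin K)} (h : IsAction m N A) : ind A ∈ polytope m N := by
  refine ⟨fun k => ⟨ind_nonneg A k, ind_le_one A k⟩, ?_⟩
  cases m with
  | AWC => simp only [sum_ind]; exact_mod_cast h
  | SUC => simp only [sum_ind]; exact_mod_cast h
  | AIC => simp only [sum_ind]; exact_mod_cast h

/-- Compare the constant vectors `1` and `0` on an action with `N ≥ 1` elements. -/
lemma IsLipschitzConst.nonneg {L : ℝ} (hL : IsLipschitzConst K m N L) (hN : 1 ≤ N)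
    (hNK : N ≤ K) : 0 ≤ L := by
  obtain ⟨A, hA, hcard⟩ := exists_isAction m hNK
  have h := hL A hA (fun _ => 1) (fun _ => 0) (fun k => by norm_num) (fun k => by norm_num)
  have h2 := (abs_nonneg _).trans h
  simp only [sub_zero, abs_one, Finset.sum_const, nsmul_eq_mul, mul_one, hcard] at h2
  have hN' : (0 : ℝ) < N := by exact_mod_cast hN
  exact nonneg_of_mul_nonneg_left h2 hN'

end Reward

/-! ## Confidence bounds -/

section Confidence

variable {K : ℕ} {E : Type*} [MeasurableSpace E] {env : Environment K E} {Ω : Type*}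
  {e : ℕ → Ω → E} {S : ℕ → Ω → Finset (Fin K)}

lemma mean_mem (k : Fin K) : 0 ≤ env.mean k ∧ env.mean k ≤ 1 :=
  (isSample_outcome env k).integral_mem

lemma sum_div_obsCount (f : E → ℝ) {t : ℕ} {k : Fin K} {ω : Ω}
    (h : obsCount env e S t k ω ≠ 0) :
    (∑ τ ∈ obsRounds env e S t k ω, f (e τ ω)) / obsCount env e S t k ω =
      ∫ x, f x ∂env.law + devSum env e S f t k ω / obsCount env e S t k ω := by
  have h' : (obsCount env e S t k ω : ℝ) ≠ 0 := by exact_mod_cast h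
  rw [devSum, Finset.sum_sub_distrib, Finset.sum_const, nsmul_eq_mul]
  change _ = _ + (_ - (obsCount env e S t k ω : ℝ) * _) / _
  field_simp
  ring

lemma radius_nonneg (δ : ℝ) (t n : ℕ) : 0 ≤ radius K δ t n := Real.sqrt_nonneg _

lemma ucb_mem (δ : ℝ) (t : ℕ) (ω : Ω) (k : Fin K) :
    0 ≤ ucb env e S δ t ω k ∧ ucb env e S δ t ω k ≤ 1 := by
  unfold ucb
  split_ifs
  · norm_num
  · refine ⟨le_min (add_nonneg (div_nonneg (Finset.sum_nonneg fun τ _ =>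
      (env.outcome_mem k _).1) (Nat.cast_nonneg _)) (radius_nonneg _ _ _)) zero_le_one,
      min_le_right _ _⟩

lemma measurable_ucb (δ : ℝ) (t : ℕ) (k : Fin K) :
    Measurable[past e S t] fun ω => ucb env e S δ t ω k := by
  have heq : (fun ω => ucb env e S δ t ω k) = fun ω =>
      if obsCount env e S t k ω = 0 then 1 else
        min (env.mean k + devSum env e S (env.outcome k) t k ω / obsCount env e S t k ω +
          radius K δ t (obsCount env e S t k ω)) 1 := by
    funext ω
    unfold ucb
    split_ifs with h
    · rfl
    · rw [empMean, sum_div_obsCount _ h]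
      rfl
  rw [heq]
  have h0 : MeasurableSet[past e S t] {ω | obsCount env e S t k ω = 0} :=
    measurable_obsCount t k (MeasurableSet.of_discrete (s := {n | n = 0}))
  refine Measurable.ite h0 measurable_const (Measurable.min (Measurable.add ?_ ?_)
    measurable_const)
  · exact ((measurable_devSum (env.measurable_outcome k) t k).div
      (measurable_comp_obsCount t k fun n => (n : ℝ))).const_add _
  · exact measurable_comp_obsCount t k fun n => radius K δ t n

lemma mean_le_ucb {δ : ℝ} {t : ℕ} {ω : Ω} {k : Fin K}
    (h : ω ∉ tailEvent env e S δ (-1) (env.outcome k) t k) :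
    env.mean k ≤ ucb env e S δ t ω k := by
  unfold ucb
  split_ifs with h0
  · exact (mean_mem k).2
  · refine le_min ?_ (mean_mem k).2
    have hpos : (0 : ℝ) < obsCount env e S t k ω := by
      exact_mod_cast Nat.pos_of_ne_zero h0
    have h1 : -1 * devSum env e S (env.outcome k) t k ω <
        obsCount env e S t k ω * radius K δ t (obsCount env e S t k ω) := by
      by_contra hcon
      exact h ⟨h0, not_lt.1 hcon⟩
    rw [empMean, sum_div_obsCount _ h0]
    change _ ≤ env.mean k + _ + _
    have h2 : -radius K δ t (obsCount env e S t k ω) ≤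
        devSum env e S (env.outcome k) t k ω / obsCount env e S t k ω := by
      rw [le_div_iff₀ hpos]
      linarith
    linarith

lemma lcb_le_meanCost {δ : ℝ} {t : ℕ} {ω : Ω} {k : Fin K}
    (h : ω ∉ tailEvent env e S δ 1 (env.cost k) t k) :
    lcb env e S δ t ω k ≤ env.meanCost k := by
  have hc := (isSample_cost env k).integral_mem.1
  unfold lcb
  split_ifs with h0
  · exact hc
  · refine max_le ?_ hc
    have hpos : (0 : ℝ) < obsCount env e S t k ω := by
      exact_mod_cast Nat.pos_of_ne_zero h0
    have h1 : 1 * devSum env e S (env.cost k) t k ω <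
        obsCount env e S t k ω * radius K δ t (obsCount env e S t k ω) := by
      by_contra hcon
      exact h ⟨h0, not_lt.1 hcon⟩
    rw [empCost, sum_div_obsCount _ h0]
    change env.meanCost k + _ - _ ≤ _
    have h2 : devSum env e S (env.cost k) t k ω / obsCount env e S t k ω ≤
        radius K δ t (obsCount env e S t k ω) := by
      rw [div_le_iff₀ hpos]
      linarith
    linarith

variable (env e S) in
/-- The optimism of an arm: a bound on the excess of the optimistic estimate over the mean. -/
def optimism (T t : ℕ) (k : Fin K) (ω : Ω) : ℝ :=
  (if obsCount env e S t k ω = 0 then 1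
    else radiusCoeff K T / √(obsCount env e S t k ω : ℝ)) +
  devSum env e S (env.outcome k) t k ω / obsCount env e S t k ω

/-- The deviation enters exactly instead of being bounded by a second radius. This holds without any
good event. -/
lemma ucb_sub_mean_le (hK : 1 ≤ K) {T t : ℕ} (ht : t ∈ Finset.Icc 1 T) (ω : Ω) (k : Fin K) :
    ucb env e S (1 / (T : ℝ)) t ω k - env.mean k ≤ optimism env e S T t k ω := by
  rw [Finset.mem_Icc] at ht
  unfold ucb optimism
  split_ifs with h0
  · rw [h0]
    simpa using (mean_mem k).1
  · have h1 := radius_le hK ht.1 ht.2 (obsCount env e S t k ω)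
    refine (sub_le_sub_right (min_le_left _ _) _).trans ?_
    rw [empMean, sum_div_obsCount _ h0]
    change env.mean k + _ + _ - env.mean k ≤ _
    linarith

lemma neg_one_le_optimism (T t : ℕ) (k : Fin K) (ω : Ω) : -1 ≤ optimism env e S T t k ω := by
  have h1 := abs_devSum_le e S (isSample_outcome env k) t ω
  have h2 : -1 ≤ devSum env e S (env.outcome k) t k ω / obsCount env e S t k ω := by
    rcases Nat.eq_zero_or_pos (obsCount env e S t k ω) with h0 | h0
    · rw [h0]; simp
    · have hpos : (0 : ℝ) < obsCount env e S t k ω := by exact_mod_cast h0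
      rw [le_div_iff₀ hpos]
      linarith [neg_abs_le (devSum env e S (env.outcome k) t k ω)]
  unfold optimism
  have h3 : 0 ≤ (if obsCount env e S t k ω = 0 then 1
    else radiusCoeff K T / √(obsCount env e S t k ω : ℝ)) := by
    split_ifs
    · exact zero_le_one
    · exact div_nonneg radiusCoeff_nonneg (Real.sqrt_nonneg _)
  linarith

lemma optimism_nonneg (hK : 1 ≤ K) {T t : ℕ} (ht : t ∈ Finset.Icc 1 T) {k : Fin K} {ω : Ω}
    (h : ω ∉ tailEvent env e S (1 / (T : ℝ)) (-1) (env.outcome k) t k) :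
    0 ≤ optimism env e S T t k ω :=
  (sub_nonneg.2 (mean_le_ucb h)).trans (ucb_sub_mean_le hK ht ω k)

variable (env e S) in
/-- Some confidence interval fails in round `t`. -/
def badEvent (δ : ℝ) (t : ℕ) : Set Ω :=
  ⋃ k, (tailEvent env e S δ (-1) (env.outcome k) t k ∪ tailEvent env e S δ 1 (env.cost k) t k)

lemma measurableSet_badEvent (δ : ℝ) (t : ℕ) :
    MeasurableSet[past e S t] (badEvent env e S δ t) :=
  MeasurableSet.iUnion fun k => (measurableSet_tailEvent δ (-1) (env.measurable_outcome k) t k).union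
    (measurableSet_tailEvent δ 1 (env.measurable_cost k) t k)

lemma notMem_tailEvent_of_notMem_badEvent {δ : ℝ} {t : ℕ} {ω : Ω}
    (h : ω ∉ badEvent env e S δ t) (k : Fin K) :
    ω ∉ tailEvent env e S δ (-1) (env.outcome k) t k ∧
      ω ∉ tailEvent env e S δ 1 (env.cost k) t k := by
  simp only [badEvent, Set.mem_iUnion, Set.mem_union, not_exists, not_or] at h
  exact h k

/-- Outside the bad event, the relaxed solution is optimistic. -/
lemma le_relaxedReward_of_notMem_badEvent {m : RewardModel} {N : ℕ} {ρ α δ : ℝ} (hα : 0 ≤ α)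
    {Sstar : Finset (Fin K)} (hS : env.IsOptimal m N ρ Sstar) {t : ℕ} {ω : Ω}
    (h : ω ∉ badEvent env e S δ t) {z : Fin K → ℝ}
    (hz : IsApproxSolution m N ρ α (ucb env e S δ t ω) (lcb env e S δ t ω) z) :
    α * reward m Sstar env.mean ≤ relaxedReward m z (ucb env e S δ t ω) := by
  -- Underestimated costs keep the optimal action within the budget of the relaxed problem.
  have hmem : ind Sstar ∈ relaxedFeasible m N ρ (lcb env e S δ t ω) := by
    refine ⟨ind_mem_polytope hS.1.1, le_trans ?_ hS.1.2⟩
    have : ∑ k, lcb env e S δ t ω k * ind Sstar k = ∑ k ∈ Sstar, lcb env e S δ t ω k :=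
      (sum_eq_sum_ite _ _).symm
    rw [this]
    exact Finset.sum_le_sum fun k _ =>
      lcb_le_meanCost (notMem_tailEvent_of_notMem_badEvent h k).2
  have h1 := (hz.2 ⟨_, hmem⟩).2 _ hmem
  rw [relaxedReward_ind] at h1
  refine le_trans (mul_le_mul_of_nonneg_left ?_ hα) h1
  exact reward_mono _ (fun k => (mean_mem k).1) (fun k => (ucb_mem δ t ω k).2)
    fun k => mean_le_ucb (notMem_tailEvent_of_notMem_badEvent h k).1

end Confidence

/-! ## The regret of a round -/

section Regret

lemma measurable_reward {K : ℕ} {m : RewardModel} {Ω : Type*} {n : MeasurableSpace Ω} {ν : Ω → Fin K → ℝ}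
    (hν : ∀ k, Measurable[n] fun ω => ν ω k) (A : Finset (Fin K)) :
    Measurable[n] fun ω => reward m A (ν ω) := by
  cases m with
  | AWC =>
    exact (Finset.measurable_fun_prod A fun k _ => (hν k).const_sub 1).const_sub 1
  | SUC => exact Finset.measurable_fun_sum A fun k _ => hν k
  | AIC => exact Finset.measurable_fun_prod A fun k _ => hν k

variable {K : ℕ} {E : Type*} [MeasurableSpace E] {env : Environment K E} {Ω : Type*}
  {e : ℕ → Ω → E} {S : ℕ → Ω → Finset (Fin K)} [mΩ : MeasurableSpace Ω]
  {m : RewardModel} {N T : ℕ} {ρ α δ : ℝ} {P : Measure Ω}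
  {Z : ℕ → Ω → Fin K → ℝ} {σ : ℕ → (Fin K → ℝ) → PMF (Finset (Fin K))}

namespace IsRun

variable (hrun : IsRun env e S m N T ρ α δ P Z σ)
include hrun

lemma measurableSet_action {t : ℕ} (ht : t ∈ Finset.Icc 1 T) (A : Finset (Fin K)) :
    MeasurableSet {ω | S t ω = A} :=
  hrun.measurable_action t ht (measurableSet_singleton A)

variable [IsProbabilityMeasure P]

/-- Given the past, the action follows the rounding distribution. -/
lemma integral_mul_indicator_action {t : ℕ} (ht : t ∈ Finset.Icc 1 T) {F : Ω → ℝ}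
    (hF : Measurable[past e S t] F) {C : ℝ} (hC : ∀ ω, |F ω| ≤ C) (A : Finset (Fin K)) :
    Integrable (fun ω => F ω * (σ t (Z t ω) A).toReal) P ∧
      ∫ ω, F ω * (σ t (Z t ω) A).toReal ∂P =
        ∫ ω, F ω * {ω | S t ω = A}.indicator (fun _ => (1 : ℝ)) ω ∂P := by
  have ht1 : t ≤ T + 1 := by rw [Finset.mem_Icc] at ht; omega
  have hle := hrun.past_le ht1
  have hind : Integrable ({ω | S t ω = A}.indicator fun _ => (1 : ℝ)) P :=
    (integrable_const 1).indicator (hrun.measurableSet_action ht A)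
  -- Measurability and integrability of the left side come from its agreement with a conditional
  -- expectation; `Z` itself is not known to be measurable.
  have hae : (fun ω => F ω * (σ t (Z t ω) A).toReal) =ᵐ[P]
      P[F * {ω | S t ω = A}.indicator (fun _ => (1 : ℝ)) | past e S t] := by
    have h1 := condExp_stronglyMeasurable_mul_of_bound hle hF.stronglyMeasurable hind C
      (.of_forall hC)
    filter_upwards [h1, hrun.action_law t ht A] with ω h2 h3
    rw [h2, Pi.mul_apply, h3]
  refine ⟨integrable_condExp.congr hae.symm, ?_⟩
  rw [integral_congr_ae hae, integral_condExp hle]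
  rfl

/-- The rounding never returns a set that is not an action, so each of the finitely many such sets
is selected with probability zero. -/
lemma ae_isAction {t : ℕ} (ht : t ∈ Finset.Icc 1 T) : ∀ᵐ ω ∂P, IsAction m N (S t ω) := by
  have h : ∀ A : Finset (Fin K), ¬ IsAction m N A → ∀ᵐ ω ∂P, S t ω ≠ A := by
    intro A hA
    obtain ⟨-, h1⟩ := hrun.integral_mul_indicator_action ht (F := fun _ => 1) measurable_const
      (C := 1) (fun _ => by simp) A
    have h0 : ∀ ω, σ t (Z t ω) A = 0 := by
      intro ω
      by_contra hne
      exact hA (isAction_of_mem_support (hrun.rounding t ht) (hrun.relaxed t ht ω).1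
        ((PMF.mem_support_iff _ _).2 hne))
    simp only [h0, ENNReal.toReal_zero, mul_zero, one_mul, integral_zero] at h1
    rw [integral_indicator_const _ (hrun.measurableSet_action ht A), smul_eq_mul, mul_one] at h1
    have h2 : P {ω | S t ω = A} = 0 := (measureReal_eq_zero_iff (measure_ne_top _ _)).1 h1.symm
    rw [ae_iff]
    simpa using h2
  have h' : ∀ᵐ ω ∂P, ∀ A : Finset (Fin K), ¬ IsAction m N A → S t ω ≠ A := by
    rw [ae_all_iff]
    intro A
    by_cases hA : IsAction m N A
    · exact .of_forall fun _ hn => absurd hA hn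
    · filter_upwards [h A hA] with ω hω _ using hω
  filter_upwards [h'] with ω hω
  by_contra hcon
  exact hω _ hcon rfl

/-- Every arm of the selected action is observed with probability at least `o`. -/
lemma mul_integral_action_le {o : ℝ} (ho : ∀ t ∈ Finset.Icc 1 T, ∀ A : Finset (Fin K),
    IsAction m N A → o ≤ env.obsProb t A) {t : ℕ} (ht : t ∈ Finset.Icc 1 T) (k : Fin K)
    {F : Ω → ℝ} (hF : Measurable[past e S t] F) {C : ℝ} (hC : ∀ ω, |F ω| ≤ C)
    (h0 : ∀ ω, 0 ≤ F ω) :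
    o * ∫ ω, F ω * ind (S t ω) k ∂P ≤ ∫ ω, F ω * obsInd env e S t k ω ∂P := by
  have ht1 : t ≤ T + 1 := by rw [Finset.mem_Icc] at ht; omega
  have hFm := hrun.measurable_of_past ht1 hF
  have hFi := integrable_of_abs_le (P := P) hFm hC
  have hb : ∀ A x, |fbInd env t k A x| ≤ 1 := fun A x => by
    rw [abs_of_nonneg (fbInd_nonneg env t k A x)]; exact fbInd_le_one env t k A x
  have h1 := hrun.integral_mul_apply ht hF hC (measurable_fbInd env t k) hb
  have hfi : ∀ A, Integrable (fbInd env t k A) env.law := fun A =>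
    Integrable.of_bound (measurable_fbInd env t k A).aestronglyMeasurable 1 (.of_forall (hb A))
  have hg1 : ∀ A, |∫ x, fbInd env t k A x ∂env.law| ≤ 1 := by
    intro A
    rw [abs_of_nonneg (integral_nonneg (fbInd_nonneg env t k A))]
    simpa using integral_mono (hfi A) (integrable_const 1) (fbInd_le_one env t k A)
  simp only [obsInd]
  rw [h1, ← integral_const_mul]
  refine integral_mono_ae ?_ ?_ ?_
  · refine (hFi.mul_bdd (c := 1) ((measurable_ind k).comp
      (hrun.measurable_action t ht)).aestronglyMeasurable (.of_forall fun ω => ?_)).const_mul o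
    simp only [Function.comp]
    rw [Real.norm_of_nonneg (ind_nonneg _ _)]
    exact ind_le_one _ _
  · refine hFi.mul_bdd (c := 1) ((measurable_of_countable fun A : Finset (Fin K) =>
      ∫ x, fbInd env t k A x ∂env.law).comp
      (hrun.measurable_action t ht)).aestronglyMeasurable (.of_forall fun ω => hg1 _)
  · filter_upwards [hrun.ae_isAction ht] with ω hω
    -- If the whole action is observed, so is each of its elements.
    have hkey : o * ind (S t ω) k ≤ ∫ x, fbInd env t k (S t ω) x ∂env.law := by
      by_cases hk : k ∈ S t ω
      · rw [ind_of_mem hk, mul_one]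
        refine (ho t ht _ hω).trans ?_
        have hm : MeasurableSet {x | env.feedback t (S t ω) x = S t ω} :=
          env.measurable_feedback t (S t ω) (measurableSet_singleton _)
        rw [Environment.obsProb, ← integral_indicator_one hm]
        refine integral_mono ((integrable_const 1).indicator hm) (hfi _) fun x => ?_
        by_cases hx : env.feedback t (S t ω) x = S t ω
        · rw [Set.indicator_of_mem (by exact hx)]
          simp [fbInd, hx, ind_of_mem hk]
        · rw [Set.indicator_of_notMem (by exact hx)]
          exact fbInd_nonneg _ _ _ _ _
      · rw [ind_of_notMem hk, mul_zero]
        exact integral_nonneg (fbInd_nonneg env t k _)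
    calc o * (F ω * ind (S t ω) k) = F ω * (o * ind (S t ω) k) := by ring
      _ ≤ _ := mul_le_mul_of_nonneg_left hkey (h0 ω)

end IsRun

end Regret

/-! ### From the regret of a round to the total over rounds and arms -/

section RegretBound

variable {K : ℕ} {E : Type*} [MeasurableSpace E] {env : Environment K E} {Ω : Type*}
  {e : ℕ → Ω → E} {S : ℕ → Ω → Finset (Fin K)} {T : ℕ} {δ : ℝ}

/-- Outside the bad event, the excess of the optimistic estimate over the mean. -/
def excess (env : Environment K E) (e : ℕ → Ω → E) (S : ℕ → Ω → Finset (Fin K)) (δ : ℝ) (t : ℕ)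
    (k : Fin K) (ω : Ω) : ℝ :=
  (badEvent env e S δ t)ᶜ.indicator (fun ω => ucb env e S δ t ω k - env.mean k) ω

lemma excess_nonneg (t : ℕ) (k : Fin K) (ω : Ω) : 0 ≤ excess env e S δ t k ω :=
  Set.indicator_nonneg (fun _ h =>
    sub_nonneg.2 (mean_le_ucb (notMem_tailEvent_of_notMem_badEvent h k).1)) ω

lemma abs_excess_le (t : ℕ) (k : Fin K) (ω : Ω) : |excess env e S δ t k ω| ≤ 1 := by
  rw [abs_of_nonneg (excess_nonneg t k ω)]
  refine Set.indicator_le' (fun ω _ => ?_) (fun _ _ => zero_le_one) ω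
  linarith [(ucb_mem (env := env) (e := e) (S := S) δ t ω k).2, (mean_mem (env := env) k).1]

lemma measurable_excess (t : ℕ) (k : Fin K) :
    Measurable[past e S t] (excess env e S δ t k) :=
  ((measurable_ucb δ t k).sub_const _).indicator (measurableSet_badEvent δ t).compl

/-- The excess is at most the optimism, except on a tail event. -/
lemma excess_mul_obsInd_le (hK : 1 ≤ K) {t : ℕ} (ht : t ∈ Finset.Icc 1 T) (k : Fin K) (ω : Ω) :
    excess env e S (1 / (T : ℝ)) t k ω * obsInd env e S t k ω ≤
      obsInd env e S t k ω * optimism env e S T t k ω +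
        (tailEvent env e S (1 / (T : ℝ)) (-1) (env.outcome k) t k).indicator (fun _ => 1) ω := by
  have hb0 := obsInd_nonneg env e S t k ω
  have hb1 := obsInd_le_one env e S t k ω
  by_cases h : ω ∈ tailEvent env e S (1 / (T : ℝ)) (-1) (env.outcome k) t k
  -- Here the excess is zero while the optimism may be as low as `-1`; the added indicator
  -- compensates. In this way the optimism is summed over all rounds, untruncated, as the martingale
  -- argument requires.
  · have hbad : ω ∈ badEvent env e S (1 / (T : ℝ)) t :=
      Set.mem_iUnion.2 ⟨k, Or.inl h⟩
    rw [excess, Set.indicator_of_notMem (by simpa using hbad), Set.indicator_of_mem h]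
    have := mul_le_mul_of_nonneg_left (neg_one_le_optimism (env := env) (e := e) (S := S) T t k ω)
      hb0
    linarith
  · rw [Set.indicator_of_notMem h, add_zero, mul_comm]
    refine mul_le_mul_of_nonneg_left ?_ hb0
    -- A round that is bad for another reason also has zero excess, and the optimism of this arm is
    -- still nonnegative.
    by_cases hbad : ω ∈ badEvent env e S (1 / (T : ℝ)) t
    · rw [excess, Set.indicator_of_notMem (by simpa using hbad)]
      exact optimism_nonneg hK ht h
    · rw [excess, Set.indicator_of_mem (by simpa using hbad)]
      exact ucb_sub_mean_le hK ht ω k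

variable [mΩ : MeasurableSpace Ω]
  {m : RewardModel} {N : ℕ} {ρ α : ℝ} {P : Measure Ω}
  {Z : ℕ → Ω → Fin K → ℝ} {σ : ℕ → (Fin K → ℝ) → PMF (Finset (Fin K))}

namespace IsRun

/-! ### Bounds for an arbitrary confidence parameter -/

section General

variable (hrun : IsRun env e S m N T ρ α δ P Z σ)
include hrun

lemma measurable_reward_action {t : ℕ} (ht : t ∈ Finset.Icc 1 T) :
    Measurable fun ω => reward m (S t ω) (ucb env e S δ t ω) := by
  have ht1 : t ≤ T + 1 := by rw [Finset.mem_Icc] at ht; omega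
  have h1 : Measurable fun ω => ucb env e S δ t ω :=
    measurable_pi_lambda _ fun k => hrun.measurable_of_past ht1 (measurable_ucb δ t k)
  exact measurable_apply_action (g := fun A ν => reward m A ν) h1 (hrun.measurable_action t ht)
    fun A => measurable_reward (ν := fun ν : Fin K → ℝ => ν) (fun k => measurable_pi_apply k) A

variable [IsProbabilityMeasure P]

lemma integrable_comp_action {t : ℕ} (ht : t ∈ Finset.Icc 1 T) (g : Finset (Fin K) → ℝ) :
    Integrable (fun ω => g (S t ω)) P := by
  refine integrable_of_abs_le ((measurable_of_countable g).comp (hrun.measurable_action t ht))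
    (C := ∑ A, |g A|) fun ω => ?_
  exact Finset.single_le_sum (f := fun A => |g A|) (fun _ _ => abs_nonneg _) (Finset.mem_univ _)

/-- The regret of a round outside the bad event is at most the regret that the selected action has
with respect to the optimistic estimates. -/
lemma integral_good_regret_le (hα : 0 ≤ α) {Sstar : Finset (Fin K)}
    (hS : env.IsOptimal m N ρ Sstar) {t : ℕ} (ht : t ∈ Finset.Icc 1 T) :
    ∫ ω, (badEvent env e S δ t)ᶜ.indicator (fun _ => α * reward m Sstar env.mean) ω ∂P ≤
      ∫ ω, (badEvent env e S δ t)ᶜ.indicator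
        (fun ω => reward m (S t ω) (ucb env e S δ t ω)) ω ∂P := by
  have ht1 : t ≤ T + 1 := by rw [Finset.mem_Icc] at ht; omega
  set G := (badEvent env e S δ t)ᶜ
  have hGm : MeasurableSet[past e S t] G := (measurableSet_badEvent δ t).compl
  have hGm' : MeasurableSet G := hrun.past_le ht1 _ hGm
  set F : Finset (Fin K) → Ω → ℝ := fun A =>
    G.indicator fun ω => reward m A (ucb env e S δ t ω)
  have hF : ∀ A, Measurable[past e S t] (F A) := fun A =>
    (measurable_reward (fun k => measurable_ucb δ t k) A).indicator hGm
  have hFb : ∀ A ω, |F A ω| ≤ K + 1 := by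
    intro A ω
    have h1 := reward_nonneg (m := m) A (ucb_mem (env := env) (e := e) (S := S) δ t ω)
    have h2 := reward_le (m := m) A (ucb_mem (env := env) (e := e) (S := S) δ t ω)
    by_cases hω : ω ∈ G
    · simp only [F]
      rw [Set.indicator_of_mem hω, abs_of_nonneg h1]
      exact h2
    · simp only [F]
      rw [Set.indicator_of_notMem hω, abs_zero]
      positivity
  have hact := fun A => hrun.integral_mul_indicator_action ht (hF A) (hFb A) A
  calc ∫ ω, G.indicator (fun _ => α * reward m Sstar env.mean) ω ∂P
      -- The good event and the estimates belong to the past, so the mean over the rounding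
      -- distribution is the conditional mean over the selected action.
      ≤ ∫ ω, ∑ A, F A ω * (σ t (Z t ω) A).toReal ∂P := by
        refine integral_mono ((integrable_const _).indicator hGm')
          (integrable_finsetSum _ fun A _ => (hact A).1) fun ω => ?_
        by_cases hω : ω ∈ G
        · simp only [F, Set.indicator_of_mem hω]
          have h1 := le_relaxedReward_of_notMem_badEvent hα hS hω (hrun.relaxed t ht ω)
          have h2 := relaxedReward_le_pmfMean (hrun.rounding t ht) (hrun.relaxed t ht ω).1
            (ucb_mem (env := env) (e := e) (S := S) δ t ω)
          refine h1.trans (h2.trans (le_of_eq ?_))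
          exact Finset.sum_congr rfl fun A _ => mul_comm _ _
        · simp only [F, Set.indicator_of_notMem hω, zero_mul, Finset.sum_const_zero, le_refl]
    _ = ∫ ω, ∑ A, F A ω * {ω | S t ω = A}.indicator (fun _ => (1 : ℝ)) ω ∂P := by
        rw [integral_finsetSum _ fun A _ => (hact A).1, integral_finsetSum]
        · exact Finset.sum_congr rfl fun A _ => (hact A).2
        · intro A _
          refine (integrable_of_abs_le (hrun.measurable_of_past ht1 (hF A)) (hFb A)).mul_bdd
            (c := 1) (measurable_const.indicator
              (hrun.measurableSet_action ht A)).aestronglyMeasurable (.of_forall fun ω => ?_)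
          refine (norm_indicator_le_norm_self _ _).trans ?_
          simp
    _ = ∫ ω, G.indicator (fun ω => reward m (S t ω) (ucb env e S δ t ω)) ω ∂P := by
        refine integral_congr_ae (.of_forall fun ω => ?_)
        simp only
        rw [Finset.sum_eq_single (S t ω)]
        · rw [Set.indicator_of_mem (by exact rfl), mul_one]
          by_cases hω : ω ∈ G
          · simp only [F, Set.indicator_of_mem hω]
          · simp only [F, Set.indicator_of_notMem hω]
        · intro A _ hA
          rw [Set.indicator_of_notMem (show ω ∉ {ω | S t ω = A} from fun h => hA (Eq.symm h)),
            mul_zero]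
        · simp

/-- The regret of a round, bounded by the excess of the selected arms and the bad event. -/
lemma integral_regret_le (hα : 0 ≤ α) (hα' : α ≤ 1) {Sstar : Finset (Fin K)}
    (hS : env.IsOptimal m N ρ Sstar) {L : ℝ} (hL : IsLipschitzConst K m N L)
    {t : ℕ} (ht : t ∈ Finset.Icc 1 T) :
    ∫ ω, (α * reward m Sstar env.mean - reward m (S t ω) env.mean) ∂P ≤
      L * ∑ k, ∫ ω, excess env e S δ t k ω * ind (S t ω) k ∂P +
        reward m Sstar env.mean * P.real (badEvent env e S δ t) := by
  have ht1 : t ≤ T + 1 := by rw [Finset.mem_Icc] at ht; omega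
  have hgood := hrun.integral_good_regret_le hα hS ht
  have hBm : MeasurableSet (badEvent env e S δ t) :=
    hrun.past_le ht1 _ (measurableSet_badEvent δ t)
  set B := badEvent env e S δ t
  set r := reward m Sstar env.mean
  have hr : 0 ≤ r := reward_nonneg _ mean_mem
  have hiu : Integrable (fun ω => reward m (S t ω) (ucb env e S δ t ω)) P :=
    integrable_of_abs_le (hrun.measurable_reward_action ht) (C := K + 1) fun ω => by
      rw [abs_of_nonneg (reward_nonneg _ (ucb_mem δ t ω))]
      exact reward_le _ (ucb_mem δ t ω)
  have hir : Integrable (fun ω => reward m (S t ω) env.mean) P :=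
    hrun.integrable_comp_action ht fun A => reward m A env.mean
  have hic : Integrable (Bᶜ.indicator fun _ => α * r) P :=
    (integrable_const _).indicator hBm.compl
  have hix : ∀ k, Integrable (fun ω => excess env e S δ t k ω * ind (S t ω) k) P := fun k =>
    (hrun.integrable_comp_action ht fun A => ind A k).bdd_mul (c := 1)
      (hrun.measurable_of_past ht1 (measurable_excess t k)).aestronglyMeasurable
      (.of_forall fun ω => abs_excess_le t k ω)
  have hix' : Integrable (fun ω => L * ∑ k, excess env e S δ t k ω * ind (S t ω) k) P :=
    (integrable_finsetSum _ fun k _ => hix k).const_mul L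
  have hiB : Integrable (B.indicator fun _ => r) P := (integrable_const _).indicator hBm
  have hgu : Integrable (Bᶜ.indicator fun ω => reward m (S t ω) (ucb env e S δ t ω)) P :=
    hiu.indicator hBm.compl
  have hpt : ∀ᵐ ω ∂P, α * r - reward m (S t ω) env.mean ≤
      (Bᶜ.indicator (fun _ => α * r) ω -
        Bᶜ.indicator (fun ω => reward m (S t ω) (ucb env e S δ t ω)) ω) +
      (L * ∑ k, excess env e S δ t k ω * ind (S t ω) k + B.indicator (fun _ => r) ω) := by
    filter_upwards [hrun.ae_isAction ht] with ω hω
    -- On the bad event the regret is at most the optimal reward, since `α ≤ 1` and rewards are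
    -- nonnegative. Off it, the Lipschitz property is applied between the estimates and the means.
    by_cases h : ω ∈ B
    · have h' : ω ∉ Bᶜ := fun hn => hn h
      have hx : ∀ k, excess env e S δ t k ω = 0 := fun k => Set.indicator_of_notMem h' _
      rw [Set.indicator_of_notMem h', Set.indicator_of_notMem h', Set.indicator_of_mem h]
      simp only [hx, zero_mul, Finset.sum_const_zero, mul_zero]
      have h1 := reward_nonneg (m := m) (S t ω) (mean_mem (env := env))
      have h2 := mul_le_mul_of_nonneg_right hα' hr
      linarith
    · have h' : ω ∈ Bᶜ := h
      have hx : ∀ k, excess env e S δ t k ω = ucb env e S δ t ω k - env.mean k :=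
        fun k => Set.indicator_of_mem h' _
      rw [Set.indicator_of_mem h', Set.indicator_of_mem h', Set.indicator_of_notMem h]
      have h1 := (le_abs_self _).trans
        (hL (S t ω) hω (ucb env e S δ t ω) env.mean (ucb_mem δ t ω) mean_mem)
      have h2 : ∑ k ∈ S t ω, |ucb env e S δ t ω k - env.mean k| =
          ∑ k, excess env e S δ t k ω * ind (S t ω) k := by
        rw [sum_eq_sum_ite]
        refine Finset.sum_congr rfl fun k _ => ?_
        rw [hx k, abs_of_nonneg
          (sub_nonneg.2 (mean_le_ucb (notMem_tailEvent_of_notMem_badEvent h k).1))]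
        rfl
      rw [h2] at h1
      linarith
  refine (integral_mono_ae ((integrable_const _).sub hir) ((hic.sub hgu).add (hix'.add hiB))
    hpt).trans ?_
  rw [integral_add' (hic.sub hgu) (hix'.add hiB), integral_sub' hic hgu, integral_add' hix' hiB,
    integral_const_mul, integral_finsetSum _ fun k _ => hix k, integral_indicator_const _ hBm,
    smul_eq_mul, mul_comm r]
  linarith

/-- The total number of observations is at most `N` per round. -/
lemma sum_integral_obsCount_le :
    ∑ k, ∫ ω, (obsCount env e S (T + 1) k ω : ℝ) ∂P ≤ N * T := by
  rw [← integral_finsetSum _ fun k _ =>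
    hrun.integrable_comp_obsCount k le_rfl fun n => (n : ℝ)]
  have hae : ∀ᵐ ω ∂P, ∀ t ∈ Finset.Icc 1 T, IsAction m N (S t ω) := by
    rw [Filter.eventually_all_finset]
    exact fun t ht => hrun.ae_isAction ht
  calc _ ≤ ∫ _, (N : ℝ) * T ∂P := by
        refine integral_mono_ae (integrable_finsetSum _ fun k _ =>
          hrun.integrable_comp_obsCount k le_rfl fun n => (n : ℝ)) (integrable_const _) ?_
        filter_upwards [hae] with ω hω
        simp_rw [obsCount_eq_sum]
        rw [Finset.sum_comm]
        have hle : ∀ t ∈ Finset.Ico 1 (T + 1), ∑ k, obsInd env e S t k ω ≤ (N : ℝ) := by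
          intro t ht
          have h1 : ∑ k, obsInd env e S t k ω = (observed env e S t ω).card := sum_ind _
          rw [h1]
          have h2 : (observed env e S t ω).card ≤ (S t ω).card :=
            Finset.card_le_card (env.feedback_subset t _ _)
          have ht' : t ∈ Finset.Icc 1 T := by
            rw [Finset.mem_Ico] at ht
            rw [Finset.mem_Icc]
            omega
          exact_mod_cast h2.trans (hω t ht').card_le
        refine (Finset.sum_le_sum hle).trans (le_of_eq ?_)
        rw [Finset.sum_const, nsmul_eq_mul, Nat.card_Ico, Nat.add_sub_cancel]
        ring
    _ = N * T := by simp

end General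

/-! ### Bounds for the confidence parameter `1 / T` -/

section Horizon

variable [IsProbabilityMeasure P] (hrun : IsRun env e S m N T ρ α (1 / (T : ℝ)) P Z σ)
include hrun

lemma sum_measureReal_badEvent_le (hK : 1 ≤ K) (hT : 1 ≤ T) :
    ∑ t ∈ Finset.Icc 1 T, P.real (badEvent env e S (1 / (T : ℝ)) t) ≤ 1 := by
  have h1 : ∀ t ∈ Finset.Icc 1 T, P.real (badEvent env e S (1 / (T : ℝ)) t) ≤
      ∑ k, (P.real (tailEvent env e S (1 / (T : ℝ)) (-1) (env.outcome k) t k) +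
        P.real (tailEvent env e S (1 / (T : ℝ)) 1 (env.cost k) t k)) := by
    intro t _
    refine (measureReal_iUnion_fintype_le _).trans (Finset.sum_le_sum fun k _ => ?_)
    exact measureReal_union_le _ _
  refine (Finset.sum_le_sum h1).trans ?_
  rw [Finset.sum_comm]
  have h2 : ∀ k ∈ (Finset.univ : Finset (Fin K)), ∑ t ∈ Finset.Icc 1 T,
      (P.real (tailEvent env e S (1 / (T : ℝ)) (-1) (env.outcome k) t k) +
        P.real (tailEvent env e S (1 / (T : ℝ)) 1 (env.cost k) t k)) ≤
      1 / (4 * (K * T)) + 1 / (4 * (K * T)) := by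
    intro k _
    rw [Finset.sum_add_distrib]
    exact add_le_add
      (hrun.sum_measureReal_tailEvent_le hK hT (isSample_outcome env k) (by norm_num))
      (hrun.sum_measureReal_tailEvent_le hK hT (isSample_cost env k) (by norm_num))
  refine (Finset.sum_le_sum h2).trans ?_
  have hK' : (1 : ℝ) ≤ K := by exact_mod_cast hK
  have hT' : (1 : ℝ) ≤ T := by exact_mod_cast hT
  rw [Finset.sum_const, Finset.card_univ, Fintype.card_fin, nsmul_eq_mul]
  have h3 : (K : ℝ) * (1 / (4 * (K * T)) + 1 / (4 * (K * T))) = 1 / (2 * T) := by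
    field_simp
    norm_num
  rw [h3, div_le_one (by positivity)]
  linarith

/-- The total excess of an arm at the rounds in which it is observed. -/
lemma sum_integral_excess_le (hK : 1 ≤ K) (hT : 1 ≤ T) (k : Fin K) {n₀ : ℝ} (hn₀ : 0 < n₀) :
    ∑ t ∈ Finset.Icc 1 T,
        ∫ ω, excess env e S (1 / (T : ℝ)) t k ω * obsInd env e S t k ω ∂P ≤
      boundCoeff K T * ((∫ ω, (obsCount env e S (T + 1) k ω : ℝ) ∂P) / √n₀ + √n₀) -
        3 / 5 / boundCoeff K T * √n₀ + 1 / (4 * (K * T)) := by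
  have hbound : ∀ t ∈ Finset.Icc 1 T, t ≤ T + 1 := fun t ht => by
    rw [Finset.mem_Icc] at ht; omega
  have hio : ∀ t ∈ Finset.Icc 1 T, Integrable (fun ω =>
      obsInd env e S t k ω * optimism env e S T t k ω) P := by
    intro t ht
    have h1 := hrun.integrable_mul_obsInd (hrun.integrable_comp_obsCount (env := env) k
      (hbound t ht) fun n => if n = 0 then 1 else radiusCoeff K T / √(n : ℝ)) ht k
    have h2 := hrun.integrable_obsInd_mul_dev (isSample_outcome env k) ht
    refine (h1.add h2).congr (.of_forall fun ω => ?_)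
    simp only [Pi.add_apply, optimism]
    ring
  have hit : ∀ t ∈ Finset.Icc 1 T, MeasurableSet
      (tailEvent env e S (1 / (T : ℝ)) (-1) (env.outcome k) t k) := fun t ht =>
    hrun.past_le (hbound t ht) _ (measurableSet_tailEvent _ _ (env.measurable_outcome k) t k)
  have hle : ∀ t ∈ Finset.Icc 1 T,
      ∫ ω, excess env e S (1 / (T : ℝ)) t k ω * obsInd env e S t k ω ∂P ≤
      ∫ ω, obsInd env e S t k ω * optimism env e S T t k ω ∂P +
        P.real (tailEvent env e S (1 / (T : ℝ)) (-1) (env.outcome k) t k) := by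
    intro t ht
    have hi : Integrable ((tailEvent env e S (1 / (T : ℝ)) (-1) (env.outcome k) t k).indicator
        fun _ => (1 : ℝ)) P := (integrable_const _).indicator (hit t ht)
    have h1 := integral_mono (μ := P) (hrun.integrable_mul_obsInd (integrable_of_abs_le
      (hrun.measurable_of_past (hbound t ht) (measurable_excess t k)) (abs_excess_le t k)) ht k)
      ((hio t ht).add hi) fun ω => excess_mul_obsInd_le hK ht k ω
    rw [integral_add' (hio t ht) hi, integral_indicator_const _ (hit t ht), smul_eq_mul,
      mul_one] at h1
    exact h1
  refine (Finset.sum_le_sum hle).trans ?_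
  rw [Finset.sum_add_distrib, ← integral_finsetSum _ hio]
  exact add_le_add (hrun.integral_sum_optimism_le hK hT (isSample_outcome env k) hn₀)
    (hrun.sum_measureReal_tailEvent_le hK hT (isSample_outcome env k) (by norm_num))

/-- The total excess of all arms at the rounds in which they are observed. -/
lemma sum_sum_integral_excess_le (hN : 1 ≤ N) (hK : 1 ≤ K) (hT : 1 ≤ T) :
    ∑ k, ∑ t ∈ Finset.Icc 1 T,
        ∫ ω, excess env e S (1 / (T : ℝ)) t k ω * obsInd env e S t k ω ∂P ≤
      2 * boundCoeff K T * √(N * K * T : ℝ) := by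
  have hN' : (0 : ℝ) < N := by exact_mod_cast hN
  have hK' : (0 : ℝ) < K := by exact_mod_cast hK
  have hT' : (0 : ℝ) < T := by exact_mod_cast hT
  -- The tangency point is the even share of the at most `N T` observations. It balances `N T / √n₀`
  -- and `K √n₀`, both equal to `√(N K T)`.
  have hn₀ : (0 : ℝ) < N * T / K := by positivity
  have hs : 0 < √(N * T / K : ℝ) := Real.sqrt_pos.2 hn₀
  have hc := boundCoeff_pos hK hT
  refine (Finset.sum_le_sum fun k _ => hrun.sum_integral_excess_le hK hT k hn₀).trans ?_
  have hKs : K * √(N * T / K : ℝ) = √(N * K * T : ℝ) := by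
    have h : (N * K * T : ℝ) = K ^ 2 * (N * T / K) := by field_simp
    rw [h, Real.sqrt_mul (by positivity), Real.sqrt_sq hK'.le]
  have hNs : (N * T : ℝ) / √(N * T / K : ℝ) = √(N * K * T : ℝ) := by
    rw [← hKs, div_eq_iff hs.ne', mul_assoc, Real.mul_self_sqrt hn₀.le]
    field_simp
  have hcount := hrun.sum_integral_obsCount_le
  -- The slack left in the tangent bound covers the tail events of all arms, whose total is at most
  -- `1 / (4 T)`.
  have hslack := slack_ge hK hT hN
  rw [Finset.sum_add_distrib, Finset.sum_sub_distrib, ← Finset.mul_sum, Finset.sum_add_distrib,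
    ← Finset.sum_div, Finset.sum_const, Finset.sum_const, Finset.sum_const, Finset.card_univ,
    Fintype.card_fin, nsmul_eq_mul, nsmul_eq_mul, nsmul_eq_mul, hKs]
  have h1 : (∑ k, ∫ ω, (obsCount env e S (T + 1) k ω : ℝ) ∂P) / √(N * T / K : ℝ) ≤
      √(N * K * T : ℝ) := by
    rw [← hNs]
    exact div_le_div_of_nonneg_right hcount hs.le
  have h2 : (K : ℝ) * (1 / (4 * (K * T))) = 1 / (4 * T) := by field_simp
  have h3 : (K : ℝ) * (3 / 5 / boundCoeff K T * √(N * T / K : ℝ)) =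
      3 / 5 / boundCoeff K T * √(N * K * T : ℝ) := by
    rw [← hKs]
    ring
  rw [h2, h3]
  have h4 := mul_le_mul_of_nonneg_left (add_le_add_left h1 (√(N * K * T : ℝ))) hc.le
  linarith

end Horizon

end IsRun

end RegretBound

end C2MABV

end

/-! ### The regret bound -/

theorem theorem1 {K N T : ℕ} (hN : 1 ≤ N) (hNK : N ≤ K) (hT : 1 ≤ T)
    (m : C2MABV.RewardModel)
    {E : Type*} [MeasurableSpace E] (env : C2MABV.Environment K E)
    {ρ α : ℝ} (hρ : 0 < ρ) (hα : 0 ≤ α) (hα' : α ≤ 1)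
    {Ω : Type*} [MeasurableSpace Ω] (P : Measure Ω) [IsProbabilityMeasure P]
    (e : ℕ → Ω → E) (S : ℕ → Ω → Finset (Fin K))
    (Z : ℕ → Ω → Fin K → ℝ) (σ : ℕ → (Fin K → ℝ) → PMF (Finset (Fin K)))
    (hrun : C2MABV.IsRun env e S m N T ρ α (1 / (T : ℝ)) P Z σ)
    (Sstar : Finset (Fin K)) (hSstar : env.IsOptimal m N ρ Sstar)
    {L : ℝ} (hL : C2MABV.IsLipschitzConst K m N L)
    {oStar : ℝ} (ho : IsLeast (env.obsProbs m N T) oStar) (ho_pos : 0 < oStar) :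
    C2MABV.regret env S m T α P Sstar ≤
      2 * L / oStar * √(2 * N * K * T * Real.log (2 * Real.pi ^ 2 * K * T / 3)) +
        (K + 1) * C2MABV.reward m Sstar env.mean := by
  have hK : 1 ≤ K := hN.trans hNK
  have hL0 := hL.nonneg hN hNK
  have hr : 0 ≤ C2MABV.reward m Sstar env.mean := C2MABV.reward_nonneg _ C2MABV.mean_mem
  have hobs : ∀ t ∈ Finset.Icc 1 T, ∀ A : Finset (Fin K), C2MABV.IsAction m N A →
      oStar ≤ env.obsProb t A := fun t ht A hA => ho.2 ⟨t, ht, A, hA, rfl⟩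
  -- The excess is nonnegative and determined by the past, so passing from selected to observed arms
  -- costs only the factor `1 / oStar`.
  have hstep : ∀ t ∈ Finset.Icc 1 T, ∀ k,
      ∫ ω, C2MABV.excess env e S (1 / (T : ℝ)) t k ω * C2MABV.ind (S t ω) k ∂P ≤
        1 / oStar * ∫ ω, C2MABV.excess env e S (1 / (T : ℝ)) t k ω *
          C2MABV.obsInd env e S t k ω ∂P := by
    intro t ht k
    have h := hrun.mul_integral_action_le hobs ht k 
      (C2MABV.measurable_excess (env := env) (δ := 1 / (T : ℝ)) t k)
      (C2MABV.abs_excess_le t k) (C2MABV.excess_nonneg t k)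
    rw [one_div_mul_eq_div, le_div_iff₀ ho_pos, mul_comm]
    exact h
  have hround : ∀ t ∈ Finset.Icc 1 T,
      ∫ ω, (α * C2MABV.reward m Sstar env.mean - C2MABV.reward m (S t ω) env.mean) ∂P ≤
        L / oStar * ∑ k, ∫ ω, C2MABV.excess env e S (1 / (T : ℝ)) t k ω *
          C2MABV.obsInd env e S t k ω ∂P +
        C2MABV.reward m Sstar env.mean *
          P.real (C2MABV.badEvent env e S (1 / (T : ℝ)) t) := by
    intro t ht
    refine (hrun.integral_regret_le hα hα' hSstar hL ht).trans
      (add_le_add_left ?_ _)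
    have h := mul_le_mul_of_nonneg_left
      (Finset.sum_le_sum fun k (_ : k ∈ Finset.univ) => hstep t ht k) hL0
    refine h.trans (le_of_eq ?_)
    rw [← Finset.mul_sum]
    ring
  have hroot : 2 * C2MABV.boundCoeff K T * √(N * K * T : ℝ) =
      2 * √(2 * N * K * T * Real.log (2 * Real.pi ^ 2 * K * T / 3)) := by
    rw [mul_assoc, C2MABV.boundCoeff, ← Real.sqrt_mul' _ (by positivity)]
    congr 2
    ring
  have hexc := hrun.sum_sum_integral_excess_le hN hK hT
  rw [Finset.sum_comm, hroot] at hexc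
  rw [C2MABV.regret, integral_finsetSum _ fun t ht =>
    hrun.integrable_comp_action ht fun A =>
      α * C2MABV.reward m Sstar env.mean - C2MABV.reward m A env.mean]
  refine (Finset.sum_le_sum hround).trans ?_
  rw [Finset.sum_add_distrib, ← Finset.mul_sum, ← Finset.mul_sum]
  refine add_le_add ?_ ?_
  · refine (mul_le_mul_of_nonneg_left hexc (div_nonneg hL0 ho_pos.le)).trans (le_of_eq ?_)
    ring
  -- The bad rounds cost one optimal reward in total. The first observations are already paid for in
  -- the main term, so the remaining `K` optimal rewards are room to spare.
  · refine (mul_le_mul_of_nonneg_left (hrun.sum_measureReal_badEvent_le hK hT) hr).trans ?_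
    have : 0 ≤ (K : ℝ) * C2MABV.reward m Sstar env.mean := mul_nonneg K.cast_nonneg hr
    linarith
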